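/- Let $n\ge 2$, let $\Omega=\{x\in\mathbb R^n : x_1^2+\dots+x_{n-1}^2<x_n^2\}$ be the open double cone, and let $\Omega_\pm=\{x\in\Omega:\pm x_n>0\}$ be its two half-cones. For $1\le p\le\infty$ let $W^1_p(\Omega)$ be the space of real functions $f\in L^p(\Omega)$ whose distributional gradient $\nabla f$ in $\Omega$ belongs to $L^p(\Omega)$, with the norm $\|f\|_{W^1_p(\Omega)}=\|f\|_{L^p(\Omega)}+\|\nabla f\|_{L^p(\Omega)}$. For $1\le p<\infty$ let $\widetilde W^1_p(\Omega)$ be the closure in $W^1_p(\Omega)$ of the set of restrictions to $\Omega$ of functions in $C_0^\infty(\mathbb R^n)$ (smooth with compact support), and let $\widetilde W^1_\infty(\Omega)$ be the space of bounded Lipschitz functions on $\Omega$ that extend continuously at the origin (functions that agree almost everywhere being identified). If $1\le p\le n$, then $\widetilde W^1_p(\Omega)=W^1_p(\Omega)$. If $n<p\le\infty$, then every $f\in W^1_p(\Omega)$ has a representative that is continuous on $\Omega_+$ and on $\Omega_-$ and that has limits $f(0^+)$ and $f(0^-)$ at the origin from $\Omega_+$ and from $\Omega_-$ respectively (these numbers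 are determined by $f$), and $$\widetilde W^1_p(\Omega)=\{f\in W^1_p(\Omega) : f(0^+)=f(0^-)\};$$ this subspace has codimension $1$ in $W^1_p(\Omega)$. -/

import Mathlib

open MeasureTheory Topology Filter Set
open scoped ENNReal ContDiff

noncomputable section

namespace ConeSobolev

/-! ### First order Sobolev spaces on an open set -/

section Sobolev

variable {n : ℕ}

/-- `g` is the distributional gradient of `f` on `O`: for every test function `φ` with compact
support in `O` and every `i`, `∫_O f ∂ᵢφ = - ∫_O gᵢ φ`. -/
def IsWeakGradient (O : Set (EuclideanSpace ℝ (Fin n))) (f : EuclideanSpace ℝ (Fin n) → ℝ)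
    (g : EuclideanSpace ℝ (Fin n) → EuclideanSpace ℝ (Fin n)) : Prop :=
  ∀ φ : EuclideanSpace ℝ (Fin n) → ℝ, ContDiff ℝ ∞ φ → HasCompactSupport φ → tsupport φ ⊆ O →
    ∀ i : Fin n, ∫ x in O, f x * fderiv ℝ φ x (EuclideanSpace.single i 1)
      = - ∫ x in O, g x i * φ x

variable {O : TopologicalSpace.Opens (EuclideanSpace ℝ (Fin n))} {p : ℝ≥0∞} [hp : Fact (1 ≤ p)]

theorem integrable_mul_fderiv (f : Lp ℝ p (volume.restrict (O : Set (EuclideanSpace ℝ (Fin n)))))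
    {φ : EuclideanSpace ℝ (Fin n) → ℝ} (h1 : ContDiff ℝ ∞ φ) (h2 : HasCompactSupport φ)
    (v : EuclideanSpace ℝ (Fin n)) :
    Integrable (fun x => f x * fderiv ℝ φ x v) (volume.restrict O) := by
  have hf := (Lp.memLp f).locallyIntegrable hp.out
  have hc : Continuous (fun x => fderiv ℝ φ x v) :=
    (h1.continuous_fderiv (by simp)).clm_apply continuous_const
  exact hf.integrable_smul_right_of_hasCompactSupport hc (h2.fderiv_apply (𝕜 := ℝ) v)

theorem memLp_coord
    (g : Lp (EuclideanSpace ℝ (Fin n)) p (volume.restrict (O : Set (EuclideanSpace ℝ (Fin n)))))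
    (i : Fin n) : MemLp (fun x => g x i) p (volume.restrict O) :=
  (EuclideanSpace.proj (𝕜 := ℝ) i).comp_memLp' (Lp.memLp g)

theorem integrable_coord_mul
    (g : Lp (EuclideanSpace ℝ (Fin n)) p (volume.restrict (O : Set (EuclideanSpace ℝ (Fin n)))))
    {φ : EuclideanSpace ℝ (Fin n) → ℝ} (h1 : ContDiff ℝ ∞ φ) (h2 : HasCompactSupport φ)
    (i : Fin n) : Integrable (fun x => g x i * φ x) (volume.restrict O) :=
  ((memLp_coord g i).locallyIntegrable hp.out).integrable_smul_right_of_hasCompactSupport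
    h1.continuous h2

theorem IsWeakGradient.zero :
    IsWeakGradient (O : Set (EuclideanSpace ℝ (Fin n)))
      (0 : Lp ℝ p (volume.restrict (O : Set (EuclideanSpace ℝ (Fin n)))))
      (0 : Lp (EuclideanSpace ℝ (Fin n)) p
        (volume.restrict (O : Set (EuclideanSpace ℝ (Fin n))))) := by
  intro φ _ _ _ i
  rw [integral_eq_zero_of_ae, integral_eq_zero_of_ae, neg_zero]
  · filter_upwards [Lp.coeFn_zero (EuclideanSpace ℝ (Fin n)) p
      (volume.restrict (O : Set (EuclideanSpace ℝ (Fin n))))] with x hx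
    rw [hx]; simp
  · filter_upwards [Lp.coeFn_zero ℝ p
      (volume.restrict (O : Set (EuclideanSpace ℝ (Fin n))))] with x hx
    rw [hx]; simp

theorem IsWeakGradient.add
    {f f' : Lp ℝ p (volume.restrict (O : Set (EuclideanSpace ℝ (Fin n))))}
    {g g' : Lp (EuclideanSpace ℝ (Fin n)) p
      (volume.restrict (O : Set (EuclideanSpace ℝ (Fin n))))}
    (h : IsWeakGradient (O : Set (EuclideanSpace ℝ (Fin n))) f g)
    (h' : IsWeakGradient (O : Set (EuclideanSpace ℝ (Fin n))) f' g') :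
    IsWeakGradient (O : Set (EuclideanSpace ℝ (Fin n))) (f + f' : Lp ℝ p _)
      (g + g' : Lp (EuclideanSpace ℝ (Fin n)) p _) := by
  intro φ h1 h2 h3 i
  have e1 : ∫ x in O, (f + f' : Lp ℝ p _) x * fderiv ℝ φ x (EuclideanSpace.single i 1)
      = (∫ x in O, f x * fderiv ℝ φ x (EuclideanSpace.single i 1))
        + ∫ x in O, f' x * fderiv ℝ φ x (EuclideanSpace.single i 1) := by
    rw [← integral_add (integrable_mul_fderiv f h1 h2 _) (integrable_mul_fderiv f' h1 h2 _)]
    refine integral_congr_ae ?_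
    filter_upwards [Lp.coeFn_add f f'] with x hx
    rw [hx]; simp [add_mul]
  have e2 : ∫ x in O, (g + g' : Lp (EuclideanSpace ℝ (Fin n)) p _) x i * φ x
      = (∫ x in O, g x i * φ x) + ∫ x in O, g' x i * φ x := by
    rw [← integral_add (integrable_coord_mul g h1 h2 i) (integrable_coord_mul g' h1 h2 i)]
    refine integral_congr_ae ?_
    filter_upwards [Lp.coeFn_add g g'] with x hx
    rw [hx]; simp [add_mul]
  rw [e1, e2, h φ h1 h2 h3 i, h' φ h1 h2 h3 i]
  ring

theorem IsWeakGradient.smul (c : ℝ)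
    {f : Lp ℝ p (volume.restrict (O : Set (EuclideanSpace ℝ (Fin n))))}
    {g : Lp (EuclideanSpace ℝ (Fin n)) p
      (volume.restrict (O : Set (EuclideanSpace ℝ (Fin n))))}
    (h : IsWeakGradient (O : Set (EuclideanSpace ℝ (Fin n))) f g) :
    IsWeakGradient (O : Set (EuclideanSpace ℝ (Fin n))) (c • f : Lp ℝ p _)
      (c • g : Lp (EuclideanSpace ℝ (Fin n)) p _) := by
  intro φ h1 h2 h3 i
  have e1 : ∫ x in O, (c • f : Lp ℝ p _) x * fderiv ℝ φ x (EuclideanSpace.single i 1)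
      = c * ∫ x in O, f x * fderiv ℝ φ x (EuclideanSpace.single i 1) := by
    rw [← integral_const_mul]
    refine integral_congr_ae ?_
    filter_upwards [Lp.coeFn_smul c f] with x hx
    rw [hx]; simp [mul_assoc]
  have e2 : ∫ x in O, (c • g : Lp (EuclideanSpace ℝ (Fin n)) p _) x i * φ x
      = c * ∫ x in O, g x i * φ x := by
    rw [← integral_const_mul]
    refine integral_congr_ae ?_
    filter_upwards [Lp.coeFn_smul c g] with x hx
    rw [hx]; simp [mul_assoc]
  rw [e1, e2, h φ h1 h2 h3 i]
  ring

theorem IsWeakGradient.unique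
    {f : Lp ℝ p (volume.restrict (O : Set (EuclideanSpace ℝ (Fin n))))}
    {g g' : Lp (EuclideanSpace ℝ (Fin n)) p
      (volume.restrict (O : Set (EuclideanSpace ℝ (Fin n))))}
    (h : IsWeakGradient (O : Set (EuclideanSpace ℝ (Fin n))) f g)
    (h' : IsWeakGradient (O : Set (EuclideanSpace ℝ (Fin n))) f g') : g = g' := by
  have key : ∀ i : Fin n, ∀ᵐ x ∂(volume.restrict (O : Set (EuclideanSpace ℝ (Fin n)))),
      g x i - g' x i = 0 := by
    intro i
    have hl : LocallyIntegrable (fun x => g x i - g' x i)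
        (volume.restrict (O : Set (EuclideanSpace ℝ (Fin n)))) :=
      ((memLp_coord g i).locallyIntegrable hp.out).sub
        ((memLp_coord g' i).locallyIntegrable hp.out)
    have := O.isOpen.ae_eq_zero_of_integral_contDiff_smul_eq_zero
      (hl.locallyIntegrableOn (O : Set (EuclideanSpace ℝ (Fin n)))) (fun φ h1 h2 h3 => by
        have e : ∀ x, φ x • (g x i - g' x i) = g x i * φ x - g' x i * φ x := by
          intro x; simp only [smul_eq_mul]; ring
        simp only [e]
        rw [integral_sub (integrable_coord_mul g h1 h2 i) (integrable_coord_mul g' h1 h2 i)]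
        have a := h φ h1 h2 h3 i
        have b := h' φ h1 h2 h3 i
        linarith)
    filter_upwards [this, ae_restrict_mem O.isOpen.measurableSet] with x hx hO
    exact hx hO
  refine Lp.ext ?_
  filter_upwards [ae_all_iff.2 key] with x hx
  ext i
  exact sub_eq_zero.1 (hx i)

variable (O p)

/-- The space `W^1_p(O)`, as a subspace of `L^p(O)`: the functions whose distributional gradient
belongs to `L^p(O)`. -/
def sobolev : Submodule ℝ (Lp ℝ p (volume.restrict (O : Set (EuclideanSpace ℝ (Fin n))))) where
  carrier := {f | ∃ g : Lp (EuclideanSpace ℝ (Fin n)) p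
    (volume.restrict (O : Set (EuclideanSpace ℝ (Fin n)))),
      IsWeakGradient (O : Set (EuclideanSpace ℝ (Fin n))) f g}
  zero_mem' := ⟨0, IsWeakGradient.zero⟩
  add_mem' := by
    rintro f f' ⟨g, h⟩ ⟨g', h'⟩
    exact ⟨g + g', h.add h'⟩
  smul_mem' := by
    rintro c f ⟨g, h⟩
    exact ⟨c • g, h.smul c⟩

/-- The space `W^1_p(O)` as a type of its own, to be equipped with the Sobolev norm
(rather than with the norm inherited from `L^p(O)`). -/
def SobolevSpace : Type := ↥(sobolev O p)

instance : AddCommGroup (SobolevSpace O p) := inferInstanceAs (AddCommGroup ↥(sobolev O p))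

instance : Module ℝ (SobolevSpace O p) := inferInstanceAs (Module ℝ ↥(sobolev O p))

/-- The inclusion of `W^1_p(O)` in `L^p(O)`. -/
def SobolevSpace.val :
    SobolevSpace O p →ₗ[ℝ] Lp ℝ p (volume.restrict (O : Set (EuclideanSpace ℝ (Fin n)))) :=
  (sobolev O p).subtype

theorem SobolevSpace.exists_grad (f : SobolevSpace O p) :
    ∃ g : Lp (EuclideanSpace ℝ (Fin n)) p
      (volume.restrict (O : Set (EuclideanSpace ℝ (Fin n)))),
      IsWeakGradient (O : Set (EuclideanSpace ℝ (Fin n))) (SobolevSpace.val O p f) g :=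
  f.2

/-- The distributional gradient `∇f ∈ L^p(O; ℝⁿ)` of `f ∈ W^1_p(O)`. -/
def SobolevSpace.grad : SobolevSpace O p →ₗ[ℝ]
    Lp (EuclideanSpace ℝ (Fin n)) p (volume.restrict (O : Set (EuclideanSpace ℝ (Fin n)))) where
  toFun f := (SobolevSpace.exists_grad O p f).choose
  map_add' f f' := by
    refine IsWeakGradient.unique (SobolevSpace.exists_grad O p (f + f')).choose_spec ?_
    rw [map_add]
    exact (SobolevSpace.exists_grad O p f).choose_spec.add
      (SobolevSpace.exists_grad O p f').choose_spec
  map_smul' c f := by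
    refine IsWeakGradient.unique (SobolevSpace.exists_grad O p (c • f)).choose_spec ?_
    rw [map_smul]
    exact (SobolevSpace.exists_grad O p f).choose_spec.smul c

/-- `‖f‖_{W^1_p(O)} = ‖f‖_{L^p(O)} + ‖∇f‖_{L^p(O)}`. -/
def sobolevNorm : AddGroupNorm (SobolevSpace O p) where
  toFun f := ‖SobolevSpace.val O p f‖ + ‖SobolevSpace.grad O p f‖
  map_zero' := by simp
  add_le' f f' := by
    rw [map_add, map_add]
    have h1 := norm_add_le (SobolevSpace.val O p f) (SobolevSpace.val O p f')
    have h2 := norm_add_le (SobolevSpace.grad O p f) (SobolevSpace.grad O p f')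
    linarith
  neg' f := by rw [map_neg, map_neg, norm_neg, norm_neg]
  eq_zero_of_map_eq_zero' f h := by
    have h1 := norm_nonneg (SobolevSpace.val O p f)
    have h2 := norm_nonneg (SobolevSpace.grad O p f)
    have h3 : SobolevSpace.val O p f = 0 := norm_eq_zero.1 (by linarith)
    exact Subtype.ext h3

instance : NormedAddCommGroup (SobolevSpace O p) := (sobolevNorm O p).toNormedAddCommGroup

theorem SobolevSpace.norm_def (f : SobolevSpace O p) :
    ‖f‖ = ‖SobolevSpace.val O p f‖ + ‖SobolevSpace.grad O p f‖ := rfl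

instance : NormedSpace ℝ (SobolevSpace O p) where
  norm_smul_le c f := by
    rw [SobolevSpace.norm_def, SobolevSpace.norm_def, map_smul, map_smul, norm_smul, norm_smul,
      mul_add]

/-- The restrictions to `O` of the functions of class `C_0^∞(ℝⁿ)`, as a subspace of
`W^1_p(O)`. -/
def testRestrictions : Submodule ℝ (SobolevSpace O p) where
  carrier := {f | ∃ φ : EuclideanSpace ℝ (Fin n) → ℝ, ContDiff ℝ ∞ φ ∧ HasCompactSupport φ ∧
    SobolevSpace.val O p f =ᵐ[volume.restrict (O : Set (EuclideanSpace ℝ (Fin n)))] φ}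
  zero_mem' := ⟨0, contDiff_const, HasCompactSupport.zero, by
    rw [map_zero]; exact Lp.coeFn_zero _ _ _⟩
  add_mem' := by
    rintro f f' ⟨φ, h1, h2, h3⟩ ⟨φ', h1', h2', h3'⟩
    refine ⟨φ + φ', h1.add h1', h2.add h2', ?_⟩
    rw [map_add]
    exact (Lp.coeFn_add _ _).trans (h3.add h3')
  smul_mem' := by
    rintro c f ⟨φ, h1, h2, h3⟩
    refine ⟨c • φ, h1.const_smul c, h2.smul_left (f := fun _ => c), ?_⟩
    rw [map_smul]
    exact (Lp.coeFn_smul _ _).trans (h3.const_smul c)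

/-- The classes of the bounded Lipschitz functions on `O` that extend continuously at the
origin. -/
def boundedLipschitz :
    Submodule ℝ (Lp ℝ p (volume.restrict (O : Set (EuclideanSpace ℝ (Fin n))))) where
  carrier := {f | ∃ g : EuclideanSpace ℝ (Fin n) → ℝ,
    f =ᵐ[volume.restrict (O : Set (EuclideanSpace ℝ (Fin n)))] g ∧
    (∃ K, LipschitzOnWith K g (O : Set (EuclideanSpace ℝ (Fin n)))) ∧
    (∃ M, ∀ x ∈ O, |g x| ≤ M) ∧
    ∃ c, Tendsto g (𝓝[(O : Set (EuclideanSpace ℝ (Fin n)))] 0) (𝓝 c)}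
  zero_mem' := ⟨0, Lp.coeFn_zero _ _ _, ⟨0, (LipschitzWith.const 0).lipschitzOnWith⟩, ⟨0, by simp⟩,
    0, tendsto_const_nhds⟩
  add_mem' := by
    rintro f f' ⟨g, h, ⟨K, hK⟩, ⟨M, hM⟩, c, hc⟩ ⟨g', h', ⟨K', hK'⟩, ⟨M', hM'⟩, c', hc'⟩
    exact ⟨g + g', (Lp.coeFn_add _ _).trans (h.add h'), ⟨K + K', hK.add hK'⟩,
      ⟨M + M', fun x hx => (abs_add_le _ _).trans (add_le_add (hM x hx) (hM' x hx))⟩,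
      c + c', hc.add hc'⟩
  smul_mem' := by
    rintro a f ⟨g, h, ⟨K, hK⟩, ⟨M, hM⟩, c, hc⟩
    refine ⟨a • g, (Lp.coeFn_smul _ _).trans (h.const_smul a), ⟨‖a‖₊ * K, ?_⟩,
      ⟨|a| * M, fun x hx => ?_⟩, a • c, hc.const_smul a⟩
    · exact (lipschitzWith_smul a).comp_lipschitzOnWith hK
    · simp only [Pi.smul_apply, smul_eq_mul, abs_mul]
      exact mul_le_mul_of_nonneg_left (hM x hx) (abs_nonneg a)

open Classical in
/-- The space `W̃^1_p(O)`: for `p < ∞` the closure in `W^1_p(O)`, for the Sobolev norm, of the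
restrictions to `O` of the functions of class `C_0^∞(ℝⁿ)`; for `p = ∞` the space of bounded
Lipschitz functions on `O` that extend continuously at the origin. -/
def sobolevTilde :
    Submodule ℝ (Lp ℝ p (volume.restrict (O : Set (EuclideanSpace ℝ (Fin n))))) :=
  if p = (⊤ : ℝ≥0∞) then boundedLipschitz O p
  else (testRestrictions O p).topologicalClosure.map (SobolevSpace.val O p)

end Sobolev

/-! ### The double cone, in dimension `m + 1` -/

/-- The double cone `x₁² + ⋯ + xₘ² < xₘ₊₁²` in `ℝ^(m+1)`. -/
def cone (m : ℕ) : TopologicalSpace.Opens (EuclideanSpace ℝ (Fin (m + 1))) where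
  carrier := {x | ∑ i : Fin m, x i.castSucc ^ 2 < x (Fin.last m) ^ 2}
  is_open' := isOpen_lt (by fun_prop) (by fun_prop)

/-- The upper half-cone `Ω₊`. -/
def upperCone (m : ℕ) : Set (EuclideanSpace ℝ (Fin (m + 1))) :=
  {x | x ∈ cone m ∧ 0 < x (Fin.last m)}

/-- The lower half-cone `Ω₋`. -/
def lowerCone (m : ℕ) : Set (EuclideanSpace ℝ (Fin (m + 1))) :=
  {x | x ∈ cone m ∧ x (Fin.last m) < 0}

/-- `c` is the limit of `f` at the origin from `U`, where `f` is defined up to null sets and is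
identified on `U` with its continuous representative. -/
def HasLimitAtVertex {n : ℕ} (U : Set (EuclideanSpace ℝ (Fin n)))
    (f : EuclideanSpace ℝ (Fin n) → ℝ) (c : ℝ) : Prop :=
  ∃ g : EuclideanSpace ℝ (Fin n) → ℝ, f =ᵐ[volume.restrict U] g ∧ ContinuousOn g U ∧
    Tendsto g (𝓝[U] 0) (𝓝 c)

end ConeSobolev

end

/-! ### Classical gradients and distributional gradients -/

namespace ConeSobolev

variable {n : ℕ}

/-! Each half-cone `U` is an open convex cone: `U + U ⊆ U` and `tU ⊆ U` for `t > 0`. The half-cones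
meet only at the vertex, so everything depends on what `W^1_p` can see of a single point.

For `p < ∞`, mollifying with a kernel supported in `-U` near the origin uses at `x ∈ U` only values
at points of `U`. Together with a cutoff at infinity this makes test functions dense on each
half-cone (`IsOpenConvexCone.exists_testFunction_approx`). Two test functions that vanish near the
origin can be glued into one by a cutoff that is homogeneous of degree zero (`exists_glue`,
`mem_closure_of_half_cones`). It remains to make a test function `φ` vanish near the origin at small
cost: subtract `φ(0) η` with `η(0) = 1`, then cut off, which is cheap because the difference is
Lipschitz and vanishes at the origin (`exists_sobolevDist_le_add`).

If `p ≤ n`, the origin has zero capacity, so `η` can be chosen with arbitrarily small norm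
(`exists_testFunction_eq_one_of_le`); there is no obstruction.

If `n < p < ∞`, integration along rays from the vertex gives `|φ(0)| ≤ C ‖φ‖` on `U`. Translation by
`x ∈ U` maps `U` into itself, hence the same constant bounds `|φ(x)|`. Smooth approximants therefore
converge uniformly on `U ∪ {0}`, so a limit at the vertex exists and depends continuously on `f`
(`IsOpenConvexCone.exists_hasLimitAtVertex`). If this limit is zero, `|φ(0)|` is small for `φ` near
`f`, and a fixed `η` suffices; a common limit `c` is reduced to zero by subtracting `c η`.
Conversely, a test function has equal limits on both sides, and equality passes to the closure.

If `p = ∞`, a `W^1_∞` function on the convex set `U` has a Lipschitz representative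
(`exists_lipschitzWith_ae_eq`). Two such representatives with the same value at the vertex form one
Lipschitz function, because points of opposite half-cones are at least as far apart as a fixed
multiple of their norms (`mem_boundedLipschitz_of_limit`).

Finally, for `p > n` the tilde space is the kernel of the difference of the two limits, a nonzero
linear functional. -/

theorem gradient_apply (φ : EuclideanSpace ℝ (Fin n) → ℝ) (x : EuclideanSpace ℝ (Fin n))
    (i : Fin n) : gradient φ x i = fderiv ℝ φ x (EuclideanSpace.single i 1) := by
  rw [← inner_gradient_left, EuclideanSpace.inner_single_right]
  simp

theorem norm_gradient (φ : EuclideanSpace ℝ (Fin n) → ℝ) (x : EuclideanSpace ℝ (Fin n)) :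
    ‖gradient φ x‖ = ‖fderiv ℝ φ x‖ :=
  LinearIsometryEquiv.norm_map _ _

theorem continuous_gradient {φ : EuclideanSpace ℝ (Fin n) → ℝ} (h : ContDiff ℝ ∞ φ) :
    Continuous (gradient φ) :=
  (InnerProductSpace.toDual ℝ _).symm.continuous.comp (h.continuous_fderiv (by simp))

theorem hasCompactSupport_gradient {φ : EuclideanSpace ℝ (Fin n) → ℝ}
    (h : HasCompactSupport φ) : HasCompactSupport (gradient φ) :=
  (h.fderiv (𝕜 := ℝ)).comp_left (g := (InnerProductSpace.toDual ℝ _).symm) (map_zero _)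

theorem gradient_sub {φ ψ : EuclideanSpace ℝ (Fin n) → ℝ} {x : EuclideanSpace ℝ (Fin n)}
    (h : DifferentiableAt ℝ φ x) (h' : DifferentiableAt ℝ ψ x) :
    gradient (fun y => φ y - ψ y) x = gradient φ x - gradient ψ x := by
  ext i
  rw [PiLp.sub_apply, gradient_apply, gradient_apply, gradient_apply, fderiv_fun_sub h h']
  rfl

theorem gradient_mul {φ ψ : EuclideanSpace ℝ (Fin n) → ℝ} {x : EuclideanSpace ℝ (Fin n)}
    (h : DifferentiableAt ℝ φ x) (h' : DifferentiableAt ℝ ψ x) :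
    gradient (fun y => φ y * ψ y) x = φ x • gradient ψ x + ψ x • gradient φ x := by
  ext i
  rw [PiLp.add_apply, PiLp.smul_apply, PiLp.smul_apply, gradient_apply, gradient_apply,
    gradient_apply, fderiv_fun_mul h h']
  rfl

theorem gradient_const_mul {φ : EuclideanSpace ℝ (Fin n) → ℝ} {x : EuclideanSpace ℝ (Fin n)}
    (h : DifferentiableAt ℝ φ x) (c : ℝ) :
    gradient (fun y => c * φ y) x = c • gradient φ x := by
  ext i
  rw [PiLp.smul_apply, gradient_apply, gradient_apply, fderiv_const_mul h]
  rfl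

theorem gradient_comp_smul (φ : EuclideanSpace ℝ (Fin n) → ℝ) (c : ℝ)
    (x : EuclideanSpace ℝ (Fin n)) :
    gradient (fun y => φ (c • y)) x = c • gradient φ (c • x) := by
  ext i
  rw [PiLp.smul_apply, gradient_apply, gradient_apply, fderiv_comp_smul]
  rfl

theorem gradient_comp_add_right (φ : EuclideanSpace ℝ (Fin n) → ℝ)
    (a x : EuclideanSpace ℝ (Fin n)) :
    gradient (fun y => φ (y + a)) x = gradient φ (x + a) := by
  ext i
  rw [gradient_apply, gradient_apply, fderiv_comp_add_right]

theorem memLp_of_contDiff {φ : EuclideanSpace ℝ (Fin n) → ℝ} (h : ContDiff ℝ ∞ φ)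
    (hc : HasCompactSupport φ) (p : ℝ≥0∞) (μ : Measure (EuclideanSpace ℝ (Fin n)))
    [IsFiniteMeasureOnCompacts μ] : MemLp φ p μ :=
  h.continuous.memLp_of_hasCompactSupport hc

theorem memLp_gradient {φ : EuclideanSpace ℝ (Fin n) → ℝ} (h : ContDiff ℝ ∞ φ)
    (hc : HasCompactSupport φ) (p : ℝ≥0∞) (μ : Measure (EuclideanSpace ℝ (Fin n)))
    [IsFiniteMeasureOnCompacts μ] : MemLp (gradient φ) p μ :=
  (continuous_gradient h).memLp_of_hasCompactSupport (hasCompactSupport_gradient hc)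

theorem setIntegral_eq_integral_of_tsupport_subset {O : Set (EuclideanSpace ℝ (Fin n))}
    {φ h : EuclideanSpace ℝ (Fin n) → ℝ} (hs : tsupport φ ⊆ O)
    (hh : ∀ x, x ∉ tsupport φ → h x = 0) : ∫ x in O, h x = ∫ x, h x :=
  setIntegral_eq_integral_of_forall_compl_eq_zero fun x hx => hh x fun hx' => hx (hs hx')

theorem fderiv_apply_eq_zero_of_notMem_tsupport {φ : EuclideanSpace ℝ (Fin n) → ℝ}
    {x : EuclideanSpace ℝ (Fin n)} (hx : x ∉ tsupport φ) (v : EuclideanSpace ℝ (Fin n)) :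
    fderiv ℝ φ x v = 0 := by
  rw [image_eq_zero_of_notMem_tsupport fun h => hx (tsupport_fderiv_subset ℝ h)]
  rfl

theorem integrable_mul_of_continuousOn {O : Set (EuclideanSpace ℝ (Fin n))}
    {φ h ψ : EuclideanSpace ℝ (Fin n) → ℝ} (hc : HasCompactSupport φ) (hs : tsupport φ ⊆ O)
    (hh : ContinuousOn h O) (hψ : Continuous ψ) (hz : ∀ x, x ∉ tsupport φ → ψ x = 0) :
    Integrable (fun x => h x * ψ x) := by
  have h1 : IntegrableOn (fun x => h x * ψ x) (tsupport φ) :=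
    ((hh.mono hs).mul hψ.continuousOn).integrableOn_compact hc
  rwa [integrableOn_iff_integrable_of_support_subset] at h1
  intro x hx
  by_contra hx'
  exact hx (by simp [hz x hx'])

/-- The classical gradient of a function of class `C¹` on an open set is its distributional
gradient. -/
theorem isWeakGradient_gradient {O : Set (EuclideanSpace ℝ (Fin n))} (hO : IsOpen O)
    {f : EuclideanSpace ℝ (Fin n) → ℝ} (hf : ContDiffOn ℝ 1 f O) :
    IsWeakGradient O f (gradient f) := by
  intro φ h1 h2 h3 i
  have hd : ∀ x ∈ O, DifferentiableAt ℝ f x := fun x hx =>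
    (hf.differentiableOn (by simp)).differentiableAt (hO.mem_nhds hx)
  have hfd : ContinuousOn (fun x => fderiv ℝ f x (EuclideanSpace.single i 1)) O :=
    (hf.continuousOn_fderiv_of_isOpen hO le_rfl).clm_apply continuousOn_const
  have hφc : Continuous fun x => fderiv ℝ φ x (EuclideanSpace.single i 1) :=
    (h1.continuous_fderiv (by simp)).clm_apply continuous_const
  have hz : ∀ x, x ∉ tsupport φ → φ x = 0 := fun x => image_eq_zero_of_notMem_tsupport
  have hz' : ∀ x, x ∉ tsupport φ → fderiv ℝ φ x (EuclideanSpace.single i 1) = 0 :=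
    fun x hx => fderiv_apply_eq_zero_of_notMem_tsupport hx _
  simp_rw [gradient_apply]
  rw [setIntegral_eq_integral_of_tsupport_subset h3 (fun x hx => by simp [hz' x hx]),
    setIntegral_eq_integral_of_tsupport_subset h3 (fun x hx => by simp [hz x hx])]
  -- Integration by parts over the whole space: `f` need be differentiable only on the support of
  -- `φ`, so its values outside `O` are harmless.
  exact integral_mul_fderiv_eq_neg_fderiv_mul_of_integrable
    (integrable_mul_of_continuousOn h2 h3 hfd h1.continuous hz)
    (integrable_mul_of_continuousOn h2 h3 hf.continuousOn hφc hz')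
    (integrable_mul_of_continuousOn h2 h3 hf.continuousOn h1.continuous hz)
    (fun x hx => hd x (h3 hx)) (fun x _ => (h1.differentiable (by simp)) x)

theorem IsWeakGradient.mono {O O' : Set (EuclideanSpace ℝ (Fin n))}
    {f : EuclideanSpace ℝ (Fin n) → ℝ} {g : EuclideanSpace ℝ (Fin n) → EuclideanSpace ℝ (Fin n)}
    (h : IsWeakGradient O f g) (hOO : O' ⊆ O) : IsWeakGradient O' f g := by
  intro φ h1 h2 h3 i
  have := h φ h1 h2 (h3.trans hOO) i
  have hz : ∀ x, x ∉ tsupport φ → φ x = 0 := fun x => image_eq_zero_of_notMem_tsupport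
  have hz' : ∀ x, x ∉ tsupport φ → fderiv ℝ φ x (EuclideanSpace.single i 1) = 0 :=
    fun x hx => fderiv_apply_eq_zero_of_notMem_tsupport hx _
  rw [setIntegral_eq_integral_of_tsupport_subset (h3.trans hOO) (fun x hx => by simp [hz' x hx]),
    setIntegral_eq_integral_of_tsupport_subset (h3.trans hOO) (fun x hx => by simp [hz x hx])]
    at this
  rw [setIntegral_eq_integral_of_tsupport_subset h3 (fun x hx => by simp [hz' x hx]),
    setIntegral_eq_integral_of_tsupport_subset h3 (fun x hx => by simp [hz x hx]), this]

theorem IsWeakGradient.congr {O : Set (EuclideanSpace ℝ (Fin n))}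
    {f f' : EuclideanSpace ℝ (Fin n) → ℝ}
    {g g' : EuclideanSpace ℝ (Fin n) → EuclideanSpace ℝ (Fin n)} (h : IsWeakGradient O f g)
    (hf : f =ᵐ[volume.restrict O] f') (hg : g =ᵐ[volume.restrict O] g') :
    IsWeakGradient O f' g' := by
  intro φ h1 h2 h3 i
  have e1 : ∫ x in O, f' x * fderiv ℝ φ x (EuclideanSpace.single i 1)
      = ∫ x in O, f x * fderiv ℝ φ x (EuclideanSpace.single i 1) :=
    integral_congr_ae (by filter_upwards [hf] with x hx; rw [hx])
  have e2 : ∫ x in O, g' x i * φ x = ∫ x in O, g x i * φ x :=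
    integral_congr_ae (by filter_upwards [hg] with x hx; rw [hx])
  rw [e1, e2, h φ h1 h2 h3 i]

end ConeSobolev

/-! ### Mollification -/

namespace ConeSobolev

variable {n : ℕ}

/-- The convolution of a scalar kernel with a vector-valued function. -/
noncomputable def mollify {F : Type*} [NormedAddCommGroup F] [NormedSpace ℝ F]
    (k : EuclideanSpace ℝ (Fin n) → ℝ) (f : EuclideanSpace ℝ (Fin n) → F) :
    EuclideanSpace ℝ (Fin n) → F :=
  convolution k f (ContinuousLinearMap.lsmul ℝ ℝ) volume

theorem contDiff_mollify {k : EuclideanSpace ℝ (Fin n) → ℝ} (hk : ContDiff ℝ ∞ k)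
    (hkc : HasCompactSupport k) {f : EuclideanSpace ℝ (Fin n) → ℝ}
    (hf : LocallyIntegrable f volume) : ContDiff ℝ ∞ (mollify k f) :=
  hkc.contDiff_convolution_left _ hk hf

theorem fderiv_mollify_apply {k : EuclideanSpace ℝ (Fin n) → ℝ} (hk : ContDiff ℝ ∞ k)
    (hkc : HasCompactSupport k) {f : EuclideanSpace ℝ (Fin n) → ℝ}
    (hf : LocallyIntegrable f volume) (x v : EuclideanSpace ℝ (Fin n)) :
    fderiv ℝ (mollify k f) x v = ∫ t, f t * fderiv ℝ k (x - t) v := by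
  -- With the kernel as the right factor, the derivative of the convolution falls on `k`.
  have e : mollify k f = convolution f k (ContinuousLinearMap.mul ℝ ℝ) volume := by
    ext y
    rw [mollify, convolution_lsmul_swap, convolution_def]
    simp [mul_comm]
  rw [e, (hkc.hasFDerivAt_convolution_right (ContinuousLinearMap.mul ℝ ℝ) hf
    (hk.of_le (by simp)) x).fderiv, convolution_precompR_apply _ hf (hkc.fderiv (𝕜 := ℝ))
    (hk.continuous_fderiv (by simp))]
  rfl

theorem integrable_kernel_smul {F : Type*} [NormedAddCommGroup F] [NormedSpace ℝ F]
    {k : EuclideanSpace ℝ (Fin n) → ℝ} (hk : Continuous k)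
    (hkc : HasCompactSupport k) {f : EuclideanSpace ℝ (Fin n) → F}
    (hf : LocallyIntegrable f volume) (x : EuclideanSpace ℝ (Fin n)) :
    Integrable (fun t => k t • f (x - t)) :=
  hkc.convolutionExists_left (ContinuousLinearMap.lsmul ℝ ℝ) hk hf x

theorem mollify_apply_coord {k : EuclideanSpace ℝ (Fin n) → ℝ} (hk : Continuous k)
    (hkc : HasCompactSupport k) {g : EuclideanSpace ℝ (Fin n) → EuclideanSpace ℝ (Fin n)}
    (hg : LocallyIntegrable g volume) (x : EuclideanSpace ℝ (Fin n)) (i : Fin n) :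
    mollify k g x i = ∫ t, g t i * k (x - t) := by
  have h1 : mollify k g x i = ∫ t, (k t • g (x - t)) i := by
    rw [mollify, convolution_lsmul]
    exact ((EuclideanSpace.proj (𝕜 := ℝ) i).integral_comp_comm
      (integrable_kernel_smul hk hkc hg x)).symm
  rw [h1, ← integral_sub_left_eq_self _ volume x]
  simp [mul_comm]

/-- By `hx` the function `t ↦ k (x - t)` is a test function supported in `U`, and the weak gradient
identity tested on it is the claim at `x`. Nothing is required of `g` as a gradient outside `U`. -/
theorem gradient_mollify {U : Set (EuclideanSpace ℝ (Fin n))}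
    {k : EuclideanSpace ℝ (Fin n) → ℝ} (hk : ContDiff ℝ ∞ k)
    (hkc : HasCompactSupport k) {f : EuclideanSpace ℝ (Fin n) → ℝ}
    {g : EuclideanSpace ℝ (Fin n) → EuclideanSpace ℝ (Fin n)}
    (hf : LocallyIntegrable f volume) (hg : LocallyIntegrable g volume)
    (hfg : IsWeakGradient U f g) {x : EuclideanSpace ℝ (Fin n)}
    (hx : ∀ y ∈ tsupport k, x - y ∈ U) :
    gradient (mollify k f) x = mollify k g x := by
  ext i
  rw [gradient_apply, fderiv_mollify_apply hk hkc hf, mollify_apply_coord hk.continuous hkc hg]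
  set ψ : EuclideanSpace ℝ (Fin n) → ℝ := fun t => k (x - t) with hψ
  have hψd : ∀ t v, fderiv ℝ ψ t v = - fderiv ℝ k (x - t) v := by
    intro t v
    have h1 : HasFDerivAt ψ ((fderiv ℝ k (x - t)).comp (-ContinuousLinearMap.id ℝ _)) t :=
      ((hk.differentiable (by simp)) (x - t)).hasFDerivAt.comp t ((hasFDerivAt_id t).const_sub x)
    rw [h1.fderiv]
    simp
  have hψc : HasCompactSupport ψ := hkc.comp_homeomorph (Homeomorph.subLeft x)
  have hψs : tsupport ψ ⊆ U := by
    have : tsupport ψ = (Homeomorph.subLeft x) ⁻¹' tsupport k :=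
      tsupport_comp_eq_preimage k (Homeomorph.subLeft x)
    rw [this]
    intro t ht
    have := hx _ ht
    simpa using this
  have h := hfg ψ (hk.comp (contDiff_const.sub contDiff_id)) hψc hψs i
  rw [setIntegral_eq_integral_of_tsupport_subset hψs
      (fun t ht => by rw [fderiv_apply_eq_zero_of_notMem_tsupport ht, mul_zero]),
    setIntegral_eq_integral_of_tsupport_subset hψs
      (fun t ht => by rw [image_eq_zero_of_notMem_tsupport ht, mul_zero])] at h
  simp_rw [hψd, mul_neg, integral_neg, neg_inj] at h
  exact h

theorem enorm_mollify_sub_le {F : Type*} [NormedAddCommGroup F] [NormedSpace ℝ F]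
    [CompleteSpace F]
    {k : EuclideanSpace ℝ (Fin n) → ℝ} (hk : Continuous k)
    (hkc : HasCompactSupport k) (hk0 : ∀ t, 0 ≤ k t) (hk1 : ∫ t, k t = 1)
    {f : EuclideanSpace ℝ (Fin n) → F}
    (hf : LocallyIntegrable f volume) (x : EuclideanSpace ℝ (Fin n)) (c : F) :
    ‖mollify k f x - c‖ₑ ≤ ∫⁻ t, ENNReal.ofReal (k t) * ‖f (x - t) - c‖ₑ := by
  have h1 : mollify k f x - c = ∫ t, k t • (f (x - t) - c) := by
    simp_rw [smul_sub]
    rw [integral_sub (integrable_kernel_smul hk hkc hf x)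
      ((hk.integrable_of_hasCompactSupport hkc).smul_const c), integral_smul_const, hk1, one_smul]
    rfl
  rw [h1]
  refine (enorm_integral_le_lintegral_enorm _).trans_eq (lintegral_congr fun t => ?_)
  rw [enorm_smul, Real.enorm_eq_ofReal (hk0 t)]

/-- The error is an average of translation differences against the probability density `k`.
Monotonicity of `L^q` norms on a probability space moves the power `p` inside the average, and
Tonelli finishes. -/
theorem eLpNorm_mollify_sub_le {F : Type*} [NormedAddCommGroup F] [NormedSpace ℝ F]
    [CompleteSpace F]
    {k : EuclideanSpace ℝ (Fin n) → ℝ} (hk : Continuous k)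
    (hkc : HasCompactSupport k) (hk0 : ∀ t, 0 ≤ k t) (hk1 : ∫ t, k t = 1)
    {f : EuclideanSpace ℝ (Fin n) → F} (hfm : StronglyMeasurable f)
    (hf : LocallyIntegrable f volume) {p : ℝ≥0∞} (hp1 : 1 ≤ p) (hp : p ≠ ⊤) {δ : ℝ≥0∞}
    (hδ : ∀ t, k t ≠ 0 → eLpNorm (fun x => f (x - t) - f x) p volume ≤ δ) :
    eLpNorm (fun x => mollify k f x - f x) p volume ≤ δ := by
  have hp0 : p ≠ 0 := (one_pos.trans_le hp1).ne'
  have hpr : 0 < p.toReal := ENNReal.toReal_pos hp0 hp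
  set ν : Measure (EuclideanSpace ℝ (Fin n)) :=
    volume.withDensity (fun t => ENNReal.ofReal (k t)) with hν
  have hkm : Measurable fun t => ENNReal.ofReal (k t) := hk.measurable.ennreal_ofReal
  have hνp : IsProbabilityMeasure ν := ⟨by
    rw [hν, withDensity_apply _ MeasurableSet.univ, setLIntegral_univ,
      ← ofReal_integral_eq_lintegral_ofReal (hk.integrable_of_hasCompactSupport hkc)
        (Eventually.of_forall hk0), hk1, ENNReal.ofReal_one]⟩
  have hm2 : StronglyMeasurable (fun z : EuclideanSpace ℝ (Fin n) × EuclideanSpace ℝ (Fin n) =>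
      f (z.1 - z.2) - f z.1) :=
    (hfm.comp_measurable (measurable_fst.sub measurable_snd)).sub
      (hfm.comp_measurable measurable_fst)
  have hm3 : Measurable (fun z : EuclideanSpace ℝ (Fin n) × EuclideanSpace ℝ (Fin n) =>
      ‖f (z.1 - z.2) - f z.1‖ₑ ^ p.toReal) := hm2.enorm.pow_const _
  have hpt : ∀ x, ‖mollify k f x - f x‖ₑ ^ p.toReal
      ≤ ∫⁻ t, ‖f (x - t) - f x‖ₑ ^ p.toReal ∂ν := by
    intro x
    have hm : AEStronglyMeasurable (fun t => f (x - t) - f x) ν :=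
      (hm2.comp_measurable measurable_prodMk_left).aestronglyMeasurable
    have hm4 : Measurable fun t => ‖f (x - t) - f x‖ₑ :=
      (hm2.comp_measurable (measurable_prodMk_left (x := x))).enorm
    have h1 := enorm_mollify_sub_le hk hkc hk0 hk1 hf x (f x)
    have h2 : ∫⁻ t, ENNReal.ofReal (k t) * ‖f (x - t) - f x‖ₑ
        = eLpNorm (fun t => f (x - t) - f x) 1 ν := by
      rw [eLpNorm_one_eq_lintegral_enorm, hν, lintegral_withDensity_eq_lintegral_mul _ hkm hm4]
      rfl
    rw [h2] at h1
    have h3 := h1.trans (eLpNorm_le_eLpNorm_of_exponent_le hp1 hm)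
    rw [eLpNorm_eq_lintegral_rpow_enorm_toReal hp0 hp] at h3
    have h4 := ENNReal.rpow_le_rpow h3 hpr.le
    rwa [← ENNReal.rpow_mul, one_div, inv_mul_cancel₀ hpr.ne', ENNReal.rpow_one] at h4
  have hmain : ∫⁻ x, ‖mollify k f x - f x‖ₑ ^ p.toReal ≤ δ ^ p.toReal := by
    calc ∫⁻ x, ‖mollify k f x - f x‖ₑ ^ p.toReal
        ≤ ∫⁻ x, ∫⁻ t, ‖f (x - t) - f x‖ₑ ^ p.toReal ∂ν := lintegral_mono hpt
      _ = ∫⁻ t, ∫⁻ x, ‖f (x - t) - f x‖ₑ ^ p.toReal ∂volume ∂ν :=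
          lintegral_lintegral_swap hm3.aemeasurable
      _ ≤ ∫⁻ _, δ ^ p.toReal ∂ν := by
          refine lintegral_mono_ae ?_
          rw [hν, ae_withDensity_iff hkm]
          refine Eventually.of_forall fun t ht => ?_
          have h5 := hδ t fun h0 => ht (by simp [h0])
          rw [eLpNorm_eq_lintegral_rpow_enorm_toReal hp0 hp] at h5
          have h6 := ENNReal.rpow_le_rpow h5 hpr.le
          rwa [← ENNReal.rpow_mul, one_div, inv_mul_cancel₀ hpr.ne', ENNReal.rpow_one] at h6
      _ = δ ^ p.toReal := by simp
  rw [eLpNorm_eq_lintegral_rpow_enorm_toReal hp0 hp, one_div]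
  calc _ ≤ (δ ^ p.toReal) ^ (p.toReal)⁻¹ := ENNReal.rpow_le_rpow hmain (inv_nonneg.2 hpr.le)
    _ = δ := by rw [← ENNReal.rpow_mul, mul_inv_cancel₀ hpr.ne', ENNReal.rpow_one]

/-- Translations act continuously on `L^p`, `p < ∞`. -/
theorem exists_eLpNorm_translate_sub_le {F : Type*} [NormedAddCommGroup F]
    {f : EuclideanSpace ℝ (Fin n) → F} {p : ℝ≥0∞} (hp1 : 1 ≤ p) (hp : p ≠ ⊤)
    (hf : MemLp f p volume) {δ : ℝ≥0∞} (hδ : 0 < δ) :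
    ∃ r > 0, ∀ t, ‖t‖ < r → eLpNorm (fun x => f (x - t) - f x) p volume ≤ δ := by
  have : Fact (1 ≤ p) := ⟨hp1⟩
  have : Fact (p ≠ ⊤) := ⟨hp⟩
  -- The action of `DomAddAct.mk (-t)` sends `f` to `x ↦ f (-t + x)`, the translate wanted; it is
  -- continuous on `L^p` for finite `p`.
  have hc : Continuous fun t : EuclideanSpace ℝ (Fin n) => DomAddAct.mk (-t) +ᵥ hf.toLp f :=
    (DomAddAct.continuous_mk.comp continuous_neg).vadd continuous_const
  have h1 : ∀ᶠ t : EuclideanSpace ℝ (Fin n) in 𝓝 0,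
      edist (DomAddAct.mk (-t) +ᵥ hf.toLp f) (hf.toLp f) < δ := by
    have := hc.tendsto 0
    simp only [neg_zero, DomAddAct.mk_zero, zero_vadd] at this
    exact this (Metric.eball_mem_nhds _ hδ)
  obtain ⟨r, hr, h2⟩ := Metric.eventually_nhds_iff.1 h1
  refine ⟨r, hr, fun t ht => ?_⟩
  have h3 := h2 (by simpa using ht)
  rw [DomAddAct.mk_vadd_toLp, Lp.edist_toLp_toLp] at h3
  refine (le_of_eq ?_).trans h3.le
  congr 1
  ext x
  simp [sub_eq_neg_add]

end ConeSobolev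

/-! ### Density of test functions on an open convex cone -/

namespace ConeSobolev

variable {n : ℕ}

/-- Nonempty open convex cones (without vertex). -/
structure IsOpenConvexCone (U : Set (EuclideanSpace ℝ (Fin n))) : Prop where
  isOpen : IsOpen U
  nonempty : U.Nonempty
  add_mem : ∀ x ∈ U, ∀ y ∈ U, x + y ∈ U
  smul_mem : ∀ t : ℝ, 0 < t → ∀ x ∈ U, t • x ∈ U

theorem IsOpenConvexCone.exists_norm_lt {U : Set (EuclideanSpace ℝ (Fin n))}
    (hU : IsOpenConvexCone U) {r : ℝ} (hr : 0 < r) : ∃ c ∈ U, ‖c‖ < r := by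
  obtain ⟨a, ha⟩ := hU.nonempty
  refine ⟨(r / (2 * (‖a‖ + 1))) • a, hU.smul_mem _ (by positivity) a ha, ?_⟩
  rw [norm_smul, Real.norm_of_nonneg (by positivity), div_mul_eq_mul_div, div_lt_iff₀ (by positivity)]
  nlinarith [norm_nonneg a]

/-- A convolution kernel translating into the cone. -/
theorem IsOpenConvexCone.exists_kernel {U : Set (EuclideanSpace ℝ (Fin n))}
    (hU : IsOpenConvexCone U) {r : ℝ} (hr : 0 < r) :
    ∃ k : EuclideanSpace ℝ (Fin n) → ℝ, ContDiff ℝ ∞ k ∧ HasCompactSupport k ∧ (∀ t, 0 ≤ k t) ∧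
      ∫ t, k t = 1 ∧ ∀ y ∈ tsupport k, -y ∈ U ∧ ‖y‖ < r := by
  obtain ⟨c, hc, hcr⟩ := hU.exists_norm_lt (half_pos hr)
  obtain ⟨ε, hε, hεU⟩ := Metric.isOpen_iff.1 hU.isOpen c hc
  set η := min ε (r / 2) with hη
  have hη0 : 0 < η := lt_min hε (half_pos hr)
  -- For `y` within `η / 2` of `-c`, the point `-y` lies in the ball of radius `ε` about `c`, hence
  -- in `U`, and `‖y‖ < r / 2 + r / 2`.
  let b : ContDiffBump (-c) := ⟨η / 3, η / 2, by positivity, by linarith⟩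
  refine ⟨b.normed volume, b.contDiff_normed, b.hasCompactSupport_normed, b.nonneg_normed,
    b.integral_normed, fun y hy => ?_⟩
  rw [b.tsupport_normed_eq, Metric.mem_closedBall, dist_eq_norm, sub_neg_eq_add] at hy
  have hy' : ‖y + c‖ ≤ η / 2 := hy
  constructor
  · refine hεU ?_
    rw [Metric.mem_ball, dist_eq_norm, ← norm_neg]
    have : -(-y - c) = y + c := by abel
    rw [this]
    linarith [min_le_left ε (r / 2)]
  · have : y = (y + c) - c := by abel
    rw [this]
    have := norm_sub_le (y + c) c
    linarith [min_le_right ε (r / 2)]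

/-- The kernel is supported in `-U`, so `x - y ∈ U` whenever `x ∈ U` and `y` is in its support.
Hence the gradient of the mollification is the mollification of `g` on all of `U`, up to the
boundary, and no extension of `f` as a Sobolev function is needed. -/
theorem IsOpenConvexCone.exists_contDiff_approx {U : Set (EuclideanSpace ℝ (Fin n))}
    (hU : IsOpenConvexCone U) {p : ℝ≥0∞} (hp1 : 1 ≤ p) (hp : p ≠ ⊤)
    {f : EuclideanSpace ℝ (Fin n) → ℝ} {g : EuclideanSpace ℝ (Fin n) → EuclideanSpace ℝ (Fin n)}
    (hf : MemLp f p volume) (hg : MemLp g p volume) (hfm : StronglyMeasurable f)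
    (hgm : StronglyMeasurable g) (hfg : IsWeakGradient U f g) {δ : ℝ≥0∞} (hδ : 0 < δ) :
    ∃ φ : EuclideanSpace ℝ (Fin n) → ℝ, ContDiff ℝ ∞ φ ∧
      eLpNorm (fun x => φ x - f x) p (volume.restrict U) ≤ δ ∧
      eLpNorm (fun x => gradient φ x - g x) p (volume.restrict U) ≤ δ := by
  obtain ⟨r, hr, h1⟩ := exists_eLpNorm_translate_sub_le hp1 hp hf hδ
  obtain ⟨s, hs, h2⟩ := exists_eLpNorm_translate_sub_le hp1 hp hg hδ
  obtain ⟨k, hk, hkc, hk0, hk1, hkU⟩ := hU.exists_kernel (lt_min hr hs)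
  have hsupp : ∀ t, k t ≠ 0 → ‖t‖ < r ∧ ‖t‖ < s := fun t ht =>
    lt_min_iff.1 (hkU t (subset_tsupport _ ht)).2
  have hfl := hf.locallyIntegrable hp1
  have hgl := hg.locallyIntegrable hp1
  refine ⟨mollify k f, contDiff_mollify hk hkc hfl, ?_, ?_⟩
  · exact (eLpNorm_mono_measure _ Measure.restrict_le_self).trans
      (eLpNorm_mollify_sub_le hk.continuous hkc hk0 hk1 hfm hfl hp1 hp
        fun t ht => h1 t (hsupp t ht).1)
  · have h3 : eLpNorm (fun x => gradient (mollify k f) x - g x) p (volume.restrict U)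
        = eLpNorm (fun x => mollify k g x - g x) p (volume.restrict U) := by
      refine eLpNorm_congr_ae ?_
      filter_upwards [ae_restrict_mem hU.isOpen.measurableSet] with x hx
      rw [gradient_mollify hk hkc hfl hgl hfg fun y hy => ?_]
      rw [sub_eq_add_neg]
      exact hU.add_mem x hx _ (hkU y hy).1
    rw [h3]
    exact (eLpNorm_mono_measure _ Measure.restrict_le_self).trans
      (eLpNorm_mollify_sub_le hk.continuous hkc hk0 hk1 hgm hgl hp1 hp
        fun t ht => h2 t (hsupp t ht).2)

/-- Outside the support of a compactly supported approximant `g` one has `f = f - g`, so the tail of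
`f` is bounded by the approximation error. -/
theorem exists_eLpNorm_indicator_norm_ge_le {F : Type*} [NormedAddCommGroup F] [NormedSpace ℝ F]
    {μ : Measure (EuclideanSpace ℝ (Fin n))} [IsLocallyFiniteMeasure μ]
    {f : EuclideanSpace ℝ (Fin n) → F} {p : ℝ≥0∞} (hp : p ≠ ⊤)
    (hf : MemLp f p μ) {δ : ℝ≥0∞} (hδ : δ ≠ 0) :
    ∃ R : ℝ, 1 ≤ R ∧ eLpNorm ({x | R ≤ ‖x‖}.indicator f) p μ ≤ δ := by
  obtain ⟨g, hgc, hg, -, -⟩ := hf.exists_hasCompactSupport_eLpNorm_sub_le hp hδ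
  obtain ⟨R, hR⟩ := hgc.isBounded.subset_closedBall 0
  refine ⟨max R 0 + 1, by simp, le_trans (eLpNorm_mono fun x => ?_) hg⟩
  by_cases hx : max R 0 + 1 ≤ ‖x‖
  · have hgx : g x = 0 := by
      refine image_eq_zero_of_notMem_tsupport fun h => ?_
      have := hR h
      rw [mem_closedBall_zero_iff] at this
      linarith [le_max_left R 0]
    rw [indicator_of_mem (by exact hx)]
    simp [hgx]
  · rw [indicator_of_notMem (by exact hx), norm_zero]
    exact norm_nonneg _

theorem exists_cutoff (n : ℕ) {ρ : ℝ} (hρ : 0 < ρ) : ∃ χ : EuclideanSpace ℝ (Fin n) → ℝ,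
    ContDiff ℝ ∞ χ ∧ HasCompactSupport χ ∧ (∀ x, 0 ≤ χ x) ∧ (∀ x, χ x ≤ 1) ∧
    (∀ x, ‖x‖ ≤ ρ → χ x = 1) ∧ ∀ x, 2 * ρ ≤ ‖x‖ → χ x = 0 := by
  let b : ContDiffBump (0 : EuclideanSpace ℝ (Fin n)) := ⟨ρ, 2 * ρ, hρ, by linarith⟩
  refine ⟨b, b.contDiff, b.hasCompactSupport, fun x => b.nonneg, fun x => b.le_one,
    fun x hx => b.one_of_mem_closedBall (by simpa using hx),
    fun x hx => b.zero_of_le_dist (by simpa using hx)⟩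

theorem exists_norm_gradient_le {φ : EuclideanSpace ℝ (Fin n) → ℝ} (h : ContDiff ℝ ∞ φ)
    (hc : HasCompactSupport φ) : ∃ C : ℝ, 0 ≤ C ∧ ∀ x, ‖gradient φ x‖ ≤ C := by
  obtain ⟨C, hC⟩ := (continuous_gradient h).bounded_above_of_compact_support
    (hasCompactSupport_gradient hc)
  exact ⟨C, (norm_nonneg _).trans (hC 0), hC⟩

theorem gradient_eq_zero_of_eventuallyEq_const {φ : EuclideanSpace ℝ (Fin n) → ℝ} {c : ℝ}
    {x : EuclideanSpace ℝ (Fin n)} (h : ∀ᶠ y in 𝓝 x, φ y = c) : gradient φ x = 0 := by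
  have h1 : φ =ᶠ[𝓝 x] fun _ => c := h
  rw [h1.gradient_eq, gradient_fun_const]

/-- A smooth function in `W^1_p` can be cut off at infinity. -/
theorem exists_hasCompactSupport_approx {μ : Measure (EuclideanSpace ℝ (Fin n))}
    [IsLocallyFiniteMeasure μ] {p : ℝ≥0∞} (hp : p ≠ ⊤)
    {φ : EuclideanSpace ℝ (Fin n) → ℝ} (hφ : ContDiff ℝ ∞ φ)
    (h1 : MemLp φ p μ) (h2 : MemLp (gradient φ) p μ) {δ : ℝ≥0∞} (hδ : 0 < δ) :
    ∃ ψ : EuclideanSpace ℝ (Fin n) → ℝ, ContDiff ℝ ∞ ψ ∧ HasCompactSupport ψ ∧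
      eLpNorm (fun x => ψ x - φ x) p μ ≤ δ ∧
      eLpNorm (fun x => gradient ψ x - gradient φ x) p μ ≤ δ := by
  obtain ⟨χ, hχ, hχc, hχ0, hχ1, hχone, -⟩ := exists_cutoff n one_pos
  obtain ⟨C, hC0, hC⟩ := exists_norm_gradient_le hχ hχc
  -- One majorant for both errors: outside the ball of radius `R` it dominates `|φ|` and also `|∇φ|
  -- + C |φ|`, which bounds the error in the gradient.
  have hH : MemLp (fun x => ‖gradient φ x‖ + (C + 1) * ‖φ x‖) p μ :=
    h2.norm.add (h1.norm.const_mul _)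
  obtain ⟨R, hR1, hR⟩ := exists_eLpNorm_indicator_norm_ge_le hp hH hδ.ne'
  have hR0 : 0 < R := by linarith
  -- Since `R ≥ 1`, the dilation does not increase the gradient bound `C`.
  set χR : EuclideanSpace ℝ (Fin n) → ℝ := fun x => χ (R⁻¹ • x) with hχR
  have hχRd : ContDiff ℝ ∞ χR := hχ.comp (contDiff_const_smul _)
  have hχRc : HasCompactSupport χR :=
    hχc.comp_homeomorph (Homeomorph.smulOfNeZero R⁻¹ (inv_ne_zero hR0.ne'))
  have hone : ∀ x, ‖x‖ ≤ R → χR x = 1 := fun x hx => hχone _ (by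
    rw [norm_smul, Real.norm_of_nonneg (by positivity), inv_mul_le_iff₀ hR0]
    linarith)
  have hgrad : ∀ x, ‖gradient χR x‖ ≤ C := by
    intro x
    rw [hχR, gradient_comp_smul, norm_smul, Real.norm_of_nonneg (by positivity)]
    calc R⁻¹ * ‖gradient χ (R⁻¹ • x)‖ ≤ 1 * C :=
          mul_le_mul (inv_le_one_of_one_le₀ hR1) (hC _) (norm_nonneg _) zero_le_one
      _ = C := one_mul C
  have hgrad0 : ∀ x, ‖x‖ < R → gradient χR x = 0 := fun x hx =>
    gradient_eq_zero_of_eventuallyEq_const (c := 1) (by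
      filter_upwards [(isOpen_lt continuous_norm continuous_const).mem_nhds hx] with y hy
      exact hone y (le_of_lt hy))
  refine ⟨fun x => χR x * φ x, hχRd.mul hφ, hχRc.mul_right, ?_, ?_⟩
  · refine (eLpNorm_mono_real fun x => ?_).trans hR
    by_cases hx : R ≤ ‖x‖
    · rw [indicator_of_mem (by exact hx)]
      have h3 : χR x * φ x - φ x = (χR x - 1) * φ x := by ring
      have h4 : |χR x - 1| ≤ 1 := abs_le.2 ⟨by linarith [hχ0 (R⁻¹ • x)], by linarith [hχ1 (R⁻¹ • x)]⟩
      rw [h3, norm_mul, Real.norm_eq_abs (χR x - 1)]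
      nlinarith [norm_nonneg (gradient φ x), norm_nonneg (φ x), mul_nonneg hC0 (norm_nonneg (φ x))]
    · rw [indicator_of_notMem (by exact hx)]
      simp [hone x (not_le.1 hx).le]
  · refine (eLpNorm_mono_real fun x => ?_).trans hR
    rw [gradient_mul ((hχRd.differentiable (by simp)) x) ((hφ.differentiable (by simp)) x)]
    by_cases hx : R ≤ ‖x‖
    · rw [indicator_of_mem (by exact hx)]
      have h3 : χR x • gradient φ x + φ x • gradient χR x - gradient φ x
          = (χR x - 1) • gradient φ x + φ x • gradient χR x := by
        rw [sub_smul, one_smul]; abel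
      have h4 : |χR x - 1| ≤ 1 := abs_le.2 ⟨by linarith [hχ0 (R⁻¹ • x)], by linarith [hχ1 (R⁻¹ • x)]⟩
      rw [h3]
      refine (norm_add_le _ _).trans ?_
      rw [norm_smul, norm_smul, Real.norm_eq_abs (χR x - 1)]
      nlinarith [norm_nonneg (gradient φ x), norm_nonneg (φ x),
        mul_le_mul_of_nonneg_left (hgrad x) (norm_nonneg (φ x))]
    · rw [indicator_of_notMem (by exact hx), hone x (not_le.1 hx).le, hgrad0 x (not_le.1 hx)]
      simp

/-- On an open convex cone, the test functions are dense in `W^1_p`, `p < ∞`. -/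
theorem IsOpenConvexCone.exists_testFunction_approx {U : Set (EuclideanSpace ℝ (Fin n))}
    (hU : IsOpenConvexCone U) {p : ℝ≥0∞} (hp1 : 1 ≤ p) (hp : p ≠ ⊤)
    {f : EuclideanSpace ℝ (Fin n) → ℝ} {g : EuclideanSpace ℝ (Fin n) → EuclideanSpace ℝ (Fin n)}
    (hf : MemLp f p (volume.restrict U)) (hg : MemLp g p (volume.restrict U))
    (hfg : IsWeakGradient U f g) {δ : ℝ≥0∞} (hδ : 0 < δ) :
    ∃ φ : EuclideanSpace ℝ (Fin n) → ℝ, ContDiff ℝ ∞ φ ∧ HasCompactSupport φ ∧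
      eLpNorm (fun x => φ x - f x) p (volume.restrict U) ≤ δ ∧
      eLpNorm (fun x => gradient φ x - g x) p (volume.restrict U) ≤ δ := by
  have hUm := hU.isOpen.measurableSet
  obtain ⟨f', hfm, hff⟩ := hf.1
  obtain ⟨g', hgm, hgg⟩ := hg.1
  -- Extension by zero gives functions in `L^p` of the whole space; the weak gradient relation is
  -- kept on `U` only, which is all that the one-sided mollification uses.
  have hfi : f =ᵐ[volume.restrict U] U.indicator f' := by
    filter_upwards [hff, ae_restrict_mem hUm] with x hx hxU
    rw [hx, indicator_of_mem hxU]
  have hgi : g =ᵐ[volume.restrict U] U.indicator g' := by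
    filter_upwards [hgg, ae_restrict_mem hUm] with x hx hxU
    rw [hx, indicator_of_mem hxU]
  have hδ2 : 0 < δ / 2 := ENNReal.half_pos hδ.ne'
  have hfL : MemLp (U.indicator f') p volume :=
    (memLp_indicator_iff_restrict hUm).2 (hf.ae_eq hff)
  have hgL : MemLp (U.indicator g') p volume :=
    (memLp_indicator_iff_restrict hUm).2 (hg.ae_eq hgg)
  -- The minimum with `1` keeps the error finite even for `δ = ⊤`, so that `φ` and its gradient
  -- belong to `L^p`.
  obtain ⟨φ, hφ, h1, h2⟩ := hU.exists_contDiff_approx hp1 hp hfL hgL (hfm.indicator hUm)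
    (hgm.indicator hUm) (hfg.congr hfi hgi) (lt_min hδ2 one_pos)
  have h1' : eLpNorm (fun x => φ x - f x) p (volume.restrict U) ≤ min (δ / 2) 1 := by
    refine le_of_eq_of_le (eLpNorm_congr_ae ?_) h1
    filter_upwards [hfi] with x hx
    rw [hx]
  have h2' : eLpNorm (fun x => gradient φ x - g x) p (volume.restrict U) ≤ min (δ / 2) 1 := by
    refine le_of_eq_of_le (eLpNorm_congr_ae ?_) h2
    filter_upwards [hgi] with x hx
    rw [hx]
  have hm1 : AEStronglyMeasurable φ (volume.restrict U) := hφ.continuous.aestronglyMeasurable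
  have hm2 : AEStronglyMeasurable (gradient φ) (volume.restrict U) :=
    (continuous_gradient hφ).aestronglyMeasurable
  have hlt : min (δ / 2) 1 < (⊤ : ℝ≥0∞) := (min_le_right _ _).trans_lt ENNReal.one_lt_top
  have hφL : MemLp φ p (volume.restrict U) := by
    have : MemLp (fun x => φ x - f x) p (volume.restrict U) := ⟨hm1.sub hf.1, h1'.trans_lt hlt⟩
    convert this.add hf using 1
    ext x; simp
  have hφL' : MemLp (gradient φ) p (volume.restrict U) := by
    have : MemLp (fun x => gradient φ x - g x) p (volume.restrict U) :=
      ⟨hm2.sub hg.1, h2'.trans_lt hlt⟩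
    convert this.add hg using 1
    ext x; simp
  obtain ⟨ψ, hψ, hψc, h3, h4⟩ := exists_hasCompactSupport_approx hp hφ hφL hφL' hδ2
  refine ⟨ψ, hψ, hψc, ?_, ?_⟩
  · calc eLpNorm (fun x => ψ x - f x) p (volume.restrict U)
        = eLpNorm ((fun x => ψ x - φ x) + fun x => φ x - f x) p (volume.restrict U) := by
          congr 1; ext x; simp
      _ ≤ δ / 2 + δ / 2 := (eLpNorm_add_le (hψ.continuous.aestronglyMeasurable.sub hm1)
          (hm1.sub hf.1) hp1).trans (add_le_add h3 (h1'.trans (min_le_left _ _)))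
      _ = δ := ENNReal.add_halves δ
  · calc eLpNorm (fun x => gradient ψ x - g x) p (volume.restrict U)
        = eLpNorm ((fun x => gradient ψ x - gradient φ x) + fun x => gradient φ x - g x) p
            (volume.restrict U) := by
          congr 1; ext x; simp
      _ ≤ δ / 2 + δ / 2 := (eLpNorm_add_le
          ((continuous_gradient hψ).aestronglyMeasurable.sub hm2)
          (hm2.sub hg.1) hp1).trans (add_le_add h4 (h2'.trans (min_le_left _ _)))
      _ = δ := ENNReal.add_halves δ

end ConeSobolev

/-! ### The Sobolev inequality and the limit at the vertex, `p > n` -/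

namespace ConeSobolev

variable {n : ℕ}

/-- The dilation pushes Lebesgue measure on the invariant set `S` to `t⁻ⁿ` times itself. The
exponent `-n/p` is integrable at `0` exactly when `p > n`, and for `p = n` it cancels the factor
from the chain rule; both facts are used later. -/
theorem eLpNorm_comp_smul {F : Type*} [NormedAddCommGroup F]
    {S : Set (EuclideanSpace ℝ (Fin n))} (hSm : MeasurableSet S) {t : ℝ} (ht : 0 < t)
    (hS : (fun x : EuclideanSpace ℝ (Fin n) => t • x) ⁻¹' S = S) {p : ℝ≥0∞} (hp : p ≠ ⊤)
    {h : EuclideanSpace ℝ (Fin n) → F} (hh : Continuous h) :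
    eLpNorm (fun x => h (t • x)) p (volume.restrict S)
      = ENNReal.ofReal (t ^ (-(n / p.toReal))) * eLpNorm h p (volume.restrict S) := by
  have hm : Measurable fun x : EuclideanSpace ℝ (Fin n) => t • x := measurable_const_smul t
  have hmap : Measure.map (fun x : EuclideanSpace ℝ (Fin n) => t • x) (volume.restrict S)
      = ENNReal.ofReal |(t ^ n)⁻¹| • volume.restrict S := by
    conv_lhs => rw [← hS]
    rw [← Measure.restrict_map hm hSm]
    have := Measure.map_addHaar_smul (volume : Measure (EuclideanSpace ℝ (Fin n))) ht.ne'
    rw [finrank_euclideanSpace_fin] at this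
    rw [this, Measure.restrict_smul]
  have h1 : eLpNorm (fun x => h (t • x)) p (volume.restrict S)
      = eLpNorm h p (Measure.map (fun x => t • x) (volume.restrict S)) := by
    have hms : AEStronglyMeasurable h
        (Measure.map (fun x => t • x) (volume.restrict S)) := by
      rw [hmap]; exact hh.aestronglyMeasurable
    rw [eLpNorm_map_measure hms hm.aemeasurable]
    rfl
  rw [h1, hmap, eLpNorm_smul_measure_of_ne_top hp, smul_eq_mul, abs_of_pos (by positivity),
    ENNReal.ofReal_rpow_of_pos (by positivity)]
  congr 2
  rw [one_div, ENNReal.toReal_inv, Real.inv_rpow (by positivity), ← Real.rpow_natCast,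
    ← Real.rpow_mul ht.le, Real.rpow_neg ht.le, div_eq_mul_inv]

/-- The fundamental theorem of calculus on the segment from `0` to `y`. -/
theorem enorm_apply_zero_le {φ : EuclideanSpace ℝ (Fin n) → ℝ} (hφ : ContDiff ℝ ∞ φ)
    {y : EuclideanSpace ℝ (Fin n)} {M : ℝ≥0∞} (hy : ‖y‖ₑ ≤ M) :
    ‖φ 0‖ₑ ≤ ‖φ y‖ₑ + M * ∫⁻ t in Ioo (0 : ℝ) 1, ‖gradient φ (t • y)‖ₑ := by
  have hd : ∀ t : ℝ, HasDerivAt (fun t : ℝ => φ (t • y)) (fderiv ℝ φ (t • y) y) t := by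
    intro t
    have h1 : HasDerivAt (fun t : ℝ => t • y) y t := by
      simpa using (hasDerivAt_id t).smul_const y
    exact ((hφ.differentiable (by simp)) (t • y)).hasFDerivAt.comp_hasDerivAt t h1
  have hc : Continuous fun t : ℝ => fderiv ℝ φ (t • y) y :=
    ((hφ.continuous_fderiv (by simp)).comp (continuous_id.smul continuous_const)).clm_apply
      continuous_const
  have h2 := intervalIntegral.integral_eq_sub_of_hasDerivAt (a := 0) (b := 1)
    (fun t _ => hd t) (hc.intervalIntegrable _ _)
  rw [intervalIntegral.integral_of_le zero_le_one, integral_Ioc_eq_integral_Ioo, one_smul,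
    zero_smul] at h2
  have h3 : φ 0 = φ y - ∫ t in Ioo (0 : ℝ) 1, fderiv ℝ φ (t • y) y := by rw [h2]; ring
  rw [h3]
  refine enorm_sub_le.trans (add_le_add le_rfl ?_)
  refine (enorm_integral_le_lintegral_enorm _).trans ?_
  have hmeas : Measurable fun t : ℝ => ‖gradient φ (t • y)‖ₑ :=
    ((continuous_gradient hφ).comp (continuous_id.smul continuous_const)).enorm.measurable
  rw [← lintegral_const_mul _ hmeas]
  refine lintegral_mono fun t => ?_
  have h4 : ‖gradient φ (t • y)‖ₑ = ‖fderiv ℝ φ (t • y)‖ₑ := by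
    rw [← ofReal_norm, norm_gradient, ofReal_norm]
  calc ‖fderiv ℝ φ (t • y) y‖ₑ ≤ ‖fderiv ℝ φ (t • y)‖ₑ * ‖y‖ₑ := by
        simp only [← ofReal_norm]
        rw [← ENNReal.ofReal_mul (norm_nonneg _)]
        exact ENNReal.ofReal_le_ofReal (ContinuousLinearMap.le_opNorm _ _)
    _ ≤ M * ‖gradient φ (t • y)‖ₑ := by
        rw [h4, mul_comm]; gcongr

/-- The Sobolev inequality at the vertex of a convex cone. -/
theorem IsOpenConvexCone.exists_enorm_zero_le {U : Set (EuclideanSpace ℝ (Fin n))}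
    (hU : IsOpenConvexCone U) {p : ℝ≥0∞} (hp1 : 1 ≤ p) (hpn : (n : ℝ≥0∞) < p) (hp : p ≠ ⊤) :
    ∃ C : ℝ≥0∞, C ≠ ⊤ ∧ ∀ φ : EuclideanSpace ℝ (Fin n) → ℝ, ContDiff ℝ ∞ φ →
      ‖φ 0‖ₑ ≤ C * (eLpNorm φ p (volume.restrict U)
        + eLpNorm (gradient φ) p (volume.restrict U)) := by
  obtain ⟨c, hc⟩ := hU.nonempty
  obtain ⟨ε, hε, hεU⟩ := Metric.isOpen_iff.1 hU.isOpen c hc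
  -- The ray estimate is averaged over this ball inside `U`; all segments from the origin to its
  -- points stay in `U` apart from the vertex.
  set D := Metric.ball c ε with hD
  set v := volume D with hv
  have hv0 : v ≠ 0 := (Metric.measure_ball_pos volume c hε).ne'
  have hvt : v ≠ ⊤ := measure_ball_lt_top.ne
  set M : ℝ≥0∞ := ENNReal.ofReal (‖c‖ + ε) with hM
  have hDM : ∀ y ∈ D, ‖y‖ₑ ≤ M := by
    intro y hy
    rw [← ofReal_norm]
    refine ENNReal.ofReal_le_ofReal ?_
    have h1 : ‖y - c‖ < ε := by rwa [hD, Metric.mem_ball, dist_eq_norm] at hy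
    have h2 := norm_add_le (y - c) c
    rw [sub_add_cancel] at h2
    linarith
  -- The power of the volume of `D` in Hölder's inequality from `L¹` to `L^p`.
  set a : ℝ := 1 / (1 : ℝ≥0∞).toReal - 1 / p.toReal with ha
  have hpr1 : 1 ≤ p.toReal := by
    rw [← ENNReal.toReal_one]; exact ENNReal.toReal_mono hp hp1
  have ha0 : 0 ≤ a := by
    rw [ha, ENNReal.toReal_one, div_one, sub_nonneg, div_le_one (by linarith)]; exact hpr1
  set I : ℝ≥0∞ := ∫⁻ t in Ioo (0 : ℝ) 1, ENNReal.ofReal (t ^ (-(n / p.toReal))) with hI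
  -- The only place where `n < p` enters: then `t ^ (-(n/p))` is integrable on `(0, 1)`.
  have hIt : I ≠ ⊤ := by
    have hint : IntegrableOn (fun t : ℝ => t ^ (-(n / p.toReal))) (Ioo (0 : ℝ) 1) := by
      rw [intervalIntegral.integrableOn_Ioo_rpow_iff one_pos, neg_lt_neg_iff,
        div_lt_one (by linarith)]
      have := (ENNReal.toReal_lt_toReal (ENNReal.natCast_ne_top n) hp).2 hpn
      simpa using this
    have h1 : I = ∫⁻ t in Ioo (0 : ℝ) 1, ‖(t ^ (-(n / p.toReal)) : ℝ)‖ₑ := by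
      refine setLIntegral_congr_fun measurableSet_Ioo fun t ht => ?_
      exact (Real.enorm_of_nonneg (Real.rpow_nonneg ht.1.le _)).symm
    rw [h1]
    exact hint.2.ne
  have hHolder : ∀ {F : Type} [NormedAddCommGroup F] (h : EuclideanSpace ℝ (Fin n) → F),
      Continuous h → ∫⁻ y in D, ‖h y‖ₑ ≤ eLpNorm h p (volume.restrict U) * v ^ a := by
    intro F _ h hh
    rw [← eLpNorm_one_eq_lintegral_enorm]
    have := eLpNorm_le_eLpNorm_mul_rpow_measure_univ (μ := volume.restrict D) hp1
      hh.aestronglyMeasurable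
    rw [Measure.restrict_apply_univ] at this
    refine this.trans ?_
    gcongr
  refine ⟨v⁻¹ * (v ^ a + M * (I * v ^ a)), ?_, fun φ hφ => ?_⟩
  · have hva : v ^ a ≠ ⊤ := ENNReal.rpow_ne_top_of_nonneg ha0 hvt
    exact ENNReal.mul_ne_top (ENNReal.inv_ne_top.2 hv0) (ENNReal.add_ne_top.2
      ⟨hva, ENNReal.mul_ne_top ENNReal.ofReal_ne_top (ENNReal.mul_ne_top hIt hva)⟩)
  set A := eLpNorm φ p (volume.restrict U)
  set B := eLpNorm (gradient φ) p (volume.restrict U)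
  have hgc := continuous_gradient hφ
  have hjoint : Continuous fun z : EuclideanSpace ℝ (Fin n) × ℝ =>
      ‖gradient φ (z.2 • z.1)‖ₑ :=
    (hgc.comp (continuous_snd.smul continuous_fst)).enorm
  -- Integrate the ray estimate over `D`, exchange the integrals, and for each `t` apply Hölder on
  -- `D` followed by the scaling law on `U`.
  have key : ‖φ 0‖ₑ * v ≤ A * v ^ a + M * (I * (B * v ^ a)) := by
    calc ‖φ 0‖ₑ * v = ∫⁻ _ in D, ‖φ 0‖ₑ := by
          rw [lintegral_const, Measure.restrict_apply_univ]
      _ ≤ ∫⁻ y in D, (‖φ y‖ₑ + M * ∫⁻ t in Ioo (0 : ℝ) 1, ‖gradient φ (t • y)‖ₑ) :=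
          setLIntegral_mono' measurableSet_ball fun y hy => enorm_apply_zero_le hφ (hDM y hy)
      _ = (∫⁻ y in D, ‖φ y‖ₑ)
          + M * ∫⁻ y in D, ∫⁻ t in Ioo (0 : ℝ) 1, ‖gradient φ (t • y)‖ₑ := by
          rw [lintegral_add_left hφ.continuous.enorm.measurable,
            lintegral_const_mul' _ _ ENNReal.ofReal_ne_top]
      _ = (∫⁻ y in D, ‖φ y‖ₑ)
          + M * ∫⁻ t in Ioo (0 : ℝ) 1, ∫⁻ y in D, ‖gradient φ (t • y)‖ₑ := by
          rw [lintegral_lintegral_swap hjoint.measurable.aemeasurable]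
      _ ≤ A * v ^ a + M * ∫⁻ t in Ioo (0 : ℝ) 1,
            ENNReal.ofReal (t ^ (-(n / p.toReal))) * (B * v ^ a) := by
          gcongr ?_ + M * ?_
          · exact hHolder φ hφ.continuous
          · refine setLIntegral_mono' measurableSet_Ioo fun t ht => ?_
            have h1 := hHolder (fun y => gradient φ (t • y))
              (hgc.comp (continuous_const_smul t))
            have hpre : (fun x : EuclideanSpace ℝ (Fin n) => t • x) ⁻¹' U = U := by
              ext x
              refine ⟨fun hx => ?_, hU.smul_mem t ht.1 x⟩
              have := hU.smul_mem t⁻¹ (inv_pos.2 ht.1) _ hx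
              rwa [inv_smul_smul₀ ht.1.ne'] at this
            rw [eLpNorm_comp_smul hU.isOpen.measurableSet ht.1 hpre hp hgc, mul_assoc] at h1
            exact h1
      _ = A * v ^ a + M * (I * (B * v ^ a)) := by
          rw [lintegral_mul_const _ (by fun_prop)]
  calc ‖φ 0‖ₑ = v⁻¹ * (‖φ 0‖ₑ * v) := by
        rw [mul_comm ‖φ 0‖ₑ, ← mul_assoc, ENNReal.inv_mul_cancel hv0 hvt, one_mul]
    _ ≤ v⁻¹ * (A * v ^ a + M * (I * (B * v ^ a))) := by gcongr
    _ ≤ v⁻¹ * ((v ^ a + M * (I * v ^ a)) * (A + B)) := by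
        gcongr v⁻¹ * ?_
        have e : (v ^ a + M * (I * v ^ a)) * (A + B)
            = (A * v ^ a + M * (I * (B * v ^ a))) + (v ^ a * B + M * (I * v ^ a) * A) := by ring
        rw [e]
        exact le_self_add
    _ = v⁻¹ * (v ^ a + M * (I * v ^ a)) * (A + B) := by rw [mul_assoc]

/-- Translation by `x` preserves the measure and maps `U` into itself. -/
theorem IsOpenConvexCone.eLpNorm_comp_add_right_le {F : Type*} [NormedAddCommGroup F]
    {U : Set (EuclideanSpace ℝ (Fin n))} (hU : IsOpenConvexCone U) (p : ℝ≥0∞)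
    {h : EuclideanSpace ℝ (Fin n) → F} (hh : Continuous h) {x : EuclideanSpace ℝ (Fin n)}
    (hx : x ∈ insert 0 U) :
    eLpNorm (fun y => h (y + x)) p (volume.restrict U) ≤ eLpNorm h p (volume.restrict U) := by
  have hmp : MeasurePreserving (fun y : EuclideanSpace ℝ (Fin n) => y + x) volume volume :=
    measurePreserving_add_right volume x
  have hsub : U ⊆ (fun y => y + x) ⁻¹' U := by
    intro y hy
    rcases hx with rfl | hx
    · simpa using hy
    · exact hU.add_mem y hy x hx
  have h1 := eLpNorm_comp_measurePreserving (p := p)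
    (hh.aestronglyMeasurable (μ := volume.restrict U))
    (hmp.restrict_preimage hU.isOpen.measurableSet)
  rw [← h1]
  exact eLpNorm_mono_measure _ (Measure.restrict_mono hsub le_rfl)

/-- The Sobolev inequality on a convex cone, vertex included. -/
theorem IsOpenConvexCone.exists_enorm_le {U : Set (EuclideanSpace ℝ (Fin n))}
    (hU : IsOpenConvexCone U) {p : ℝ≥0∞} (hp1 : 1 ≤ p) (hpn : (n : ℝ≥0∞) < p) (hp : p ≠ ⊤) :
    ∃ C : ℝ≥0∞, C ≠ ⊤ ∧ ∀ φ : EuclideanSpace ℝ (Fin n) → ℝ, ContDiff ℝ ∞ φ →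
      ∀ x ∈ insert 0 U, ‖φ x‖ₑ ≤ C * (eLpNorm φ p (volume.restrict U)
        + eLpNorm (gradient φ) p (volume.restrict U)) := by
  obtain ⟨C, hC, h⟩ := hU.exists_enorm_zero_le hp1 hpn hp
  refine ⟨C, hC, fun φ hφ x hx => ?_⟩
  -- The inequality at the vertex, applied to the translate by `x`, carries over to `x` with the
  -- same constant.
  have h1 := h (fun y => φ (y + x)) (hφ.comp (contDiff_id.add contDiff_const))
  simp only [zero_add] at h1
  have h2 : gradient (fun y => φ (y + x)) = fun y => gradient φ (y + x) :=
    funext fun y => gradient_comp_add_right φ x y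
  rw [h2] at h1
  refine h1.trans ?_
  gcongr
  · exact hU.eLpNorm_comp_add_right_le p hφ.continuous hx
  · exact hU.eLpNorm_comp_add_right_le p (continuous_gradient hφ) hx

/-- The distance in `W^1_p(U)` from a smooth function to `f`, whose gradient is `g`. -/
noncomputable def sobolevDist (U : Set (EuclideanSpace ℝ (Fin n))) (p : ℝ≥0∞)
    (φ f : EuclideanSpace ℝ (Fin n) → ℝ)
    (g : EuclideanSpace ℝ (Fin n) → EuclideanSpace ℝ (Fin n)) : ℝ≥0∞ :=
  eLpNorm (fun x => φ x - f x) p (volume.restrict U)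
    + eLpNorm (fun x => gradient φ x - g x) p (volume.restrict U)

theorem eLpNorm_sub_le_add {F : Type*} [NormedAddCommGroup F] {α : Type*} [MeasurableSpace α]
    {μ : Measure α} {p : ℝ≥0∞} (hp1 : 1 ≤ p) {f g h : α → F} (hf : AEStronglyMeasurable f μ)
    (hg : AEStronglyMeasurable g μ) (hh : AEStronglyMeasurable h μ) :
    eLpNorm (fun x => f x - g x) p μ
      ≤ eLpNorm (fun x => f x - h x) p μ + eLpNorm (fun x => g x - h x) p μ := by
  have e : (fun x => f x - g x) = (fun x => f x - h x) - fun x => g x - h x := by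
    ext x; simp
  rw [e]
  exact eLpNorm_sub_le (hf.sub hh) (hg.sub hh) hp1

/-- For `p > n` the functions in `W^1_p` of a convex cone have a limit at the vertex, and it
depends continuously on the function. -/
theorem IsOpenConvexCone.exists_hasLimitAtVertex {U : Set (EuclideanSpace ℝ (Fin n))}
    (hU : IsOpenConvexCone U) {p : ℝ≥0∞} (hp1 : 1 ≤ p) (hpn : (n : ℝ≥0∞) < p) (hp : p ≠ ⊤) :
    ∃ C : ℝ≥0∞, C ≠ ⊤ ∧ ∀ (f : EuclideanSpace ℝ (Fin n) → ℝ)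
      (g : EuclideanSpace ℝ (Fin n) → EuclideanSpace ℝ (Fin n)),
      MemLp f p (volume.restrict U) → MemLp g p (volume.restrict U) → IsWeakGradient U f g →
      ∃ c : ℝ, HasLimitAtVertex U f c ∧ ∀ ψ : EuclideanSpace ℝ (Fin n) → ℝ, ContDiff ℝ ∞ ψ →
        ‖c - ψ 0‖ₑ ≤ C * sobolevDist U p ψ f g := by
  obtain ⟨C, hC, hS⟩ := hU.exists_enorm_le hp1 hpn hp
  refine ⟨C, hC, fun f g hf hg hfg => ?_⟩
  have hdiff : ∀ φ ψ : EuclideanSpace ℝ (Fin n) → ℝ, ContDiff ℝ ∞ φ → ContDiff ℝ ∞ ψ →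
      ∀ x ∈ insert 0 U, ‖φ x - ψ x‖ₑ ≤ C * (sobolevDist U p φ f g + sobolevDist U p ψ f g) := by
    intro φ ψ hφ hψ x hx
    refine (hS (fun y => φ y - ψ y) (hφ.sub hψ) x hx).trans ?_
    have h2 : gradient (fun y => φ y - ψ y) = fun y => gradient φ y - gradient ψ y :=
      funext fun y => gradient_sub ((hφ.differentiable (by simp)) y)
        ((hψ.differentiable (by simp)) y)
    rw [h2]
    gcongr C * ?_
    have h3 := eLpNorm_sub_le_add hp1 (hφ.continuous.aestronglyMeasurable (μ := volume.restrict U))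
      hψ.continuous.aestronglyMeasurable hf.1
    have h4 := eLpNorm_sub_le_add hp1
      ((continuous_gradient hφ).aestronglyMeasurable (μ := volume.restrict U))
      (continuous_gradient hψ).aestronglyMeasurable hg.1
    refine (add_le_add h3 h4).trans_eq ?_
    rw [sobolevDist, sobolevDist]
    ring
  -- At `k = 0` the value is `⊤`, an empty requirement that does not affect the limit.
  have hδ : ∀ k : ℕ, (0 : ℝ≥0∞) < (k : ℝ≥0∞)⁻¹ := fun k =>
    ENNReal.inv_pos.2 (ENNReal.natCast_ne_top k)
  choose φ hφ hφc hφ1 hφ2 using fun k : ℕ =>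
    hU.exists_testFunction_approx hp1 hp hf hg hfg (hδ k)
  set e : ℕ → ℝ≥0∞ := fun k => sobolevDist U p (φ k) f g with he
  have het : Tendsto e atTop (𝓝 0) := by
    have h0 : Tendsto (fun k : ℕ => (k : ℝ≥0∞)⁻¹ + (k : ℝ≥0∞)⁻¹) atTop (𝓝 (0 + 0)) :=
      ENNReal.tendsto_inv_nat_nhds_zero.add ENNReal.tendsto_inv_nat_nhds_zero
    rw [add_zero] at h0
    exact tendsto_of_tendsto_of_tendsto_of_le_of_le tendsto_const_nhds h0 (fun _ => zero_le)
      fun k => add_le_add (hφ1 k) (hφ2 k)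
  -- Including the vertex in the set of uniform convergence makes the limit function continuous
  -- there, so `h 0` is the limit from `U`.
  have hCauchy : UniformCauchySeqOn φ atTop (insert 0 U) := by
    intro u hu
    obtain ⟨ε, hε, hεu⟩ := mem_uniformity_edist.1 hu
    have h1 : Tendsto (fun m : ℕ × ℕ => C * (e m.1 + e m.2)) (atTop ×ˢ atTop) (𝓝 0) := by
      have := ENNReal.Tendsto.const_mul (a := C)
        ((het.comp tendsto_fst).add (het.comp tendsto_snd) : Tendsto (fun m : ℕ × ℕ =>
          e m.1 + e m.2) (atTop ×ˢ atTop) (𝓝 (0 + 0))) (Or.inr hC)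
      simpa using this
    filter_upwards [h1.eventually (gt_mem_nhds hε)] with m hm x hx
    refine hεu ?_
    rw [edist_eq_enorm_sub]
    exact (hdiff _ _ (hφ m.1) (hφ m.2) x hx).trans_lt hm
  have hlim : ∀ x ∈ insert 0 U, ∃ l, Tendsto (fun k => φ k x) atTop (𝓝 l) := fun x hx =>
    cauchySeq_tendsto_of_complete (hCauchy.cauchySeq hx)
  choose! h hh using hlim
  have hunif : TendstoUniformlyOn φ h atTop (insert 0 U) :=
    hCauchy.tendstoUniformlyOn_of_tendsto hh
  have hcont : ContinuousOn h (insert 0 U) :=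
    hunif.continuousOn (Frequently.of_forall fun k => (hφ k).continuous.continuousOn)
  refine ⟨h 0, ⟨h, ?_, hcont.mono (subset_insert _ _), ?_⟩, fun ψ hψ => ?_⟩
  -- Convergence in `L^p` gives almost everywhere convergence of a subsequence, which identifies the
  -- uniform limit `h` with `f`.
  · have hp0 : p ≠ 0 := (one_pos.trans_le hp1).ne'
    have h1 : Tendsto (fun k => eLpNorm (φ k - f) p (volume.restrict U)) atTop (𝓝 0) :=
      tendsto_of_tendsto_of_tendsto_of_le_of_le tendsto_const_nhds het (fun _ => zero_le)
        fun k => le_self_add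
    obtain ⟨ns, hns, hae⟩ := (tendstoInMeasure_of_tendsto_eLpNorm hp0
      (fun k => (hφ k).continuous.aestronglyMeasurable) hf.1 h1).exists_seq_tendsto_ae
    filter_upwards [hae, ae_restrict_mem hU.isOpen.measurableSet] with x hx hxU
    exact tendsto_nhds_unique hx ((hh x (mem_insert_of_mem _ hxU)).comp hns.tendsto_atTop)
  · exact (hcont 0 (mem_insert _ _)).mono (subset_insert _ _)
  · have h1 : Tendsto (fun k => ‖φ k 0 - ψ 0‖ₑ) atTop (𝓝 ‖h 0 - ψ 0‖ₑ) :=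
      ((hh 0 (mem_insert _ _)).sub_const _).enorm
    have h2 : Tendsto (fun k => C * (e k + sobolevDist U p ψ f g)) atTop
        (𝓝 (C * (0 + sobolevDist U p ψ f g))) :=
      ENNReal.Tendsto.const_mul (het.add_const _) (Or.inr hC)
    rw [zero_add] at h2
    exact le_of_tendsto_of_tendsto' h1 h2 fun k => hdiff _ _ (hφ k) hψ 0 (mem_insert _ _)

end ConeSobolev

/-! ### Removing a neighbourhood of the origin -/

namespace ConeSobolev

variable {n : ℕ}

theorem exists_eLpNorm_indicator_closedBall_le (hn : n ≠ 0) {p : ℝ≥0∞} (hp1 : 1 ≤ p)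
    (hp : p ≠ ⊤) (K : ℝ) {δ : ℝ≥0∞} (hδ : 0 < δ) :
    ∃ r : ℝ, 0 < r ∧ r ≤ 1 ∧
      eLpNorm ((Metric.closedBall (0 : EuclideanSpace ℝ (Fin n)) r).indicator fun _ => K) p volume
        ≤ δ := by
  have hp0 : p ≠ 0 := (one_pos.trans_le hp1).ne'
  have hpr : 0 < 1 / p.toReal := one_div_pos.2 (ENNReal.toReal_pos hp0 hp)
  set v := volume (Metric.ball (0 : EuclideanSpace ℝ (Fin n)) 1) with hv
  have h1 : Tendsto (fun r : ℝ => ‖K‖ₑ * (ENNReal.ofReal (r ^ n) * v) ^ (1 / p.toReal)) (𝓝 0)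
      (𝓝 0) := by
    have h2 : Tendsto (fun r : ℝ => ENNReal.ofReal (r ^ n) * v) (𝓝 0) (𝓝 0) := by
      have h3 : Tendsto (fun r : ℝ => ENNReal.ofReal (r ^ n)) (𝓝 0) (𝓝 0) := by
        have := (ENNReal.continuous_ofReal.comp (continuous_pow (M := ℝ) n)).tendsto 0
        simpa [hn, Function.comp_def] using this
      simpa using ENNReal.Tendsto.mul_const h3 (Or.inr measure_ball_lt_top.ne)
    have h4 := (ENNReal.continuous_rpow_const (y := 1 / p.toReal)).tendsto 0
    rw [ENNReal.zero_rpow_of_pos hpr] at h4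
    simpa using ENNReal.Tendsto.const_mul (h4.comp h2) (Or.inr (enorm_ne_top (x := K)))
  obtain ⟨s, hs, h5⟩ := Metric.eventually_nhds_iff.1 (h1.eventually (gt_mem_nhds hδ))
  refine ⟨min (s / 2) 1, by positivity, min_le_right _ _, ?_⟩
  have hr : 0 < min (s / 2) 1 := by positivity
  have h6 := h5 (y := min (s / 2) 1) (by
    rw [Real.dist_eq, sub_zero, abs_of_pos hr]
    linarith [min_le_left (s / 2) 1])
  rw [eLpNorm_indicator_const Metric.isClosed_closedBall.measurableSet hp0 hp,
    Measure.addHaar_closedBall _ _ hr.le, finrank_euclideanSpace_fin]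
  exact h6.le

/-- A test function that vanishes at the origin is a limit in `W^1_p`, `p < ∞`, of test functions
that vanish near the origin. -/
theorem exists_approx_eventually_eq_zero (hn : n ≠ 0) {p : ℝ≥0∞} (hp1 : 1 ≤ p) (hp : p ≠ ⊤)
    {φ : EuclideanSpace ℝ (Fin n) → ℝ} (hφ : ContDiff ℝ ∞ φ) (hφc : HasCompactSupport φ)
    (hφ0 : φ 0 = 0) {δ : ℝ≥0∞} (hδ : 0 < δ) :
    ∃ ψ : EuclideanSpace ℝ (Fin n) → ℝ, ContDiff ℝ ∞ ψ ∧ HasCompactSupport ψ ∧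
      (∀ᶠ x in 𝓝 0, ψ x = 0) ∧ eLpNorm (fun x => ψ x - φ x) p volume ≤ δ ∧
      eLpNorm (fun x => gradient ψ x - gradient φ x) p volume ≤ δ := by
  obtain ⟨χ, hχ, hχc, hχ0, hχ1, hχone, hχzero⟩ := exists_cutoff n one_pos
  obtain ⟨C, hC0, hC⟩ := exists_norm_gradient_le hχ hχc
  obtain ⟨L, hL0, hL⟩ := exists_norm_gradient_le hφ hφc
  -- On the small ball the term `χ ∇φ` contributes at most `L` and `φ ∇χ` at most `2 L C`; the same
  -- constant bounds the error in the function, as `r ≤ 1`.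
  obtain ⟨r, hr, hr1, hrδ⟩ :=
    exists_eLpNorm_indicator_closedBall_le hn hp1 hp (L * (1 + 2 * C)) hδ
  -- The linear vanishing of `φ` offsets the factor `R = 2 / r` in the gradient of the dilated
  -- cutoff. Thus the error stays bounded, on a ball whose volume tends to zero.
  have hφL : ∀ x, |φ x| ≤ L * ‖x‖ := by
    intro x
    have := Convex.norm_image_sub_le_of_norm_fderiv_le (𝕜 := ℝ) (f := φ) (s := univ) (C := L)
      (fun y _ => (hφ.differentiable (by simp)) y)
      (fun y _ => by rw [← norm_gradient]; exact hL y) convex_univ (mem_univ 0) (mem_univ x)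
    simpa [hφ0] using this
  set R : ℝ := 2 / r with hR
  have hR0 : 0 < R := by positivity
  set χR : EuclideanSpace ℝ (Fin n) → ℝ := fun x => χ (R • x) with hχR
  have hχRd : ContDiff ℝ ∞ χR := hχ.comp (contDiff_const_smul _)
  have hnorm : ∀ x : EuclideanSpace ℝ (Fin n), ‖R • x‖ = R * ‖x‖ := fun x => by
    rw [norm_smul, Real.norm_of_nonneg hR0.le]
  have hzero : ∀ x, r ≤ ‖x‖ → χR x = 0 := fun x hx => hχzero _ (by
    rw [hnorm, hR, div_mul_eq_mul_div, le_div_iff₀ hr]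
    linarith)
  have hgrad : ∀ x, ‖gradient χR x‖ ≤ R * C := by
    intro x
    rw [hχR, gradient_comp_smul, norm_smul, Real.norm_of_nonneg hR0.le]
    exact mul_le_mul_of_nonneg_left (hC _) hR0.le
  have hgrad0 : ∀ x, r < ‖x‖ → gradient χR x = 0 := fun x hx =>
    gradient_eq_zero_of_eventuallyEq_const (c := 0) (by
      filter_upwards [(isOpen_lt continuous_const continuous_norm).mem_nhds hx] with y hy
      exact hzero y (le_of_lt hy))
  have hdφ := hφ.differentiable (by simp)
  have hdχ := hχRd.differentiable (by simp)
  have hmem : ∀ x : EuclideanSpace ℝ (Fin n), ‖x‖ ≤ r → x ∈ Metric.closedBall 0 r := fun x hx => by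
    simpa using hx
  have hnmem : ∀ x : EuclideanSpace ℝ (Fin n), ¬ ‖x‖ ≤ r → x ∉ Metric.closedBall 0 r :=
    fun x hx => by simpa using hx
  refine ⟨fun x => φ x - χR x * φ x, hφ.sub (hχRd.mul hφ), ?_, ?_, ?_, ?_⟩
  · exact hφc.sub hφc.mul_left
  · have h1 : ∀ᶠ x : EuclideanSpace ℝ (Fin n) in 𝓝 0, ‖x‖ < R⁻¹ :=
      (isOpen_lt continuous_norm continuous_const).mem_nhds (by simpa using hR0)
    filter_upwards [h1] with x hx
    have : χR x = 1 := hχone _ (by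
      rw [hnorm, ← mul_inv_cancel₀ hR0.ne']
      exact mul_le_mul_of_nonneg_left hx.le hR0.le)
    rw [this, one_mul, sub_self]
  · refine (eLpNorm_mono_real fun x => ?_).trans hrδ
    by_cases hx : ‖x‖ ≤ r
    · rw [indicator_of_mem (hmem x hx)]
      have h3 : φ x - χR x * φ x - φ x = - (χR x * φ x) := by ring
      rw [h3, norm_neg, norm_mul, Real.norm_of_nonneg (hχ0 _), Real.norm_eq_abs]
      calc χR x * |φ x| ≤ 1 * (L * 1) :=
            mul_le_mul (hχ1 _) ((hφL x).trans (mul_le_mul_of_nonneg_left (hx.trans hr1) hL0))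
              (abs_nonneg _) zero_le_one
        _ ≤ L * (1 + 2 * C) := by nlinarith [mul_nonneg hL0 hC0]
    · rw [indicator_of_notMem (hnmem x hx)]
      simp [hzero x (not_le.1 hx).le]
  · refine (eLpNorm_mono_real fun x => ?_).trans hrδ
    rw [gradient_sub (ψ := fun x => χR x * φ x) (hdφ x) ((hdχ x).mul (hdφ x)), gradient_mul (hdχ x) (hdφ x),
      sub_sub_cancel_left, norm_neg]
    by_cases hx : ‖x‖ ≤ r
    · rw [indicator_of_mem (hmem x hx)]
      refine (norm_add_le _ _).trans ?_
      rw [norm_smul, norm_smul, Real.norm_of_nonneg (hχ0 _), Real.norm_eq_abs]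
      have h1 : χR x * ‖gradient φ x‖ ≤ 1 * L :=
        mul_le_mul (hχ1 _) (hL x) (norm_nonneg _) zero_le_one
      have h2 : |φ x| * ‖gradient χR x‖ ≤ (L * r) * (R * C) :=
        mul_le_mul ((hφL x).trans (mul_le_mul_of_nonneg_left hx hL0)) (hgrad x) (norm_nonneg _)
          (by positivity)
      have h3 : (L * r) * (R * C) = 2 * (L * C) := by
        rw [hR]; field_simp
      linarith
    · rw [indicator_of_notMem (hnmem x hx), hzero x (not_le.1 hx).le, hgrad0 x (not_le.1 hx)]
      simp

end ConeSobolev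

/-! ### The capacity of the origin, `p ≤ n` -/

namespace ConeSobolev

variable {n : ℕ}

theorem gradient_fun_sum {ι : Type*} (s : Finset ι) {φ : ι → EuclideanSpace ℝ (Fin n) → ℝ}
    {x : EuclideanSpace ℝ (Fin n)} (h : ∀ i ∈ s, DifferentiableAt ℝ (φ i) x) :
    gradient (fun y => ∑ i ∈ s, φ i y) x = ∑ i ∈ s, gradient (φ i) x := by
  rw [gradient, fderiv_fun_sum h, map_sum]
  rfl

/-- A sum with at most one nonzero term. -/
theorem enorm_sum_rpow_le {F ι : Type*} [NormedAddCommGroup F] (s : Finset ι) (a : ι → F)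
    (h : ∀ i ∈ s, ∀ j ∈ s, a i ≠ 0 → a j ≠ 0 → i = j) {q : ℝ} (hq : 0 < q) :
    ‖∑ i ∈ s, a i‖ₑ ^ q ≤ ∑ i ∈ s, ‖a i‖ₑ ^ q := by
  by_cases h0 : ∃ i ∈ s, a i ≠ 0
  · obtain ⟨i, hi, hai⟩ := h0
    have h1 : ∑ j ∈ s, a j = a i := Finset.sum_eq_single_of_mem i hi fun j hj hji => by
      by_contra haj
      exact hji (h j hj i hi haj hai)
    rw [h1]
    exact Finset.single_le_sum (f := fun i => ‖a i‖ₑ ^ q) (fun _ _ => zero_le) hi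
  · push Not at h0
    rw [Finset.sum_eq_zero h0, enorm_zero, ENNReal.zero_rpow_of_pos hq]
    exact zero_le

/-- The origin has zero `n`-capacity, `n ≥ 2`. -/
theorem exists_eLpNorm_gradient_le (hn : 2 ≤ n) {ρ : ℝ} (hρ : 0 < ρ) {δ : ℝ≥0∞} (hδ : 0 < δ) :
    ∃ η : EuclideanSpace ℝ (Fin n) → ℝ, ContDiff ℝ ∞ η ∧ HasCompactSupport η ∧
      η 0 = 1 ∧ (∀ x, |η x| ≤ 1) ∧ (∀ x, 2 * ρ ≤ ‖x‖ → η x = 0) ∧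
      eLpNorm (gradient η) n volume ≤ δ := by
  obtain ⟨χ, hχ, hχc, hχ0, hχ1, hχone, hχzero⟩ := exists_cutoff n hρ
  have hp0 : (n : ℝ≥0∞) ≠ 0 := by simp; omega
  have hpt : (n : ℝ≥0∞) ≠ ⊤ := ENNReal.natCast_ne_top n
  have hnr : (0 : ℝ) < n := by exact_mod_cast (by omega : 0 < n)
  set A := eLpNorm (gradient χ) n volume with hA
  have hAt : A ≠ ⊤ := (memLp_gradient hχ hχc _ volume).2.ne
  -- The average of `k` dilated cutoffs with disjointly supported gradients, each of the same `Lⁿ`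
  -- norm `A`, has gradient norm at most `k⁻¹ k^(1/n) A`; this tends to zero because `n ≥ 2`.
  have hlim : Tendsto (fun k : ℕ => ENNReal.ofReal ((k : ℝ) ^ (-(1 - 1 / (n : ℝ)))) * A) atTop
      (𝓝 0) := by
    have hexp : 0 < 1 - 1 / (n : ℝ) := by
      rw [sub_pos, div_lt_one hnr]
      exact_mod_cast (by omega : 1 < n)
    have h1 := (tendsto_rpow_neg_atTop hexp).comp tendsto_natCast_atTop_atTop
    have h2 := (ENNReal.continuous_ofReal.tendsto 0).comp h1
    rw [ENNReal.ofReal_zero] at h2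
    simpa using ENNReal.Tendsto.mul_const h2 (Or.inr hAt)
  obtain ⟨k, hkδ, hk0⟩ := ((hlim.eventually (gt_mem_nhds hδ)).and (eventually_gt_atTop 0)).exists
  have hkr : (0 : ℝ) < k := by exact_mod_cast hk0
  -- The gradient of the `i`-th cutoff lives on the annulus `ρ ≤ s i * ‖x‖ ≤ 2 * ρ`; the ratio `4 >
  -- 2` makes these closed annuli disjoint.
  set s : ℕ → ℝ := fun i => 4 ^ i with hs
  have hs1 : ∀ i, 1 ≤ s i := fun i => one_le_pow₀ (by norm_num)
  have hs0 : ∀ i, 0 < s i := fun i => one_pos.trans_le (hs1 i)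
  set χs : ℕ → EuclideanSpace ℝ (Fin n) → ℝ := fun i x => χ (s i • x) with hχs
  have hχsd : ∀ i, ContDiff ℝ ∞ (χs i) := fun i => hχ.comp (contDiff_const_smul _)
  have hgrad : ∀ i x, gradient (χs i) x = s i • gradient χ (s i • x) := fun i x =>
    gradient_comp_smul χ (s i) x
  have hgradne : ∀ i x, gradient (χs i) x ≠ 0 → ρ ≤ s i * ‖x‖ ∧ s i * ‖x‖ ≤ 2 * ρ := by
    intro i x hx
    have hnorm : ‖s i • x‖ = s i * ‖x‖ := by rw [norm_smul, Real.norm_of_nonneg (hs0 i).le]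
    by_contra hcon
    refine hx ?_
    rw [hgrad]
    rw [← hnorm, not_and_or, not_le, not_le] at hcon
    rcases hcon with h | h
    · rw [gradient_eq_zero_of_eventuallyEq_const (c := 1), smul_zero]
      filter_upwards [(isOpen_lt continuous_norm continuous_const).mem_nhds h] with y hy
      exact hχone y (le_of_lt hy)
    · rw [gradient_eq_zero_of_eventuallyEq_const (c := 0), smul_zero]
      filter_upwards [(isOpen_lt continuous_const continuous_norm).mem_nhds h] with y hy
      exact hχzero y (le_of_lt hy)
  have hlt : ∀ i j, ∀ x : EuclideanSpace ℝ (Fin n), gradient (χs i) x ≠ 0 →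
      gradient (χs j) x ≠ 0 → ¬ i < j := by
    intro i j x hi hj hij
    have h1 := (hgradne i x hi).1
    have h2 := (hgradne j x hj).2
    have h3 : s i * 4 ≤ s j := by
      rw [hs]
      change (4 : ℝ) ^ i * 4 ≤ 4 ^ j
      rw [← pow_succ]
      exact pow_le_pow_right₀ (by norm_num) hij
    nlinarith [norm_nonneg x]
  have hdisj : ∀ x, ∀ i ∈ Finset.range k, ∀ j ∈ Finset.range k, gradient (χs i) x ≠ 0 →
      gradient (χs j) x ≠ 0 → i = j := fun x i _ j _ hi hj =>
    le_antisymm (not_lt.1 (hlt j i x hj hi)) (not_lt.1 (hlt i j x hi hj))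
  have hsum : ContDiff ℝ ∞ fun x => ∑ i ∈ Finset.range k, χs i x :=
    ContDiff.sum fun i _ => hχsd i
  have hχs1 : ∀ i x, χs i x ≤ 1 := fun i x => hχ1 _
  have hχsz : ∀ i x, 2 * ρ ≤ ‖x‖ → χs i x = 0 := fun i x hx => hχzero _ (by
    rw [norm_smul, Real.norm_of_nonneg (hs0 i).le]
    nlinarith [hs1 i, norm_nonneg x])
  have hηz : ∀ x, 2 * ρ ≤ ‖x‖ → (k : ℝ)⁻¹ * ∑ i ∈ Finset.range k, χs i x = 0 := fun x hx => by
    rw [Finset.sum_eq_zero fun i _ => hχsz i x hx, mul_zero]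
  refine ⟨fun x => (k : ℝ)⁻¹ * ∑ i ∈ Finset.range k, χs i x, contDiff_const.mul hsum,
    ?_, ?_, ?_, hηz, ?_⟩
  · refine HasCompactSupport.intro (isCompact_closedBall (0 : EuclideanSpace ℝ (Fin n)) (2 * ρ))
      fun x hx => hηz x ?_
    rw [mem_closedBall_zero_iff, not_le] at hx
    exact hx.le
  · have : ∀ i, χs i 0 = 1 := fun i => hχone _ (by simpa using hρ.le)
    simp [this, hkr.ne']
  · intro x
    rw [abs_of_nonneg (mul_nonneg (by positivity) (Finset.sum_nonneg fun i _ => hχ0 _)),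
      inv_mul_le_iff₀ hkr, mul_one]
    calc ∑ i ∈ Finset.range k, χs i x ≤ ∑ i ∈ Finset.range k, (1 : ℝ) :=
          Finset.sum_le_sum fun i _ => hχs1 i x
      _ = k := by simp
  · refine le_trans ?_ hkδ.le
    have hg : gradient (fun x => (k : ℝ)⁻¹ * ∑ i ∈ Finset.range k, χs i x)
        = (k : ℝ)⁻¹ • fun x => ∑ i ∈ Finset.range k, gradient (χs i) x := by
      ext1 x
      rw [gradient_const_mul ((hsum.differentiable (by simp)) x),
        gradient_fun_sum _ fun i _ => ((hχsd i).differentiable (by simp)) x]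
      rfl
    -- Conformal invariance of the `n`-energy: the chain rule gives the factor `s i`, the change of
    -- variables in `Lⁿ` its inverse.
    have hint : ∀ i, ∫⁻ x, ‖gradient (χs i) x‖ₑ ^ (n : ℝ) = A ^ (n : ℝ) := by
      intro i
      have h1 : eLpNorm (gradient (χs i)) n volume = A := by
        have e : gradient (χs i) = s i • fun x => gradient χ (s i • x) := funext (hgrad i)
        have h2 := eLpNorm_comp_smul (n := n) (S := univ) MeasurableSet.univ (hs0 i)
          preimage_univ hpt (continuous_gradient hχ)
        rw [Measure.restrict_univ, ENNReal.toReal_natCast, div_self hnr.ne',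
          Real.rpow_neg_one] at h2
        rw [e, eLpNorm_const_smul, h2, Real.enorm_of_nonneg (hs0 i).le, ← mul_assoc,
          ← ENNReal.ofReal_mul (hs0 i).le, mul_inv_cancel₀ (hs0 i).ne', ENNReal.ofReal_one,
          one_mul]
      rw [← h1, eLpNorm_eq_lintegral_rpow_enorm_toReal hp0 hpt, ENNReal.toReal_natCast,
        ← ENNReal.rpow_mul, one_div, inv_mul_cancel₀ hnr.ne', ENNReal.rpow_one]
    have hN : eLpNorm (fun x => ∑ i ∈ Finset.range k, gradient (χs i) x) n volume
        ≤ (k : ℝ≥0∞) ^ (1 / (n : ℝ)) * A := by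
      rw [eLpNorm_eq_lintegral_rpow_enorm_toReal hp0 hpt, ENNReal.toReal_natCast]
      calc (∫⁻ x, ‖∑ i ∈ Finset.range k, gradient (χs i) x‖ₑ ^ (n : ℝ)) ^ (1 / (n : ℝ))
          ≤ (∫⁻ x, ∑ i ∈ Finset.range k, ‖gradient (χs i) x‖ₑ ^ (n : ℝ)) ^ (1 / (n : ℝ)) := by
            gcongr with x
            exact enorm_sum_rpow_le _ _ (hdisj x) hnr
        _ = ((k : ℝ≥0∞) * A ^ (n : ℝ)) ^ (1 / (n : ℝ)) := by
            rw [lintegral_finsetSum _ fun i _ =>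
              ((continuous_gradient (hχsd i)).enorm.measurable.pow_const _),
              Finset.sum_congr rfl fun i _ => hint i]
            simp
        _ = (k : ℝ≥0∞) ^ (1 / (n : ℝ)) * A := by
            rw [ENNReal.mul_rpow_of_nonneg _ _ (by positivity), ← ENNReal.rpow_mul, one_div,
              mul_inv_cancel₀ hnr.ne', ENNReal.rpow_one]
    rw [hg, eLpNorm_const_smul, Real.enorm_of_nonneg (by positivity)]
    calc ENNReal.ofReal (k : ℝ)⁻¹ * eLpNorm (fun x => ∑ i ∈ Finset.range k, gradient (χs i) x)
          n volume ≤ ENNReal.ofReal (k : ℝ)⁻¹ * ((k : ℝ≥0∞) ^ (1 / (n : ℝ)) * A) := by gcongr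
      _ = ENNReal.ofReal ((k : ℝ) ^ (-(1 - 1 / (n : ℝ)))) * A := by
          rw [← mul_assoc, ← ENNReal.ofReal_natCast k, ENNReal.ofReal_rpow_of_pos hkr,
            ← ENNReal.ofReal_mul (by positivity), ← Real.rpow_neg_one (k : ℝ),
            ← Real.rpow_add hkr]
          ring_nf

/-- For `p ≤ n` the evaluation at the origin is not continuous for the `W^1_p` norm. -/
theorem exists_testFunction_eq_one_of_le (hn : 2 ≤ n) {p : ℝ≥0∞} (hp1 : 1 ≤ p)
    (hpn : p ≤ n) {δ : ℝ≥0∞} (hδ : 0 < δ) :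
    ∃ η : EuclideanSpace ℝ (Fin n) → ℝ, ContDiff ℝ ∞ η ∧ HasCompactSupport η ∧ η 0 = 1 ∧
      eLpNorm η p volume ≤ δ ∧ eLpNorm (gradient η) p volume ≤ δ := by
  have hp : p ≠ ⊤ := (hpn.trans_lt (ENNReal.natCast_lt_top n)).ne
  have hpr : 0 < p.toReal := ENNReal.toReal_pos (one_pos.trans_le hp1).ne' hp
  have hprn : p.toReal ≤ n := by
    simpa using ENNReal.toReal_mono (ENNReal.natCast_ne_top n) hpn
  obtain ⟨r, hr, hr1, hrδ⟩ := exists_eLpNorm_indicator_closedBall_le (n := n) (by omega) hp1 hp 1 hδ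
  set B := Metric.closedBall (0 : EuclideanSpace ℝ (Fin n)) r with hB
  -- Hölder's inequality on the ball `B`, which carries `η` and its gradient, reduces `p ≤ n` to the
  -- exponent `n`.
  set a : ℝ := 1 / p.toReal - 1 / (n : ℝ) with ha
  have ha0 : 0 ≤ a := sub_nonneg.2 (one_div_le_one_div_of_le hpr hprn)
  set w := volume B ^ a with hw
  have hwt : w ≠ ⊤ := ENNReal.rpow_ne_top_of_nonneg ha0 measure_closedBall_lt_top.ne
  obtain ⟨η, hη, hηc, hη0, hη1, hηz, hηδ⟩ := exists_eLpNorm_gradient_le hn (half_pos hr)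
    (δ := δ / (w + 1)) (ENNReal.div_pos hδ.ne' (ENNReal.add_ne_top.2 ⟨hwt, ENNReal.one_ne_top⟩))
  have hηz' : ∀ x, r ≤ ‖x‖ → η x = 0 := fun x hx => hηz x (by linarith)
  refine ⟨η, hη, hηc, hη0, (eLpNorm_mono_real fun x => ?_).trans hrδ, ?_⟩
  · by_cases hx : ‖x‖ ≤ r
    · rw [indicator_of_mem (by simpa [hB] using hx)]
      exact hη1 x
    · rw [indicator_of_notMem (by simpa [hB] using hx), hηz' x (not_le.1 hx).le, norm_zero]
  · have hind : B.indicator (gradient η) = gradient η := by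
      refine indicator_eq_self.2 fun x hx => ?_
      by_contra hxB
      have h1 : r < ‖x‖ := by simpa [hB] using hxB
      refine hx (gradient_eq_zero_of_eventuallyEq_const (c := 0) ?_)
      filter_upwards [(isOpen_lt continuous_const continuous_norm).mem_nhds h1] with y hy
      exact hηz' y (le_of_lt hy)
    have h2 := eLpNorm_le_eLpNorm_mul_rpow_measure_univ (μ := volume.restrict B) hpn
      (continuous_gradient hη).aestronglyMeasurable
    rw [Measure.restrict_apply_univ, ENNReal.toReal_natCast,
      ← eLpNorm_indicator_eq_eLpNorm_restrict Metric.isClosed_closedBall.measurableSet, hind] at h2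
    calc eLpNorm (gradient η) p volume
        ≤ eLpNorm (gradient η) n (volume.restrict B) * w := h2
      _ ≤ δ / (w + 1) * (w + 1) := by
          gcongr
          · exact (eLpNorm_mono_measure _ Measure.restrict_le_self).trans hηδ
          · exact le_self_add
      _ = δ := ENNReal.div_mul_cancel (by simp) (ENNReal.add_ne_top.2 ⟨hwt, ENNReal.one_ne_top⟩)

end ConeSobolev

/-! ### Approximation on a convex cone by functions vanishing near the vertex -/

namespace ConeSobolev

section Distance

variable {n : ℕ} {U : Set (EuclideanSpace ℝ (Fin n))} {p : ℝ≥0∞}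

theorem sobolevDist_triangle (hp1 : 1 ≤ p) {φ ψ f : EuclideanSpace ℝ (Fin n) → ℝ}
    {g : EuclideanSpace ℝ (Fin n) → EuclideanSpace ℝ (Fin n)} (hφ : ContDiff ℝ ∞ φ)
    (hψ : ContDiff ℝ ∞ ψ) (hf : AEStronglyMeasurable f (volume.restrict U))
    (hg : AEStronglyMeasurable g (volume.restrict U)) :
    sobolevDist U p ψ f g ≤ sobolevDist U p ψ φ (gradient φ) + sobolevDist U p φ f g := by
  have h1 : eLpNorm (fun x => ψ x - f x) p (volume.restrict U)
      ≤ eLpNorm (fun x => ψ x - φ x) p (volume.restrict U)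
        + eLpNorm (fun x => φ x - f x) p (volume.restrict U) := by
    have e : (fun x => ψ x - f x) = (fun x => ψ x - φ x) + fun x => φ x - f x := by
      ext x; simp
    rw [e]
    exact eLpNorm_add_le (hψ.sub hφ).continuous.aestronglyMeasurable
      (hφ.continuous.aestronglyMeasurable.sub hf) hp1
  have h2 : eLpNorm (fun x => gradient ψ x - g x) p (volume.restrict U)
      ≤ eLpNorm (fun x => gradient ψ x - gradient φ x) p (volume.restrict U)
        + eLpNorm (fun x => gradient φ x - g x) p (volume.restrict U) := by
    have e : (fun x => gradient ψ x - g x)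
        = (fun x => gradient ψ x - gradient φ x) + fun x => gradient φ x - g x := by
      ext1 x; simp
    rw [e]
    exact eLpNorm_add_le
      ((continuous_gradient hψ).sub (continuous_gradient hφ)).aestronglyMeasurable
      ((continuous_gradient hφ).aestronglyMeasurable.sub hg) hp1
  refine (add_le_add h1 h2).trans_eq ?_
  simp only [sobolevDist]
  ring

theorem sobolevDist_mono {V : Set (EuclideanSpace ℝ (Fin n))} (h : U ⊆ V)
    (φ f : EuclideanSpace ℝ (Fin n) → ℝ)
    (g : EuclideanSpace ℝ (Fin n) → EuclideanSpace ℝ (Fin n)) :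
    sobolevDist U p φ f g ≤ sobolevDist V p φ f g :=
  add_le_add (eLpNorm_mono_measure _ (Measure.restrict_mono h le_rfl))
    (eLpNorm_mono_measure _ (Measure.restrict_mono h le_rfl))

/-- A test function can be made to vanish near the origin, at a cost governed by its value there. -/
theorem exists_sobolevDist_le_add (hn : n ≠ 0) (hp1 : 1 ≤ p) (hp : p ≠ ⊤)
    {φ η f : EuclideanSpace ℝ (Fin n) → ℝ}
    {g : EuclideanSpace ℝ (Fin n) → EuclideanSpace ℝ (Fin n)} (hφ : ContDiff ℝ ∞ φ)
    (hφc : HasCompactSupport φ) (hη : ContDiff ℝ ∞ η) (hηc : HasCompactSupport η)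
    (hη0 : η 0 = 1) (hf : AEStronglyMeasurable f (volume.restrict U))
    (hg : AEStronglyMeasurable g (volume.restrict U)) {δ : ℝ≥0∞} (hδ : 0 < δ) :
    ∃ ψ : EuclideanSpace ℝ (Fin n) → ℝ, ContDiff ℝ ∞ ψ ∧ HasCompactSupport ψ ∧
      (∀ᶠ x in 𝓝 0, ψ x = 0) ∧
      sobolevDist U p ψ f g ≤ δ + (‖φ 0‖ₑ * (eLpNorm η p volume + eLpNorm (gradient η) p volume)
        + sobolevDist U p φ f g) := by
  -- This difference vanishes at the origin, hence can be cut off there at cost `δ`; passing from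
  -- `φ` to it costs `|φ 0|` times the norm of `η`.
  set φ₁ : EuclideanSpace ℝ (Fin n) → ℝ := fun x => φ x - φ 0 * η x with hφ₁
  have hηd : ContDiff ℝ ∞ fun x => φ 0 * η x := contDiff_const.mul hη
  have hφ₁d : ContDiff ℝ ∞ φ₁ := hφ.sub hηd
  have hφ₁c : HasCompactSupport φ₁ := hφc.sub hηc.mul_left
  obtain ⟨ψ, hψ, hψc, hψ0, h1, h2⟩ := exists_approx_eventually_eq_zero hn hp1 hp hφ₁d hφ₁c
    (by simp [hφ₁, hη0]) (ENNReal.half_pos hδ.ne')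
  refine ⟨ψ, hψ, hψc, hψ0, (sobolevDist_triangle hp1 hφ₁d hψ hf hg).trans
    (add_le_add ?_ ((sobolevDist_triangle hp1 hφ hφ₁d hf hg).trans (add_le_add ?_ le_rfl)))⟩
  · calc sobolevDist U p ψ φ₁ (gradient φ₁) ≤ δ / 2 + δ / 2 :=
          add_le_add ((eLpNorm_mono_measure _ Measure.restrict_le_self).trans h1)
            ((eLpNorm_mono_measure _ Measure.restrict_le_self).trans h2)
      _ = δ := ENNReal.add_halves δ
  · have e1 : (fun x => φ₁ x - φ x) = (-φ 0) • η := by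
      ext x
      simp [hφ₁]
    have e2 : (fun x => gradient φ₁ x - gradient φ x) = (-φ 0) • gradient η := by
      ext1 x
      rw [hφ₁, gradient_sub (ψ := fun x => φ 0 * η x) ((hφ.differentiable (by simp)) x)
        ((hηd.differentiable (by simp)) x), gradient_const_mul ((hη.differentiable (by simp)) x)]
      simp
    rw [sobolevDist, e1, e2, eLpNorm_const_smul, eLpNorm_const_smul, enorm_neg, mul_add]
    gcongr <;> exact Measure.restrict_le_self

/-- The approximant `φ` comes first and fixes `φ 0`; zero capacity then provides an `η` whose norm
is small compared with `1 / (‖φ 0‖ₑ + 1)`. The total is `δ + 2δ + 2δ`. -/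
theorem IsOpenConvexCone.exists_sobolevDist_le_of_le (hU : IsOpenConvexCone U) (hn : 2 ≤ n)
    (hp1 : 1 ≤ p) (hpn : p ≤ n) {f : EuclideanSpace ℝ (Fin n) → ℝ}
    {g : EuclideanSpace ℝ (Fin n) → EuclideanSpace ℝ (Fin n)}
    (hf : MemLp f p (volume.restrict U)) (hg : MemLp g p (volume.restrict U))
    (hfg : IsWeakGradient U f g) {δ : ℝ≥0∞} (hδ : 0 < δ) :
    ∃ ψ : EuclideanSpace ℝ (Fin n) → ℝ, ContDiff ℝ ∞ ψ ∧ HasCompactSupport ψ ∧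
      (∀ᶠ x in 𝓝 0, ψ x = 0) ∧ sobolevDist U p ψ f g ≤ 5 * δ := by
  have hp : p ≠ ⊤ := (hpn.trans_lt (ENNReal.natCast_lt_top n)).ne
  obtain ⟨φ, hφ, hφc, h1, h2⟩ := hU.exists_testFunction_approx hp1 hp hf hg hfg hδ
  have ht : ‖φ 0‖ₑ + 1 ≠ ⊤ := ENNReal.add_ne_top.2 ⟨enorm_ne_top, ENNReal.one_ne_top⟩
  obtain ⟨η, hη, hηc, hη0, h3, h4⟩ := exists_testFunction_eq_one_of_le hn hp1 hpn
    (δ := δ / (‖φ 0‖ₑ + 1)) (ENNReal.div_pos hδ.ne' ht)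
  obtain ⟨ψ, hψ, hψc, hψ0, h5⟩ := exists_sobolevDist_le_add (by omega) hp1 hp hφ hφc hη hηc hη0
    hf.1 hg.1 hδ
  refine ⟨ψ, hψ, hψc, hψ0, h5.trans ?_⟩
  calc δ + (‖φ 0‖ₑ * (eLpNorm η p volume + eLpNorm (gradient η) p volume)
        + sobolevDist U p φ f g)
      ≤ δ + ((‖φ 0‖ₑ + 1) * (δ / (‖φ 0‖ₑ + 1) + δ / (‖φ 0‖ₑ + 1)) + (δ + δ)) := by
        gcongr
        · exact le_self_add
        · exact add_le_add h1 h2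
    _ = 5 * δ := by
        rw [mul_add, ENNReal.mul_div_cancel (by simp) ht]
        ring

end Distance

section Limits

variable {n : ℕ} {U : Set (EuclideanSpace ℝ (Fin n))} {f f' : EuclideanSpace ℝ (Fin n) → ℝ}
  {c c' : ℝ}

theorem IsOpenConvexCone.nhdsWithin_neBot (hU : IsOpenConvexCone U) : (𝓝[U] 0).NeBot := by
  rw [← mem_closure_iff_nhdsWithin_neBot, Metric.mem_closure_iff]
  intro ε hε
  obtain ⟨c, hc, hcε⟩ := hU.exists_norm_lt hε
  exact ⟨c, hc, by simpa using hcε⟩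

theorem HasLimitAtVertex.congr (h : HasLimitAtVertex U f c) (hff : f' =ᵐ[volume.restrict U] f) :
    HasLimitAtVertex U f' c := by
  obtain ⟨g, h1, h2, h3⟩ := h
  exact ⟨g, hff.trans h1, h2, h3⟩

theorem HasLimitAtVertex.add (h : HasLimitAtVertex U f c) (h' : HasLimitAtVertex U f' c') :
    HasLimitAtVertex U (f + f') (c + c') := by
  obtain ⟨g, h1, h2, h3⟩ := h
  obtain ⟨g', h1', h2', h3'⟩ := h'
  exact ⟨g + g', h1.add h1', h2.add h2', h3.add h3'⟩

theorem HasLimitAtVertex.const_smul (h : HasLimitAtVertex U f c) (a : ℝ) :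
    HasLimitAtVertex U (a • f) (a * c) := by
  obtain ⟨g, h1, h2, h3⟩ := h
  exact ⟨a • g, h1.const_smul a, h2.const_smul a, h3.const_smul a⟩

theorem hasLimitAtVertex_of_continuous (hf : Continuous f) : HasLimitAtVertex U f (f 0) :=
  ⟨f, .rfl, hf.continuousOn, hf.continuousWithinAt⟩

/-- Continuous representatives that agree almost everywhere on an open set agree everywhere on it,
and the vertex is in the closure of `U`. -/
theorem HasLimitAtVertex.unique (hU : IsOpenConvexCone U) (h : HasLimitAtVertex U f c)
    (h' : HasLimitAtVertex U f c') : c = c' := by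
  obtain ⟨g, h1, h2, h3⟩ := h
  obtain ⟨g', h1', h2', h3'⟩ := h'
  have heq : EqOn g g' U :=
    Measure.eqOn_open_of_ae_eq (h1.symm.trans h1') hU.isOpen h2 h2'
  have := hU.nhdsWithin_neBot
  refine tendsto_nhds_unique h3 (h3'.congr' ?_)
  filter_upwards [self_mem_nhdsWithin] with x hx
  exact (heq hx).symm

/-- The order of choices is the reverse of the case `p ≤ n`: here `η` is fixed, and `|φ 0|` is small
because the limit of `f` is zero and differs from `φ 0` by at most `C` times the distance. The
resulting `3 * δ` is relaxed to the bound of the other case, so that one gluing lemma serves both.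
-/
theorem IsOpenConvexCone.exists_sobolevDist_le_of_limit {p : ℝ≥0∞} (hU : IsOpenConvexCone U)
    (hn : n ≠ 0) (hp1 : 1 ≤ p) (hpn : (n : ℝ≥0∞) < p) (hp : p ≠ ⊤)
    {g : EuclideanSpace ℝ (Fin n) → EuclideanSpace ℝ (Fin n)}
    (hf : MemLp f p (volume.restrict U)) (hg : MemLp g p (volume.restrict U))
    (hfg : IsWeakGradient U f g) (hlim : HasLimitAtVertex U f 0) {δ : ℝ≥0∞} (hδ : 0 < δ) :
    ∃ ψ : EuclideanSpace ℝ (Fin n) → ℝ, ContDiff ℝ ∞ ψ ∧ HasCompactSupport ψ ∧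
      (∀ᶠ x in 𝓝 0, ψ x = 0) ∧ sobolevDist U p ψ f g ≤ 5 * δ := by
  obtain ⟨C, hC, htr⟩ := hU.exists_hasLimitAtVertex hp1 hpn hp
  obtain ⟨c, hc, hest⟩ := htr f g hf hg hfg
  obtain rfl := hc.unique hU hlim
  obtain ⟨η, hη, hηc, -, -, hη1, -⟩ := exists_cutoff n one_pos
  set N := eLpNorm η p volume + eLpNorm (gradient η) p volume with hN
  have hNt : N ≠ ⊤ := ENNReal.add_ne_top.2
    ⟨(memLp_of_contDiff hη hηc p volume).2.ne, (memLp_gradient hη hηc p volume).2.ne⟩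
  have ht : C * N + 1 ≠ ⊤ := ENNReal.add_ne_top.2 ⟨ENNReal.mul_ne_top hC hNt, ENNReal.one_ne_top⟩
  set ε := δ / (C * N + 1) with hε
  have hεδ : (C * N + 1) * ε = δ := ENNReal.mul_div_cancel (by simp) ht
  have hε0 : 0 < ε := ENNReal.div_pos hδ.ne' ht
  obtain ⟨φ, hφ, hφc, h1, h2⟩ := hU.exists_testFunction_approx hp1 hp hf hg hfg hε0
  obtain ⟨ψ, hψ, hψc, hψ0, h5⟩ := exists_sobolevDist_le_add hn hp1 hp hφ hφc hη hηc
    (hη1 0 (by simp)) hf.1 hg.1 hδ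
  have h6 : sobolevDist U p φ f g ≤ 2 * ε := (add_le_add h1 h2).trans_eq (two_mul ε).symm
  have h7 : ‖φ 0‖ₑ ≤ C * (2 * ε) := by
    have := hest φ hφ
    rw [zero_sub, enorm_neg] at this
    exact this.trans (by gcongr)
  refine ⟨ψ, hψ, hψc, hψ0, h5.trans ?_⟩
  calc δ + (‖φ 0‖ₑ * N + sobolevDist U p φ f g) ≤ δ + (C * (2 * ε) * N + 2 * ε) := by gcongr
    _ = δ + 2 * ((C * N + 1) * ε) := by ring
    _ = 3 * δ := by rw [hεδ]; ring
    _ ≤ 5 * δ := by gcongr; norm_num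

end Limits

/-! ### The Sobolev norm expressed through representatives -/

section SobolevSpace

variable {n : ℕ} {O : TopologicalSpace.Opens (EuclideanSpace ℝ (Fin n))} {p : ℝ≥0∞}
  [hp : Fact (1 ≤ p)]

theorem SobolevSpace.isWeakGradient_grad (f : SobolevSpace O p) :
    IsWeakGradient (O : Set (EuclideanSpace ℝ (Fin n))) (SobolevSpace.val O p f)
      (SobolevSpace.grad O p f) :=
  (SobolevSpace.exists_grad O p f).choose_spec

theorem mem_sobolev_iff {f : Lp ℝ p (volume.restrict (O : Set (EuclideanSpace ℝ (Fin n))))} :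
    f ∈ sobolev O p ↔ ∃ F : SobolevSpace O p, SobolevSpace.val O p F = f :=
  ⟨fun h => ⟨⟨f, h⟩, rfl⟩, by rintro ⟨F, rfl⟩; exact F.2⟩

/-- A function in `L^p` with an `L^p` distributional gradient gives an element of `W^1_p`. -/
theorem exists_sobolevSpace_of_memLp {f : EuclideanSpace ℝ (Fin n) → ℝ}
    {g : EuclideanSpace ℝ (Fin n) → EuclideanSpace ℝ (Fin n)}
    (hf : MemLp f p (volume.restrict (O : Set (EuclideanSpace ℝ (Fin n)))))
    (hg : MemLp g p (volume.restrict (O : Set (EuclideanSpace ℝ (Fin n)))))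
    (hfg : IsWeakGradient (O : Set (EuclideanSpace ℝ (Fin n))) f g) :
    ∃ F : SobolevSpace O p,
      SobolevSpace.val O p F =ᵐ[volume.restrict (O : Set (EuclideanSpace ℝ (Fin n)))] f :=
  ⟨⟨hf.toLp f, hg.toLp g, hfg.congr hf.coeFn_toLp.symm hg.coeFn_toLp.symm⟩, hf.coeFn_toLp⟩

theorem SobolevSpace.grad_ae_eq (F : SobolevSpace O p) {f : EuclideanSpace ℝ (Fin n) → ℝ}
    {g : EuclideanSpace ℝ (Fin n) → EuclideanSpace ℝ (Fin n)}
    (hg : MemLp g p (volume.restrict (O : Set (EuclideanSpace ℝ (Fin n)))))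
    (hfg : IsWeakGradient (O : Set (EuclideanSpace ℝ (Fin n))) f g)
    (hF : SobolevSpace.val O p F =ᵐ[volume.restrict (O : Set (EuclideanSpace ℝ (Fin n)))] f) :
    SobolevSpace.grad O p F =ᵐ[volume.restrict (O : Set (EuclideanSpace ℝ (Fin n)))] g := by
  have h1 : SobolevSpace.grad O p F = hg.toLp g :=
    F.isWeakGradient_grad.unique (hfg.congr hF.symm hg.coeFn_toLp.symm)
  rw [h1]
  exact hg.coeFn_toLp

theorem exists_sobolevSpace_of_contDiff {φ : EuclideanSpace ℝ (Fin n) → ℝ} (h : ContDiff ℝ ∞ φ)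
    (hc : HasCompactSupport φ) : ∃ F ∈ testRestrictions O p,
      SobolevSpace.val O p F =ᵐ[volume.restrict (O : Set (EuclideanSpace ℝ (Fin n)))] φ := by
  obtain ⟨F, hF⟩ := exists_sobolevSpace_of_memLp (O := O) (memLp_of_contDiff h hc p _)
    (memLp_gradient h hc p _) (isWeakGradient_gradient O.isOpen (h.of_le (by simp)).contDiffOn)
  exact ⟨F, ⟨φ, h, hc, hF⟩, hF⟩

theorem SobolevSpace.ofReal_norm_sub (T F : SobolevSpace O p)
    {φ : EuclideanSpace ℝ (Fin n) → ℝ} (h : ContDiff ℝ ∞ φ) (hc : HasCompactSupport φ)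
    (hT : SobolevSpace.val O p T =ᵐ[volume.restrict (O : Set (EuclideanSpace ℝ (Fin n)))] φ) :
    ENNReal.ofReal ‖T - F‖ = sobolevDist (O : Set (EuclideanSpace ℝ (Fin n))) p φ
      (SobolevSpace.val O p F) (SobolevSpace.grad O p F) := by
  have hT' := T.grad_ae_eq (memLp_gradient h hc p _)
    (isWeakGradient_gradient O.isOpen (h.of_le (by simp)).contDiffOn) hT
  rw [SobolevSpace.norm_def, map_sub, map_sub, ENNReal.ofReal_add (norm_nonneg _) (norm_nonneg _),
    ofReal_norm, ofReal_norm, Lp.enorm_def, Lp.enorm_def, sobolevDist]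
  congr 1
  · refine eLpNorm_congr_ae ?_
    filter_upwards [Lp.coeFn_sub (SobolevSpace.val O p T) (SobolevSpace.val O p F), hT]
      with x h1 h2
    rw [h1, Pi.sub_apply, h2]
  · refine eLpNorm_congr_ae ?_
    filter_upwards [Lp.coeFn_sub (SobolevSpace.grad O p T) (SobolevSpace.grad O p F), hT']
      with x h1 h2
    rw [h1, Pi.sub_apply, h2]

/-- Turns the closure in the Sobolev norm into estimates of `sobolevDist`, which make sense on each
half-cone separately. -/
theorem mem_closure_testRestrictions_iff {F : SobolevSpace O p} :
    F ∈ (testRestrictions O p).topologicalClosure ↔ ∀ δ : ℝ≥0∞, 0 < δ →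
      ∃ φ : EuclideanSpace ℝ (Fin n) → ℝ, ContDiff ℝ ∞ φ ∧ HasCompactSupport φ ∧
        sobolevDist (O : Set (EuclideanSpace ℝ (Fin n))) p φ
          (SobolevSpace.val O p F) (SobolevSpace.grad O p F) < δ := by
  rw [← SetLike.mem_coe, Submodule.topologicalClosure_coe, EMetric.mem_closure_iff]
  refine forall₂_congr fun δ hδ => ?_
  constructor
  · rintro ⟨T, ⟨φ, h1, h2, h3⟩, hd⟩
    refine ⟨φ, h1, h2, ?_⟩
    rwa [← T.ofReal_norm_sub F h1 h2 h3, ofReal_norm, ← edist_eq_enorm_sub, edist_comm]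
  · rintro ⟨φ, h1, h2, h3⟩
    obtain ⟨T, hT, hTφ⟩ := exists_sobolevSpace_of_contDiff (O := O) (p := p) h1 h2
    refine ⟨T, hT, ?_⟩
    rwa [edist_comm, edist_eq_enorm_sub, ← ofReal_norm, T.ofReal_norm_sub F h1 h2 hTφ]

end SobolevSpace

end ConeSobolev

/-! ### Geometry of the half-cones and gluing at the vertex -/

namespace ConeSobolev

section Geometry

variable {m : ℕ}

/-- The horizontal part of a vector. -/
noncomputable def horizontal (x : EuclideanSpace ℝ (Fin (m + 1))) : EuclideanSpace ℝ (Fin m) :=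
  WithLp.toLp 2 fun i => x i.castSucc

theorem norm_horizontal_sq (x : EuclideanSpace ℝ (Fin (m + 1))) :
    ‖horizontal x‖ ^ 2 = ∑ i : Fin m, x i.castSucc ^ 2 := by
  rw [EuclideanSpace.real_norm_sq_eq]
  rfl

theorem norm_sq_eq_horizontal_add (x : EuclideanSpace ℝ (Fin (m + 1))) :
    ‖x‖ ^ 2 = ‖horizontal x‖ ^ 2 + x (Fin.last m) ^ 2 := by
  rw [EuclideanSpace.real_norm_sq_eq, Fin.sum_univ_castSucc, norm_horizontal_sq]

theorem mem_cone_iff {x : EuclideanSpace ℝ (Fin (m + 1))} :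
    x ∈ cone m ↔ ‖horizontal x‖ < |x (Fin.last m)| := by
  change ∑ i : Fin m, x i.castSucc ^ 2 < x (Fin.last m) ^ 2 ↔ _
  rw [← norm_horizontal_sq, sq_lt_sq, abs_of_nonneg (norm_nonneg _)]

/-- In this form stability under addition is the triangle inequality. -/
theorem mem_upperCone_iff {x : EuclideanSpace ℝ (Fin (m + 1))} :
    x ∈ upperCone m ↔ ‖horizontal x‖ < x (Fin.last m) := by
  change x ∈ cone m ∧ 0 < x (Fin.last m) ↔ _
  rw [mem_cone_iff]
  constructor
  · rintro ⟨h1, h2⟩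
    rwa [abs_of_pos h2] at h1
  · intro h
    have h2 := (norm_nonneg _).trans_lt h
    exact ⟨by rwa [abs_of_pos h2], h2⟩

theorem mem_lowerCone_iff {x : EuclideanSpace ℝ (Fin (m + 1))} :
    x ∈ lowerCone m ↔ ‖horizontal x‖ < -x (Fin.last m) := by
  change x ∈ cone m ∧ x (Fin.last m) < 0 ↔ _
  rw [mem_cone_iff]
  constructor
  · rintro ⟨h1, h2⟩
    rwa [abs_of_neg h2] at h1
  · intro h
    have h2 := neg_pos.1 ((norm_nonneg _).trans_lt h)
    exact ⟨by rwa [abs_of_neg h2], h2⟩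

theorem horizontal_add (x y : EuclideanSpace ℝ (Fin (m + 1))) :
    horizontal (x + y) = horizontal x + horizontal y := rfl

theorem horizontal_smul (t : ℝ) (x : EuclideanSpace ℝ (Fin (m + 1))) :
    horizontal (t • x) = t • horizontal x := rfl

theorem isOpenConvexCone_upperCone (m : ℕ) : IsOpenConvexCone (upperCone m) where
  isOpen := (cone m).isOpen.inter (isOpen_lt continuous_const
    (EuclideanSpace.proj (𝕜 := ℝ) (Fin.last m)).continuous)
  nonempty := by
    refine ⟨EuclideanSpace.single (Fin.last m) 1, mem_upperCone_iff.2 ?_⟩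
    have : horizontal (EuclideanSpace.single (Fin.last m) (1 : ℝ)) = 0 := by
      ext i
      simp [horizontal]
    rw [this]
    simp
  add_mem x hx y hy := by
    rw [mem_upperCone_iff] at *
    rw [horizontal_add, PiLp.add_apply]
    linarith [norm_add_le (horizontal x) (horizontal y)]
  smul_mem t ht x hx := by
    rw [mem_upperCone_iff] at *
    rw [horizontal_smul, PiLp.smul_apply, norm_smul, Real.norm_of_nonneg ht.le, smul_eq_mul]
    exact mul_lt_mul_of_pos_left hx ht

theorem isOpenConvexCone_lowerCone (m : ℕ) : IsOpenConvexCone (lowerCone m) where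
  isOpen := (cone m).isOpen.inter (isOpen_lt
    (EuclideanSpace.proj (𝕜 := ℝ) (Fin.last m)).continuous continuous_const)
  nonempty := by
    refine ⟨EuclideanSpace.single (Fin.last m) (-1), mem_lowerCone_iff.2 ?_⟩
    have : horizontal (EuclideanSpace.single (Fin.last m) (-1 : ℝ)) = 0 := by
      ext i
      simp [horizontal]
    rw [this]
    simp
  add_mem x hx y hy := by
    rw [mem_lowerCone_iff] at *
    rw [horizontal_add, PiLp.add_apply]
    linarith [norm_add_le (horizontal x) (horizontal y)]
  smul_mem t ht x hx := by
    rw [mem_lowerCone_iff] at *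
    rw [horizontal_smul, PiLp.smul_apply, norm_smul, Real.norm_of_nonneg ht.le, smul_eq_mul,
      ← mul_neg]
    exact mul_lt_mul_of_pos_left hx ht

theorem upperCone_subset (m : ℕ) : upperCone m ⊆ cone m := fun _ hx => hx.1

theorem lowerCone_subset (m : ℕ) : lowerCone m ⊆ cone m := fun _ hx => hx.1

theorem cone_eq_union (m : ℕ) :
    (cone m : Set (EuclideanSpace ℝ (Fin (m + 1)))) = upperCone m ∪ lowerCone m := by
  refine Subset.antisymm (fun x hx => ?_) (union_subset (upperCone_subset m) (lowerCone_subset m))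
  have h0 : x (Fin.last m) ≠ 0 := by
    intro h0
    have h1 : ‖horizontal x‖ < |x (Fin.last m)| := mem_cone_iff.1 hx
    rw [h0, abs_zero] at h1
    exact (norm_nonneg _).not_gt h1
  rcases h0.lt_or_gt with h | h
  · exact Or.inr ⟨hx, h⟩
  · exact Or.inl ⟨hx, h⟩

theorem disjoint_upperCone_lowerCone (m : ℕ) : Disjoint (upperCone m) (lowerCone m) :=
  Set.disjoint_left.2 fun _ hx hy => lt_asymm hx.2 hy.2

/-- From `‖x‖² < 2 xₙ²`; the convenient constant `2` is the one behind the shift `1 / 2` in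
`coneCutoff`. -/
theorem norm_le_of_mem_upperCone {x : EuclideanSpace ℝ (Fin (m + 1))} (hx : x ∈ upperCone m) :
    ‖x‖ ≤ 2 * x (Fin.last m) := by
  rw [mem_upperCone_iff] at hx
  have h1 := norm_sq_eq_horizontal_add x
  have h2 := norm_nonneg (horizontal x)
  refine abs_le_of_sq_le_sq' ?_ (by linarith) |>.2
  nlinarith

theorem norm_le_of_mem_lowerCone {x : EuclideanSpace ℝ (Fin (m + 1))} (hx : x ∈ lowerCone m) :
    ‖x‖ ≤ 2 * -x (Fin.last m) := by
  rw [mem_lowerCone_iff] at hx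
  have h1 := norm_sq_eq_horizontal_add x
  have h2 := norm_nonneg (horizontal x)
  refine abs_le_of_sq_le_sq' ?_ (by linarith) |>.2
  nlinarith

theorem norm_pos_of_mem_cone {x : EuclideanSpace ℝ (Fin (m + 1))} (hx : x ∈ cone m) : 0 < ‖x‖ := by
  refine norm_pos_iff.2 fun h => ?_
  have h1 := mem_cone_iff.1 hx
  rw [h, PiLp.zero_apply, abs_zero] at h1
  exact (norm_nonneg _).not_gt h1

/-- A homogeneous function separating the two half-cones. -/
noncomputable def coneCutoff (x : EuclideanSpace ℝ (Fin (m + 1))) : ℝ :=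
  Real.smoothTransition (x (Fin.last m) / ‖x‖ + 1 / 2)

theorem coneCutoff_of_mem_upperCone {x : EuclideanSpace ℝ (Fin (m + 1))} (hx : x ∈ upperCone m) :
    coneCutoff x = 1 := by
  refine Real.smoothTransition.one_of_one_le ?_
  have h0 := norm_pos_of_mem_cone hx.1
  have : 1 / 2 ≤ x (Fin.last m) / ‖x‖ := by
    rw [le_div_iff₀ h0]
    linarith [norm_le_of_mem_upperCone hx]
  linarith

theorem coneCutoff_of_mem_lowerCone {x : EuclideanSpace ℝ (Fin (m + 1))} (hx : x ∈ lowerCone m) :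
    coneCutoff x = 0 := by
  refine Real.smoothTransition.zero_of_nonpos ?_
  have h0 := norm_pos_of_mem_cone hx.1
  have : x (Fin.last m) / ‖x‖ ≤ -(1 / 2) := by
    rw [div_le_iff₀ h0]
    linarith [norm_le_of_mem_lowerCone hx]
  linarith

theorem contDiffAt_coneCutoff {x : EuclideanSpace ℝ (Fin (m + 1))} (hx : x ≠ 0) :
    ContDiffAt ℝ ∞ coneCutoff x := by
  have h1 : ContDiffAt ℝ ∞ (fun x : EuclideanSpace ℝ (Fin (m + 1)) => x (Fin.last m)) x :=
    (EuclideanSpace.proj (𝕜 := ℝ) (Fin.last m)).contDiff.contDiffAt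
  exact Real.smoothTransition.contDiff.contDiffAt.comp x
    ((h1.div (contDiffAt_norm ℝ hx) (norm_ne_zero_iff.2 hx)).add contDiffAt_const)

/-- Test functions vanishing near the origin can be glued along the vertex. -/
theorem exists_glue {φ ψ : EuclideanSpace ℝ (Fin (m + 1)) → ℝ} (hφ : ContDiff ℝ ∞ φ)
    (hφc : HasCompactSupport φ) (hφ0 : ∀ᶠ x in 𝓝 0, φ x = 0) (hψ : ContDiff ℝ ∞ ψ)
    (hψc : HasCompactSupport ψ) (hψ0 : ∀ᶠ x in 𝓝 0, ψ x = 0) :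
    ∃ ξ : EuclideanSpace ℝ (Fin (m + 1)) → ℝ, ContDiff ℝ ∞ ξ ∧ HasCompactSupport ξ ∧
      EqOn ξ φ (upperCone m) ∧ EqOn ξ ψ (lowerCone m) := by
  refine ⟨fun x => coneCutoff x * φ x + (1 - coneCutoff x) * ψ x, ?_,
    hφc.mul_left.add hψc.mul_left, fun x hx => ?_, fun x hx => ?_⟩
  · rw [contDiff_iff_contDiffAt]
    intro x
    -- The cutoff has no smoothness at the origin; there the sum vanishes identically because both
    -- functions do.
    by_cases hx : x = 0
    · subst hx
      refine (contDiffAt_const (c := (0 : ℝ))).congr_of_eventuallyEq ?_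
      filter_upwards [hφ0, hψ0] with y h1 h2
      rw [h1, h2]
      ring
    · exact ((contDiffAt_coneCutoff hx).mul hφ.contDiffAt).add
        ((contDiffAt_const.sub (contDiffAt_coneCutoff hx)).mul hψ.contDiffAt)
  · simp [coneCutoff_of_mem_upperCone hx]
  · simp [coneCutoff_of_mem_lowerCone hx]

end Geometry

section Distance

variable {n : ℕ} {p : ℝ≥0∞}

theorem eLpNorm_restrict_union_le {F : Type*} [NormedAddCommGroup F] (hp1 : 1 ≤ p)
    {A B : Set (EuclideanSpace ℝ (Fin n))} (hA : MeasurableSet A) (hB : MeasurableSet B)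
    (hAB : Disjoint A B) {h : EuclideanSpace ℝ (Fin n) → F}
    (hh : AEStronglyMeasurable h (volume.restrict (A ∪ B))) :
    eLpNorm h p (volume.restrict (A ∪ B))
      ≤ eLpNorm h p (volume.restrict A) + eLpNorm h p (volume.restrict B) := by
  rw [← eLpNorm_indicator_eq_eLpNorm_restrict (hA.union hB),
    ← eLpNorm_indicator_eq_eLpNorm_restrict hA, ← eLpNorm_indicator_eq_eLpNorm_restrict hB,
    indicator_union_of_disjoint hAB]
  have hA' := hh.mono_measure (Measure.restrict_mono (subset_union_left (s := A) (t := B)) le_rfl)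
  have hB' := hh.mono_measure (Measure.restrict_mono (subset_union_right (s := A) (t := B)) le_rfl)
  exact eLpNorm_add_le ((aestronglyMeasurable_indicator_iff hA).2 hA')
    ((aestronglyMeasurable_indicator_iff hB).2 hB') hp1

/-- Equality on an open set entails equality of the gradients there. -/
theorem sobolevDist_congr {U : Set (EuclideanSpace ℝ (Fin n))} (hU : IsOpen U)
    {φ ψ f : EuclideanSpace ℝ (Fin n) → ℝ}
    {g : EuclideanSpace ℝ (Fin n) → EuclideanSpace ℝ (Fin n)} (h : EqOn φ ψ U) :
    sobolevDist U p φ f g = sobolevDist U p ψ f g := by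
  rw [sobolevDist, sobolevDist]
  congr 1
  · refine eLpNorm_congr_ae ?_
    filter_upwards [ae_restrict_mem hU.measurableSet] with x hx
    rw [h hx]
  · refine eLpNorm_congr_ae ?_
    filter_upwards [ae_restrict_mem hU.measurableSet] with x hx
    rw [(h.eventuallyEq_of_mem (hU.mem_nhds hx)).gradient_eq]

end Distance

/-! ### The closure of the test functions on the double cone -/

section Closure

variable {m : ℕ} {p : ℝ≥0∞}

theorem memLp_restrict_of_subset {F : Type*} [NormedAddCommGroup F]
    {O : TopologicalSpace.Opens (EuclideanSpace ℝ (Fin (m + 1)))}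
    {U : Set (EuclideanSpace ℝ (Fin (m + 1)))} (hU : U ⊆ O)
    (f : Lp F p (volume.restrict (O : Set (EuclideanSpace ℝ (Fin (m + 1)))))) :
    MemLp f p (volume.restrict U) :=
  (Lp.memLp f).mono_measure (Measure.restrict_mono hU le_rfl)

variable [hp : Fact (1 ≤ p)]

/-- Approximants on the two half-cones that vanish near the vertex are glued into one test function,
whose distance to `F` is at most the sum of the two distances. -/
theorem mem_closure_of_half_cones (F : SobolevSpace (cone m) p)
    (h : ∀ U, U = upperCone m ∨ U = lowerCone m → ∀ δ : ℝ≥0∞, 0 < δ →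
      ∃ ψ : EuclideanSpace ℝ (Fin (m + 1)) → ℝ, ContDiff ℝ ∞ ψ ∧ HasCompactSupport ψ ∧
        (∀ᶠ x in 𝓝 0, ψ x = 0) ∧ sobolevDist U p ψ (SobolevSpace.val (cone m) p F)
          (SobolevSpace.grad (cone m) p F) ≤ 5 * δ) :
    F ∈ (testRestrictions (cone m) p).topologicalClosure := by
  rw [mem_closure_testRestrictions_iff]
  intro δ hδ
  -- Two errors of `5 / 20` add up to half of the minimum; the cap at `1` keeps it finite, so that
  -- half is strictly less.
  have hδ' : 0 < min δ 1 := lt_min hδ one_pos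
  obtain ⟨φ, hφ, hφc, hφ0, h1⟩ := h _ (Or.inl rfl) (min δ 1 / 20)
    (ENNReal.div_pos hδ'.ne' (by norm_num))
  obtain ⟨ψ, hψ, hψc, hψ0, h2⟩ := h _ (Or.inr rfl) (min δ 1 / 20)
    (ENNReal.div_pos hδ'.ne' (by norm_num))
  obtain ⟨ξ, hξ, hξc, hξφ, hξψ⟩ := exists_glue hφ hφc hφ0 hψ hψc hψ0
  refine ⟨ξ, hξ, hξc, ?_⟩
  have hUo := (isOpenConvexCone_upperCone m).isOpen
  have hLo := (isOpenConvexCone_lowerCone m).isOpen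
  rw [← sobolevDist_congr hUo hξφ] at h1
  rw [← sobolevDist_congr hLo hξψ] at h2
  have hmf := (Lp.memLp (SobolevSpace.val (cone m) p F)).1
  have hmg := (Lp.memLp (SobolevSpace.grad (cone m) p F)).1
  have h3 : sobolevDist (cone m : Set (EuclideanSpace ℝ (Fin (m + 1)))) p ξ
      (SobolevSpace.val (cone m) p F) (SobolevSpace.grad (cone m) p F)
      ≤ 5 * (min δ 1 / 20) + 5 * (min δ 1 / 20) := by
    refine le_trans ?_ (add_le_add h1 h2)
    simp only [sobolevDist]
    have e1 := eLpNorm_restrict_union_le hp.out hUo.measurableSet hLo.measurableSet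
      (disjoint_upperCone_lowerCone m)
      (h := fun x => ξ x - SobolevSpace.val (cone m) p F x) (by
        rw [← cone_eq_union]
        exact hξ.continuous.aestronglyMeasurable.sub hmf)
    have e2 := eLpNorm_restrict_union_le hp.out hUo.measurableSet hLo.measurableSet
      (disjoint_upperCone_lowerCone m)
      (h := fun x => gradient ξ x - SobolevSpace.grad (cone m) p F x) (by
        rw [← cone_eq_union]
        exact (continuous_gradient hξ).aestronglyMeasurable.sub hmg)
    rw [← cone_eq_union] at e1 e2
    refine (add_le_add e1 e2).trans_eq ?_
    ring
  refine h3.trans_lt ?_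
  set ε := min δ 1 / 20 with hε
  have hε0 : ε ≠ 0 := (ENNReal.div_pos hδ'.ne' (by norm_num)).ne'
  have hεt : ε ≠ ⊤ :=
    ENNReal.div_ne_top ((min_le_right _ _).trans_lt ENNReal.one_lt_top).ne (by norm_num)
  calc 5 * ε + 5 * ε = ε * 10 := by ring
    _ < ε * 20 := (ENNReal.mul_lt_mul_iff_right hε0 hεt).2 (by norm_num)
    _ = min δ 1 := by rw [mul_comm, hε, ENNReal.mul_div_cancel (by norm_num) (by norm_num)]
    _ ≤ δ := min_le_left _ _

theorem subset_cone_of_eq {U : Set (EuclideanSpace ℝ (Fin (m + 1)))}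
    (hU : U = upperCone m ∨ U = lowerCone m) :
    IsOpenConvexCone U ∧ U ⊆ (cone m : Set (EuclideanSpace ℝ (Fin (m + 1)))) := by
  rcases hU with rfl | rfl
  · exact ⟨isOpenConvexCone_upperCone m, upperCone_subset m⟩
  · exact ⟨isOpenConvexCone_lowerCone m, lowerCone_subset m⟩

theorem mem_closure_of_le (hm : 1 ≤ m) (hpn : p ≤ ((m + 1 : ℕ) : ℝ≥0∞))
    (F : SobolevSpace (cone m) p) : F ∈ (testRestrictions (cone m) p).topologicalClosure := by
  refine mem_closure_of_half_cones F fun U hU δ hδ => ?_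
  obtain ⟨hUc, hUs⟩ := subset_cone_of_eq hU
  exact hUc.exists_sobolevDist_le_of_le (by omega) hp.out hpn (memLp_restrict_of_subset hUs _)
    (memLp_restrict_of_subset hUs _) (F.isWeakGradient_grad.mono hUs) hδ

theorem mem_closure_of_limit_zero (hpn : ((m + 1 : ℕ) : ℝ≥0∞) < p) (hpt : p ≠ ⊤)
    (F : SobolevSpace (cone m) p)
    (h1 : HasLimitAtVertex (upperCone m) (SobolevSpace.val (cone m) p F) 0)
    (h2 : HasLimitAtVertex (lowerCone m) (SobolevSpace.val (cone m) p F) 0) :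
    F ∈ (testRestrictions (cone m) p).topologicalClosure := by
  refine mem_closure_of_half_cones F fun U hU δ hδ => ?_
  obtain ⟨hUc, hUs⟩ := subset_cone_of_eq hU
  refine hUc.exists_sobolevDist_le_of_limit (by omega) hp.out hpn hpt
    (memLp_restrict_of_subset hUs _) (memLp_restrict_of_subset hUs _)
    (F.isWeakGradient_grad.mono hUs) ?_ hδ
  rcases hU with rfl | rfl
  · exact h1
  · exact h2

/-- Subtracting `c` times a test function equal to `1` at the origin reduces to limit zero on both
sides. -/
theorem mem_closure_of_limit (hpn : ((m + 1 : ℕ) : ℝ≥0∞) < p) (hpt : p ≠ ⊤)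
    (F : SobolevSpace (cone m) p) {c : ℝ}
    (h1 : HasLimitAtVertex (upperCone m) (SobolevSpace.val (cone m) p F) c)
    (h2 : HasLimitAtVertex (lowerCone m) (SobolevSpace.val (cone m) p F) c) :
    F ∈ (testRestrictions (cone m) p).topologicalClosure := by
  obtain ⟨η, hη, hηc, -, -, hη1, -⟩ := exists_cutoff (m + 1) one_pos
  obtain ⟨T, hT, hTη⟩ := exists_sobolevSpace_of_contDiff (O := cone m) (p := p) hη hηc
  have hlim : ∀ U : Set (EuclideanSpace ℝ (Fin (m + 1))), U ⊆ cone m →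
      HasLimitAtVertex U (SobolevSpace.val (cone m) p F) c →
      HasLimitAtVertex U (SobolevSpace.val (cone m) p (F + (-c) • T)) 0 := by
    intro U hU h
    have h3 := h.add ((hasLimitAtVertex_of_continuous (U := U) hη.continuous).const_smul (-c))
    rw [hη1 0 (by simp), mul_one, add_neg_cancel] at h3
    refine h3.congr (ae_mono (Measure.restrict_mono hU le_rfl) ?_)
    rw [map_add, map_smul]
    filter_upwards [hTη, Lp.coeFn_add (SobolevSpace.val (cone m) p F)
      (-c • SobolevSpace.val (cone m) p T), Lp.coeFn_smul (-c) (SobolevSpace.val (cone m) p T)]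
      with x e1 e2 e3
    rw [e2, Pi.add_apply, e3, Pi.smul_apply, e1]
    rfl
  have h4 := mem_closure_of_limit_zero hpn hpt _ (hlim _ (upperCone_subset m) h1)
    (hlim _ (lowerCone_subset m) h2)
  have h5 : F = (F + (-c) • T) + c • T := by
    rw [neg_smul]; abel
  rw [h5]
  exact Submodule.add_mem _ h4
    (Submodule.smul_mem _ _ (Submodule.le_topologicalClosure _ hT))

/-- A test function near `F` has one value `φ 0` at the origin, and both one-sided limits are within
a constant times the distance of it. -/
theorem limit_eq_of_mem_closure (hpn : ((m + 1 : ℕ) : ℝ≥0∞) < p) (hpt : p ≠ ⊤)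
    {F : SobolevSpace (cone m) p} (hF : F ∈ (testRestrictions (cone m) p).topologicalClosure)
    {c c' : ℝ} (h1 : HasLimitAtVertex (upperCone m) (SobolevSpace.val (cone m) p F) c)
    (h2 : HasLimitAtVertex (lowerCone m) (SobolevSpace.val (cone m) p F) c') : c = c' := by
  obtain ⟨C, hC, hu⟩ := (isOpenConvexCone_upperCone m).exists_hasLimitAtVertex hp.out hpn hpt
  obtain ⟨C', hC', hl⟩ := (isOpenConvexCone_lowerCone m).exists_hasLimitAtVertex hp.out hpn hpt
  obtain ⟨a, ha, hau⟩ := hu _ _ (memLp_restrict_of_subset (upperCone_subset m) _)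
    (memLp_restrict_of_subset (upperCone_subset m) _)
    (F.isWeakGradient_grad.mono (upperCone_subset m))
  obtain ⟨b, hb, hbl⟩ := hl _ _ (memLp_restrict_of_subset (lowerCone_subset m) _)
    (memLp_restrict_of_subset (lowerCone_subset m) _)
    (F.isWeakGradient_grad.mono (lowerCone_subset m))
  obtain rfl := h1.unique (isOpenConvexCone_upperCone m) ha
  obtain rfl := h2.unique (isOpenConvexCone_lowerCone m) hb
  rw [mem_closure_testRestrictions_iff] at hF
  have hCC : C + C' + 1 ≠ ⊤ := by simp [hC, hC']
  have key : ‖c - c'‖ₑ ≤ 0 := by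
    refine le_of_forall_gt fun ε hε => ?_
    obtain ⟨φ, hφ, -, hd⟩ := hF (ε / (C + C' + 1)) (ENNReal.div_pos hε.ne' hCC)
    have e1 := (hau φ hφ).trans (mul_le_mul_right (sobolevDist_mono (upperCone_subset m) _ _ _) C)
    have e2 := (hbl φ hφ).trans (mul_le_mul_right (sobolevDist_mono (lowerCone_subset m) _ _ _) C')
    have e3 : c - c' = (c - φ 0) - (c' - φ 0) := by ring
    rw [e3]
    set D := sobolevDist (cone m : Set (EuclideanSpace ℝ (Fin (m + 1)))) p φ
      (SobolevSpace.val (cone m) p F) (SobolevSpace.grad (cone m) p F)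
    calc ‖(c - φ 0) - (c' - φ 0)‖ₑ ≤ C * D + C' * D := enorm_sub_le.trans (add_le_add e1 e2)
      _ ≤ (C + C' + 1) * D := by
        rw [← add_mul]
        exact mul_le_mul_left le_self_add D
      _ < (C + C' + 1) * (ε / (C + C' + 1)) := (ENNReal.mul_lt_mul_iff_right (by simp) hCC).2 hd
      _ = ε := ENNReal.mul_div_cancel (by simp) hCC
  have := enorm_eq_zero.1 (le_antisymm key zero_le)
  linarith

end Closure

end ConeSobolev

/-! ### The case `p = ∞` -/

namespace ConeSobolev

section Lipschitz

variable {n : ℕ}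

/-- Rademacher's theorem: `gradient f` is the true gradient almost everywhere, and line derivatives
of Lipschitz functions can be integrated by parts. -/
theorem isWeakGradient_of_lipschitzWith {O : Set (EuclideanSpace ℝ (Fin n))}
    {f : EuclideanSpace ℝ (Fin n) → ℝ} {K : NNReal} (hf : LipschitzWith K f) :
    IsWeakGradient O f (gradient f) := by
  intro φ h1 h2 h3 i
  set v : EuclideanSpace ℝ (Fin n) := EuclideanSpace.single i 1
  obtain ⟨D, hD⟩ := h1.lipschitzWith_of_hasCompactSupport h2 (by simp)
  rw [setIntegral_eq_integral_of_tsupport_subset h3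
      (fun t ht => by rw [fderiv_apply_eq_zero_of_notMem_tsupport ht, mul_zero]),
    setIntegral_eq_integral_of_tsupport_subset h3
      (fun t ht => by rw [image_eq_zero_of_notMem_tsupport ht, mul_zero])]
  have h4 := hf.integral_lineDeriv_mul_eq (μ := volume) hD h2 v
  have h5 : ∫ x, gradient f x i * φ x = ∫ x, lineDeriv ℝ f x v * φ x := by
    refine integral_congr_ae ?_
    filter_upwards [hf.ae_differentiableAt (μ := volume)] with x hx
    rw [gradient_apply, hx.lineDeriv_eq_fderiv]
  have h6 : ∀ x, lineDeriv ℝ φ x (-v) * f x = - (f x * fderiv ℝ φ x v) := fun x => by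
    rw [((h1.differentiable (by simp)) x).lineDeriv_eq_fderiv, map_neg]
    ring
  rw [h5, h4]
  simp_rw [h6]
  rw [integral_neg, neg_neg]

theorem memLp_top_gradient_of_lipschitzWith {μ : Measure (EuclideanSpace ℝ (Fin n))}
    {f : EuclideanSpace ℝ (Fin n) → ℝ} {K : NNReal} (hf : LipschitzWith K f) :
    MemLp (gradient f) ⊤ μ := by
  have hm : Measurable (gradient f) :=
    (InnerProductSpace.toDual ℝ (EuclideanSpace ℝ (Fin n))).symm.continuous.measurable.comp
      (measurable_fderiv ℝ f)
  refine memLp_top_of_bound hm.aestronglyMeasurable K (Eventually.of_forall fun x => ?_)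
  rw [norm_gradient]
  exact norm_fderiv_le_of_lipschitz ℝ hf

theorem norm_mollify_le {F : Type*} [NormedAddCommGroup F] [NormedSpace ℝ F] [CompleteSpace F]
    {k : EuclideanSpace ℝ (Fin n) → ℝ} (hk : Continuous k)
    (hkc : HasCompactSupport k) (hk0 : ∀ t, 0 ≤ k t) (hk1 : ∫ t, k t = 1)
    {f : EuclideanSpace ℝ (Fin n) → F} (hf : LocallyIntegrable f volume) {N : ℝ}
    (hN : ∀ᵐ x, ‖f x‖ ≤ N) (x : EuclideanSpace ℝ (Fin n)) : ‖mollify k f x‖ ≤ N := by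
  have hN0 : 0 ≤ N := by
    obtain ⟨y, hy⟩ := hN.exists
    exact (norm_nonneg _).trans hy
  have h1 := enorm_mollify_sub_le hk hkc hk0 hk1 hf x 0
  simp only [sub_zero] at h1
  have h2 : ∀ᵐ t, ‖f (x - t)‖ ≤ N :=
    (Measure.measurePreserving_sub_left volume x).quasiMeasurePreserving.ae hN
  have h3 : ∫⁻ t, ENNReal.ofReal (k t) * ‖f (x - t)‖ₑ ≤ ENNReal.ofReal N := by
    calc ∫⁻ t, ENNReal.ofReal (k t) * ‖f (x - t)‖ₑ
        ≤ ∫⁻ t, ENNReal.ofReal (k t) * ENNReal.ofReal N := by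
          refine lintegral_mono_ae ?_
          filter_upwards [h2] with t ht
          rw [← ofReal_norm]
          gcongr
      _ = ENNReal.ofReal N := by
          rw [lintegral_mul_const _ hk.measurable.ennreal_ofReal,
            ← ofReal_integral_eq_lintegral_ofReal (hk.integrable_of_hasCompactSupport hkc)
              (Eventually.of_forall hk0), hk1, ENNReal.ofReal_one, one_mul]
  rw [← ofReal_norm] at h1
  exact (ENNReal.ofReal_le_ofReal_iff hN0).1 (h1.trans h3)

/-- On an open convex set a bounded function with bounded distributional gradient has a Lipschitz
representative. -/
theorem exists_lipschitzWith_ae_eq {U : Set (EuclideanSpace ℝ (Fin n))} (hU : IsOpen U)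
    (hUc : Convex ℝ U) {f : EuclideanSpace ℝ (Fin n) → ℝ}
    {g : EuclideanSpace ℝ (Fin n) → EuclideanSpace ℝ (Fin n)}
    (hf : MemLp f ⊤ (volume.restrict U)) (hg : MemLp g ⊤ (volume.restrict U))
    (hfg : IsWeakGradient U f g) :
    ∃ (h : EuclideanSpace ℝ (Fin n) → ℝ) (K : NNReal), LipschitzWith K h ∧
      f =ᵐ[volume.restrict U] h ∧ ∃ M, ∀ x ∈ U, |h x| ≤ M := by
  have hUm := hU.measurableSet
  set F := U.indicator f with hF
  set G := U.indicator g with hG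
  have hFf : F =ᵐ[volume.restrict U] f := indicator_ae_eq_restrict hUm
  have hGg : G =ᵐ[volume.restrict U] g := indicator_ae_eq_restrict hUm
  have hFL : MemLp F ⊤ volume := (memLp_indicator_iff_restrict hUm).2 hf
  have hGL : MemLp G ⊤ volume := (memLp_indicator_iff_restrict hUm).2 hg
  have hFl := hFL.locallyIntegrable le_top
  have hGl := hGL.locallyIntegrable le_top
  have hFG : IsWeakGradient U F G := hfg.congr hFf.symm hGg.symm
  have hbound : ∀ {E : Type} [NormedAddCommGroup E] {u : EuclideanSpace ℝ (Fin n) → E},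
      MemLp u ⊤ volume → ∃ N : ℝ, 0 ≤ N ∧ ∀ᵐ x, ‖u x‖ ≤ N := by
    intro E _ u hu
    refine ⟨(eLpNorm u ⊤ volume).toReal, ENNReal.toReal_nonneg, ?_⟩
    filter_upwards [enorm_ae_le_eLpNormEssSup u volume] with x hx
    rw [← eLpNorm_exponent_top] at hx
    rw [← toReal_enorm]
    exact ENNReal.toReal_mono hu.2.ne hx
  obtain ⟨N, hN0, hN⟩ := hbound hGL
  obtain ⟨M, hM0, hM⟩ := hbound hFL
  -- The radii keep ratio `2`, as required for convergence of the mollifications almost everywhere.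
  let b : ℕ → ContDiffBump (0 : EuclideanSpace ℝ (Fin n)) := fun k =>
    ⟨1 / ((k : ℝ) + 1) / 2, 1 / ((k : ℝ) + 1), by positivity, half_lt_self (by positivity)⟩
  have hbr : Tendsto (fun k => (b k).rOut) atTop (𝓝 0) := tendsto_one_div_add_atTop_nhds_zero_nat
  have hae := ContDiffBump.ae_convolution_tendsto_right_of_locallyIntegrable (φ := b) (K := 2)
    (μ := volume) hbr (Eventually.of_forall fun k => by
      change 1 / ((k : ℝ) + 1) ≤ 2 * (1 / ((k : ℝ) + 1) / 2)
      linarith) hFl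
  -- Almost every point of `U` is in `S`, and on `S` Lipschitz bounds pass from the mollifications
  -- to `F` itself.
  set S : Set (EuclideanSpace ℝ (Fin n)) := {x | x ∈ U ∧
    Tendsto (fun k => mollify ((b k).normed volume) F x) atTop (𝓝 (F x))} with hS
  have hlip : LipschitzOnWith N.toNNReal F S := by
    refine LipschitzOnWith.of_dist_le_mul fun x hx y hy => ?_
    rw [Real.coe_toNNReal _ hN0, dist_eq_norm, dist_eq_norm]
    have hseg : segment ℝ y x ⊆ U := hUc.segment_subset hy.1 hx.1
    have hcomp : IsCompact (segment ℝ y x) := by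
      rw [segment_eq_image]
      exact isCompact_Icc.image (by fun_prop)
    -- Once the kernel radius is below `ε`, along the segment the gradient of the mollification is
    -- the mollification of `G`, bounded by `N`; the mean value inequality applies with constant
    -- `N`.
    obtain ⟨ε, hε, hεU⟩ := hcomp.exists_thickening_subset_open hU hseg
    refine le_of_tendsto (hx.2.sub hy.2).norm ?_
    filter_upwards [hbr.eventually (gt_mem_nhds hε)] with k hk
    have hd := contDiff_mollify ((b k).contDiff_normed (μ := volume))
      (b k).hasCompactSupport_normed hFl
    refine (convex_segment y x).norm_image_sub_le_of_norm_fderiv_le (𝕜 := ℝ)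
      (fun z _ => (hd.differentiable (by simp)) z) (fun z hz => ?_)
      (left_mem_segment ℝ y x) (right_mem_segment ℝ y x)
    rw [← norm_gradient, gradient_mollify (b k).contDiff_normed (b k).hasCompactSupport_normed
      hFl hGl hFG fun w hw => hεU ?_]
    · exact norm_mollify_le ((b k).contDiff_normed (n := 0)).continuous (b k).hasCompactSupport_normed
        (b k).nonneg_normed (b k).integral_normed hGl hN z
    · rw [Metric.mem_thickening_iff]
      refine ⟨z, hz, ?_⟩
      rw [(b k).tsupport_normed_eq, mem_closedBall_zero_iff] at hw
      rw [dist_eq_norm, sub_sub_cancel_left, norm_neg]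
      exact hw.trans_lt hk
  obtain ⟨h, hh, hhF⟩ := hlip.extend_real
  have hfh : f =ᵐ[volume.restrict U] h := by
    filter_upwards [hFf, ae_restrict_of_ae hae, ae_restrict_mem hUm] with x h1 h2 h3
    rw [← h1]
    exact hhF ⟨h3, h2⟩
  refine ⟨h, _, hh, hfh, M, ?_⟩
  -- The almost everywhere bound, written as an equality of continuous functions so that it extends
  -- to every point of `U`.
  have h4 : (fun x => max |h x| M) =ᵐ[volume.restrict U] fun _ => M := by
    filter_upwards [hfh, hFf, ae_restrict_of_ae hM] with x h1 h2 h3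
    rw [← h1, ← h2]
    exact max_eq_right h3
  have h5 := Measure.eqOn_open_of_ae_eq (μ := volume) h4 hU
    (hh.continuous.abs.max continuous_const).continuousOn continuousOn_const
  intro x hx
  have := h5 hx
  simpa using this

theorem IsOpenConvexCone.convex {U : Set (EuclideanSpace ℝ (Fin n))} (hU : IsOpenConvexCone U) :
    Convex ℝ U := by
  refine convex_iff_forall_pos.2 fun x hx y hy a b ha hb _ => ?_
  exact hU.add_mem _ (hU.smul_mem a ha x hx) _ (hU.smul_mem b hb y hy)

end Lipschitz

section Top

variable {m : ℕ}

/-- A Lipschitz extension to the whole space reduces this to Rademacher's theorem. -/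
theorem boundedLipschitz_le_sobolev {n : ℕ}
    (O : TopologicalSpace.Opens (EuclideanSpace ℝ (Fin n))) :
    boundedLipschitz O ⊤ ≤ sobolev O ⊤ := by
  rintro f ⟨g, hfg, ⟨K, hK⟩, -, -⟩
  obtain ⟨h, hh, hgh⟩ := hK.extend_real
  have hfh : f =ᵐ[volume.restrict (O : Set (EuclideanSpace ℝ (Fin n)))] h := by
    filter_upwards [hfg, ae_restrict_mem O.isOpen.measurableSet] with x h1 h2
    rw [h1, hgh h2]
  have hgL := memLp_top_gradient_of_lipschitzWith
    (μ := volume.restrict (O : Set (EuclideanSpace ℝ (Fin n)))) hh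
  exact ⟨hgL.toLp _, (isWeakGradient_of_lipschitzWith hh).congr hfh.symm hgL.coeFn_toLp.symm⟩

theorem exists_lipschitzWith_of_mem_sobolev_top {U : Set (EuclideanSpace ℝ (Fin (m + 1)))}
    (hU : IsOpenConvexCone U) (hUs : U ⊆ cone m)
    {f : Lp ℝ ⊤ (volume.restrict (cone m : Set (EuclideanSpace ℝ (Fin (m + 1)))))}
    (hf : f ∈ sobolev (cone m) ⊤) :
    ∃ (h : EuclideanSpace ℝ (Fin (m + 1)) → ℝ) (K : NNReal), LipschitzWith K h ∧
      f =ᵐ[volume.restrict U] h ∧ ∃ M, ∀ x ∈ U, |h x| ≤ M := by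
  obtain ⟨g, hg⟩ := hf
  exact exists_lipschitzWith_ae_eq hU.isOpen hU.convex (memLp_restrict_of_subset hUs f)
    (memLp_restrict_of_subset hUs g) (hg.mono hUs)

theorem exists_hasLimitAtVertex_of_mem_sobolev_top {U : Set (EuclideanSpace ℝ (Fin (m + 1)))}
    (hU : IsOpenConvexCone U) (hUs : U ⊆ cone m)
    {f : Lp ℝ ⊤ (volume.restrict (cone m : Set (EuclideanSpace ℝ (Fin (m + 1)))))}
    (hf : f ∈ sobolev (cone m) ⊤) : ∃ c, HasLimitAtVertex U f c := by
  obtain ⟨h, K, hK, hfh, -⟩ := exists_lipschitzWith_of_mem_sobolev_top hU hUs hf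
  exact ⟨h 0, (hasLimitAtVertex_of_continuous hK.continuous).congr hfh⟩

theorem hasLimitAtVertex_of_mem_boundedLipschitz
    {f : Lp ℝ ⊤ (volume.restrict (cone m : Set (EuclideanSpace ℝ (Fin (m + 1)))))}
    (hf : f ∈ boundedLipschitz (cone m) ⊤) :
    ∃ c, HasLimitAtVertex (upperCone m) f c ∧ HasLimitAtVertex (lowerCone m) f c := by
  obtain ⟨g, hfg, ⟨K, hK⟩, -, c, hc⟩ := hf
  have key : ∀ U : Set (EuclideanSpace ℝ (Fin (m + 1))), U ⊆ cone m → HasLimitAtVertex U f c :=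
    fun U hU => ⟨g, ae_mono (Measure.restrict_mono hU le_rfl) hfg, hK.continuousOn.mono hU,
      hc.mono_left (nhdsWithin_mono _ hU)⟩
  exact ⟨c, key _ (upperCone_subset m), key _ (lowerCone_subset m)⟩

-- For `x` and `y` in opposite half-cones the last coordinates have opposite signs, so `‖x‖` and
-- `‖y‖` are at most `2 * dist x y`. Comparing both values with the common value `c` at the vertex
-- then yields the Lipschitz estimate across it.
open Classical in
theorem mem_boundedLipschitz_of_limit
    {f : Lp ℝ ⊤ (volume.restrict (cone m : Set (EuclideanSpace ℝ (Fin (m + 1)))))}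
    (hf : f ∈ sobolev (cone m) ⊤) {c : ℝ} (hu : HasLimitAtVertex (upperCone m) f c)
    (hl : HasLimitAtVertex (lowerCone m) f c) : f ∈ boundedLipschitz (cone m) ⊤ := by
  have hUC := isOpenConvexCone_upperCone m
  have hLC := isOpenConvexCone_lowerCone m
  obtain ⟨h, K, hK, hfh, M, hM⟩ :=
    exists_lipschitzWith_of_mem_sobolev_top hUC (upperCone_subset m) hf
  obtain ⟨h', K', hK', hfh', M', hM'⟩ :=
    exists_lipschitzWith_of_mem_sobolev_top hLC (lowerCone_subset m) hf
  have h0 : h 0 = c := HasLimitAtVertex.unique hUC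
    ((hasLimitAtVertex_of_continuous hK.continuous).congr hfh) hu
  have h0' : h' 0 = c := HasLimitAtVertex.unique hLC
    ((hasLimitAtVertex_of_continuous hK'.continuous).congr hfh') hl
  set g : EuclideanSpace ℝ (Fin (m + 1)) → ℝ := (upperCone m).piecewise h h' with hg
  have hgu : EqOn g h (upperCone m) := piecewise_eqOn _ _ _
  have hgl : EqOn g h' (lowerCone m) := (piecewise_eqOn_compl _ _ _).mono
    (disjoint_upperCone_lowerCone m).subset_compl_left
  have hcross : ∀ x ∈ upperCone m, ∀ y ∈ lowerCone m,
      |h x - h' y| ≤ 2 * (K + K') * dist x y := by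
    intro x hx y hy
    have e1 : |h x - c| ≤ K * ‖x‖ := by
      have := hK.dist_le_mul x 0
      rwa [h0, dist_zero_right, Real.dist_eq] at this
    have e2 : |h' y - c| ≤ K' * ‖y‖ := by
      have := hK'.dist_le_mul y 0
      rwa [h0', dist_zero_right, Real.dist_eq] at this
    have e3 : x (Fin.last m) - y (Fin.last m) ≤ dist x y := by
      rw [dist_eq_norm]
      exact (le_abs_self _).trans (PiLp.norm_apply_le (x - y) (Fin.last m))
    have e4 := norm_le_of_mem_upperCone hx
    have e5 := norm_le_of_mem_lowerCone hy
    have e6 : ‖x‖ ≤ 2 * dist x y := by linarith [norm_nonneg y]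
    have e7 : ‖y‖ ≤ 2 * dist x y := by linarith [norm_nonneg x]
    have e8 : |h x - h' y| ≤ |h x - c| + |h' y - c| := by
      rw [abs_sub_comm (h' y) c]
      exact abs_sub_le _ _ _
    have e9 := mul_le_mul_of_nonneg_left e6 K.coe_nonneg
    have e10 := mul_le_mul_of_nonneg_left e7 K'.coe_nonneg
    linarith
  have hmem : ∀ x ∈ cone m, x ∈ upperCone m ∨ x ∈ lowerCone m := fun x hx => by
    have : x ∈ (cone m : Set (EuclideanSpace ℝ (Fin (m + 1)))) := hx
    rwa [cone_eq_union] at this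
  refine ⟨g, ?_, ⟨2 * (K + K'), ?_⟩, ⟨max M M', fun x hx => ?_⟩, c, ?_⟩
  · have hae : ∀ᵐ x ∂volume.restrict (upperCone m ∪ lowerCone m), f x = g x := by
      refine (ae_restrict_union_iff _ _ _).2 ⟨?_, ?_⟩
      · filter_upwards [hfh, ae_restrict_mem hUC.isOpen.measurableSet] with x h1 h2
        rw [h1, hgu h2]
      · filter_upwards [hfh', ae_restrict_mem hLC.isOpen.measurableSet] with x h1 h2
        rw [h1, hgl h2]
    rwa [← cone_eq_union] at hae
  · refine LipschitzOnWith.of_dist_le_mul fun x hx y hy => ?_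
    push_cast
    have hd : 0 ≤ dist x y := dist_nonneg
    have hK0 := mul_nonneg K.coe_nonneg hd
    have hK0' := mul_nonneg K'.coe_nonneg hd
    rcases hmem x hx with hx | hx <;> rcases hmem y hy with hy | hy
    · rw [hgu hx, hgu hy]
      linarith [hK.dist_le_mul x y]
    · rw [hgu hx, hgl hy, Real.dist_eq]
      exact hcross x hx y hy
    · rw [hgl hx, hgu hy, Real.dist_eq, abs_sub_comm, dist_comm x y]
      exact hcross y hy x hx
    · rw [hgl hx, hgl hy]
      linarith [hK'.dist_le_mul x y]
  · rcases hmem x hx with hx | hx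
    · rw [hgu hx]
      exact (hM x hx).trans (le_max_left _ _)
    · rw [hgl hx]
      exact (hM' x hx).trans (le_max_right _ _)
  · rw [cone_eq_union, nhdsWithin_union, tendsto_sup]
    constructor
    · refine Tendsto.congr' ?_ ((h0 ▸ hK.continuous.tendsto 0).mono_left nhdsWithin_le_nhds)
      filter_upwards [self_mem_nhdsWithin] with x hx
      exact (hgu hx).symm
    · refine Tendsto.congr' ?_ ((h0' ▸ hK'.continuous.tendsto 0).mono_left nhdsWithin_le_nhds)
      filter_upwards [self_mem_nhdsWithin] with x hx
      exact (hgl hx).symm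

end Top

end ConeSobolev

/-! ### The characterization for `p > n` and the codimension -/

namespace ConeSobolev

variable {m : ℕ} {p : ℝ≥0∞} [hp : Fact (1 ≤ p)]

theorem sobolevTilde_of_ne_top (hpt : p ≠ ⊤) :
    sobolevTilde (cone m) p
      = (testRestrictions (cone m) p).topologicalClosure.map (SobolevSpace.val (cone m) p) :=
  if_neg hpt

theorem sobolevTilde_top : sobolevTilde (cone m) ⊤ = boundedLipschitz (cone m) ⊤ :=
  if_pos rfl

theorem sobolevTilde_eq_sobolev (hm : 1 ≤ m) (hpn : p ≤ ((m + 1 : ℕ) : ℝ≥0∞)) :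
    sobolevTilde (cone m) p = sobolev (cone m) p := by
  have hpt : p ≠ ⊤ := (hpn.trans_lt (ENNReal.natCast_lt_top _)).ne
  rw [sobolevTilde_of_ne_top hpt]
  ext f
  rw [mem_sobolev_iff, Submodule.mem_map]
  exact ⟨fun ⟨F, _, h⟩ => ⟨F, h⟩, fun ⟨F, h⟩ => ⟨F, mem_closure_of_le hm hpn F, h⟩⟩

theorem exists_hasLimitAtVertex_of_mem_sobolev (hpn : ((m + 1 : ℕ) : ℝ≥0∞) < p)
    {U : Set (EuclideanSpace ℝ (Fin (m + 1)))} (hU : IsOpenConvexCone U) (hUs : U ⊆ cone m)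
    {f : Lp ℝ p (volume.restrict (cone m : Set (EuclideanSpace ℝ (Fin (m + 1)))))}
    (hf : f ∈ sobolev (cone m) p) : ∃ c, HasLimitAtVertex U f c := by
  by_cases hpt : p = ⊤
  · subst hpt
    exact exists_hasLimitAtVertex_of_mem_sobolev_top hU hUs hf
  · obtain ⟨C, -, h⟩ := hU.exists_hasLimitAtVertex hp.out hpn hpt
    obtain ⟨g, hg⟩ := hf
    obtain ⟨c, hc, -⟩ := h f g (memLp_restrict_of_subset hUs f) (memLp_restrict_of_subset hUs g)
      (hg.mono hUs)
    exact ⟨c, hc⟩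

theorem mem_sobolevTilde_iff (hpn : ((m + 1 : ℕ) : ℝ≥0∞) < p)
    {f : Lp ℝ p (volume.restrict (cone m : Set (EuclideanSpace ℝ (Fin (m + 1)))))} :
    f ∈ sobolevTilde (cone m) p ↔ f ∈ sobolev (cone m) p ∧
      ∃ c : ℝ, HasLimitAtVertex (upperCone m) f c ∧ HasLimitAtVertex (lowerCone m) f c := by
  by_cases hpt : p = ⊤
  · subst hpt
    rw [sobolevTilde_top]
    exact ⟨fun h => ⟨boundedLipschitz_le_sobolev _ h, hasLimitAtVertex_of_mem_boundedLipschitz h⟩,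
      fun ⟨h, _, h1, h2⟩ => mem_boundedLipschitz_of_limit h h1 h2⟩
  · rw [sobolevTilde_of_ne_top hpt, Submodule.mem_map]
    constructor
    · rintro ⟨F, hF, rfl⟩
      obtain ⟨c, hc⟩ := exists_hasLimitAtVertex_of_mem_sobolev hpn (isOpenConvexCone_upperCone m)
        (upperCone_subset m) (mem_sobolev_iff.2 ⟨F, rfl⟩)
      obtain ⟨c', hc'⟩ := exists_hasLimitAtVertex_of_mem_sobolev hpn (isOpenConvexCone_lowerCone m)
        (lowerCone_subset m) (mem_sobolev_iff.2 ⟨F, rfl⟩)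
      obtain rfl := limit_eq_of_mem_closure hpn hpt hF hc hc'
      exact ⟨mem_sobolev_iff.2 ⟨F, rfl⟩, c, hc, hc'⟩
    · rintro ⟨hf, c, hc, hc'⟩
      obtain ⟨F, rfl⟩ := mem_sobolev_iff.1 hf
      exact ⟨F, mem_closure_of_limit hpn hpt F hc hc', rfl⟩

/-- The limit at the vertex, as a linear functional on `W^1_p`, `p > n`. -/
noncomputable def vertexLimit (hpn : ((m + 1 : ℕ) : ℝ≥0∞) < p)
    {U : Set (EuclideanSpace ℝ (Fin (m + 1)))} (hU : IsOpenConvexCone U) (hUs : U ⊆ cone m) :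
    ↥(sobolev (cone m) p) →ₗ[ℝ] ℝ where
  toFun f := (exists_hasLimitAtVertex_of_mem_sobolev hpn hU hUs f.2).choose
  map_add' f f' := by
    refine HasLimitAtVertex.unique hU
      (exists_hasLimitAtVertex_of_mem_sobolev hpn hU hUs (f + f').2).choose_spec ?_
    refine ((exists_hasLimitAtVertex_of_mem_sobolev hpn hU hUs f.2).choose_spec.add
      (exists_hasLimitAtVertex_of_mem_sobolev hpn hU hUs f'.2).choose_spec).congr ?_
    exact ae_mono (Measure.restrict_mono hUs le_rfl) (Lp.coeFn_add f.1 f'.1)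
  map_smul' a f := by
    refine HasLimitAtVertex.unique hU
      (exists_hasLimitAtVertex_of_mem_sobolev hpn hU hUs (a • f).2).choose_spec ?_
    refine ((exists_hasLimitAtVertex_of_mem_sobolev hpn hU hUs f.2).choose_spec.const_smul
      a).congr ?_
    exact ae_mono (Measure.restrict_mono hUs le_rfl) (Lp.coeFn_smul a f.1)

theorem hasLimitAtVertex_vertexLimit (hpn : ((m + 1 : ℕ) : ℝ≥0∞) < p)
    {U : Set (EuclideanSpace ℝ (Fin (m + 1)))} (hU : IsOpenConvexCone U) (hUs : U ⊆ cone m)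
    (f : ↥(sobolev (cone m) p)) : HasLimitAtVertex U f.1 (vertexLimit hpn hU hUs f) :=
  (exists_hasLimitAtVertex_of_mem_sobolev hpn hU hUs f.2).choose_spec

/-- A cutoff restricted to the upper half-cone and extended by zero is smooth on the double cone,
since the two halves are disjoint open sets; its jump occurs only at the vertex. -/
theorem exists_mem_sobolev_one_zero (m : ℕ) (p : ℝ≥0∞) [Fact (1 ≤ p)] :
    ∃ f ∈ sobolev (cone m) p, HasLimitAtVertex (upperCone m) f 1 ∧
      HasLimitAtVertex (lowerCone m) f 0 := by
  obtain ⟨χ, hχ, hχc, -, -, hχ1, -⟩ := exists_cutoff (m + 1) one_pos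
  have hUC := isOpenConvexCone_upperCone m
  have hLC := isOpenConvexCone_lowerCone m
  have hUm := hUC.isOpen.measurableSet
  set w := (upperCone m).indicator χ with hw
  have hwu : EqOn w χ (upperCone m) := fun x hx => indicator_of_mem hx _
  have hwl : EqOn w 0 (lowerCone m) := fun x hx =>
    indicator_of_notMem (Set.disjoint_right.1 (disjoint_upperCone_lowerCone m) hx) _
  have hcd : ContDiffOn ℝ 1 w (cone m : Set (EuclideanSpace ℝ (Fin (m + 1)))) := by
    rw [cone_eq_union]
    rintro x (hx | hx)
    · exact ((hχ.of_le (by simp)).contDiffAt.congr_of_eventuallyEq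
        (hwu.eventuallyEq_of_mem (hUC.isOpen.mem_nhds hx))).contDiffWithinAt
    · exact ((contDiffAt_const (c := (0 : ℝ))).congr_of_eventuallyEq
        (hwl.eventuallyEq_of_mem (hLC.isOpen.mem_nhds hx))).contDiffWithinAt
  have hg : gradient w =ᵐ[volume.restrict (cone m : Set (EuclideanSpace ℝ (Fin (m + 1))))]
      (upperCone m).indicator (gradient χ) := by
    filter_upwards [ae_restrict_mem (cone m).isOpen.measurableSet] with x hx
    rw [cone_eq_union] at hx
    rcases hx with hx | hx
    · rw [indicator_of_mem hx, (hwu.eventuallyEq_of_mem (hUC.isOpen.mem_nhds hx)).gradient_eq]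
    · rw [indicator_of_notMem (Set.disjoint_right.1 (disjoint_upperCone_lowerCone m) hx)]
      exact gradient_eq_zero_of_eventuallyEq_const
        (hwl.eventuallyEq_of_mem (hLC.isOpen.mem_nhds hx))
  obtain ⟨F, hF⟩ := exists_sobolevSpace_of_memLp (O := cone m) (p := p)
    ((memLp_of_contDiff hχ hχc p _).indicator hUm)
    (((memLp_gradient hχ hχc p _).indicator hUm).ae_eq hg.symm)
    (isWeakGradient_gradient (cone m).isOpen hcd)
  refine ⟨_, mem_sobolev_iff.2 ⟨F, rfl⟩, ⟨χ, ?_, hχ.continuous.continuousOn, ?_⟩,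
    ⟨0, ?_, continuousOn_const, tendsto_const_nhds⟩⟩
  · filter_upwards [ae_mono (Measure.restrict_mono (upperCone_subset m) le_rfl) hF,
      ae_restrict_mem hUm] with x h1 h2
    rw [h1, ← hwu h2]
  · have := (hχ.continuous.tendsto 0).mono_left (nhdsWithin_le_nhds (s := upperCone m))
    rwa [hχ1 0 (by simp)] at this
  · filter_upwards [ae_mono (Measure.restrict_mono (lowerCone_subset m) le_rfl) hF,
      ae_restrict_mem hLC.isOpen.measurableSet] with x h1 h2
    rw [h1, ← hwl h2]

/-- The tilde space is the kernel of `J`, the difference of the two limits, and `J` takes the value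
`1` on the function with limits `1` and `0`; hence the quotient is a line. -/
theorem finrank_quotient_sobolevTilde (hpn : ((m + 1 : ℕ) : ℝ≥0∞) < p) :
    Module.finrank ℝ
      (↥(sobolev (cone m) p) ⧸ (sobolevTilde (cone m) p).submoduleOf (sobolev (cone m) p)) = 1 := by
  have hUC := isOpenConvexCone_upperCone m
  have hLC := isOpenConvexCone_lowerCone m
  set J : ↥(sobolev (cone m) p) →ₗ[ℝ] ℝ := vertexLimit hpn hUC (upperCone_subset m)
    - vertexLimit hpn hLC (lowerCone_subset m) with hJ
  have hker : (sobolevTilde (cone m) p).submoduleOf (sobolev (cone m) p) = LinearMap.ker J := by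
    ext f
    have hu := hasLimitAtVertex_vertexLimit hpn hUC (upperCone_subset m) f
    have hl := hasLimitAtVertex_vertexLimit hpn hLC (lowerCone_subset m) f
    rw [LinearMap.mem_ker, hJ, LinearMap.sub_apply, sub_eq_zero]
    change f.1 ∈ sobolevTilde (cone m) p ↔ _
    rw [mem_sobolevTilde_iff hpn]
    constructor
    · rintro ⟨-, c, h1, h2⟩
      rw [hu.unique hUC h1, hl.unique hLC h2]
    · intro h
      rw [← h] at hl
      exact ⟨f.2, _, hu, hl⟩
  have hsurj : Function.Surjective J := by
    obtain ⟨f, hf, h1, h2⟩ := exists_mem_sobolev_one_zero m p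
    refine LinearMap.surjective fun h0 => ?_
    have h3 : J ⟨f, hf⟩ = 1 := by
      rw [hJ, LinearMap.sub_apply,
        (hasLimitAtVertex_vertexLimit hpn hUC (upperCone_subset m) ⟨f, hf⟩).unique hUC h1,
        (hasLimitAtVertex_vertexLimit hpn hLC (lowerCone_subset m) ⟨f, hf⟩).unique hLC h2, sub_zero]
    rw [h0] at h3
    exact zero_ne_one h3
  rw [hker, (J.quotKerEquivOfSurjective hsurj).finrank_eq, Module.finrank_self]

end ConeSobolev

theorem corollary2p2 (m : ℕ) (hm : 1 ≤ m) (p : ℝ≥0∞) [Fact (1 ≤ p)] :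
    (p ≤ ((m + 1 : ℕ) : ℝ≥0∞) →
      ConeSobolev.sobolevTilde (ConeSobolev.cone m) p
        = ConeSobolev.sobolev (ConeSobolev.cone m) p) ∧
    (((m + 1 : ℕ) : ℝ≥0∞) < p →
      -- the one-sided limits `f(0⁺)` and `f(0⁻)` exist and are unique
      (∀ f ∈ ConeSobolev.sobolev (ConeSobolev.cone m) p,
        (∃! c : ℝ, ConeSobolev.HasLimitAtVertex (ConeSobolev.upperCone m) f c) ∧
        (∃! c : ℝ, ConeSobolev.HasLimitAtVertex (ConeSobolev.lowerCone m) f c)) ∧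
      (ConeSobolev.sobolevTilde (ConeSobolev.cone m) p : Set _)
        = {f | f ∈ ConeSobolev.sobolev (ConeSobolev.cone m) p ∧
            ∃ c : ℝ, ConeSobolev.HasLimitAtVertex (ConeSobolev.upperCone m) f c ∧
              ConeSobolev.HasLimitAtVertex (ConeSobolev.lowerCone m) f c} ∧
      -- `W̃^1_p(Ω)` has codimension 1 in `W^1_p(Ω)`
      Module.finrank ℝ
        (↥(ConeSobolev.sobolev (ConeSobolev.cone m) p) ⧸
          (ConeSobolev.sobolevTilde (ConeSobolev.cone m) p).submoduleOf
            (ConeSobolev.sobolev (ConeSobolev.cone m) p)) = 1) := by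
  refine ⟨ConeSobolev.sobolevTilde_eq_sobolev hm, fun hpn => ⟨fun f hf => ⟨?_, ?_⟩, ?_,
    ConeSobolev.finrank_quotient_sobolevTilde hpn⟩⟩
  · have hU := ConeSobolev.isOpenConvexCone_upperCone m
    obtain ⟨c, hc⟩ := ConeSobolev.exists_hasLimitAtVertex_of_mem_sobolev hpn hU
      (ConeSobolev.upperCone_subset m) hf
    exact ⟨c, hc, fun c' hc' => hc'.unique hU hc⟩
  · have hU := ConeSobolev.isOpenConvexCone_lowerCone m
    obtain ⟨c, hc⟩ := ConeSobolev.exists_hasLimitAtVertex_of_mem_sobolev hpn hU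
      (ConeSobolev.lowerCone_subset m) hf
    exact ⟨c, hc, fun c' hc' => hc'.unique hU hc⟩
  · ext f
    exact ConeSobolev.mem_sobolevTilde_iff hpn
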